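/- Let $I$ be a finite set and let $A=(a_{ij})_{i,j\in I}$ be a real generalized Cartan matrix, i.e. $a_{ii}=2$; for $i\ne j$ the entries $a_{ij},a_{ji}$ are either both strictly negative or both zero; and for $i\neq j$ with $a_{ij}a_{ji}<4$ one has $a_{ij}a_{ji}=4\cos^2(\pi/m)$ for some integer $m\ge 2$. Let $\mathfrak h$ be a finite-dimensional real vector space with families $(h_i)_{i\in I}$ in $\mathfrak h$ and $(\alpha_i)_{i\in I}$ in $\mathfrak h^*$ such that $\alpha_j(h_i)=a_{ij}$ and the $h_i$ are positively independent ($\sum_i r_ih_i=0$ with all $r_i\ge 0$ implies all $r_i=0$); that is, a root base of a linear Coxeter system. Let $\mathcal W\subseteq GL(\mathfrak h^*)$ be the linear Coxeter group generated by the simple reflections $\sigma_i\lambda=\lambda-\lambda(h_i)\alpha_i$, acting also on $\mathfrak h$ by duality; let $\mathcal W_J=\langle\sigma_j\mid j\in J\rangle$ for $J\subseteq I$; let $\overline C=\{\lambda\in\mathfrak h^*\mid\lambda(h_i)\ge 0\ \forall i\in I\}$ and let $X=\bigcup_{\sigma\in\mathcal W}\sigma\overline C$ be the Tits cone. For $J\subseteq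 I$ let $J^\infty$ be the union of the connected components of $J$ that are not of finite type (with respect to $A$), and let $J^\perp=\{i\in I\mid a_{ij}=0\ \forall j\in J\}$. Call $J$ special if $J^\infty=J$, and facial if $\sum_{j\in J}\mathbb R_{\ge0}h_j$ is a face of $\sum_{i\in I}\mathbb R_{\ge0}h_i$; let $J^{fc}$ be the smallest facial set containing $J$. For $\Theta\subseteq I$ special and facial put $$R(\Theta)=\mathcal W_{\Theta^\perp}\{\lambda\in\mathfrak h^*\mid \lambda(h_i)=0\ (i\in\Theta),\ \lambda(h_i)\ge0\ (i\in I\setminus\Theta)\}.$$ For $\tau\in\mathcal W$ let $\mathrm{red}(\tau)\subseteq I$ be the set of indices occurring in a reduced expression of $\tau$ (it does not depend on the reduced expression), and for $J,K\subseteq I$ let $J\cap\tau K$ be the set of all $i\in J$ for which there is $j\in K$ with $\tau(\mathbb R_{\ge0}h_j)=\mathbb R_{\ge0}h_i$. Theorem. Let $\Theta_1,\Theta_2\subseteq I$ be special and facial, and let $\tau\in\mathcal W$ be the element of minimal length in its double coset $\mathcal W_{\Theta_1\cup\Theta_1^\perp}\,\tau\,\mathcal W_{\Theta_2\cup\Theta_2^\perp}$.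 Then $\Theta_1\cup\Theta_2\cup\mathrm{red}(\tau)$ is special. The sets $(\Theta_1\cup\Theta_2\cup\mathrm{red}(\tau))^{fc}$ and $(\Theta_1\cap\tau\Theta_2)^\infty$ are special and facial, $R(\Theta_1)$ and $\tau R(\Theta_2)$ are nonempty faces of $X$, and $$R(\Theta_1)\cap\tau R(\Theta_2)=R\big((\Theta_1\cup\Theta_2\cup\mathrm{red}(\tau))^{fc}\big),$$ $$R(\Theta_1)\vee\tau R(\Theta_2)=R\big((\Theta_1\cap\tau\Theta_2)^\infty\big),$$ where $\vee$ is the join in the lattice of nonempty faces of $X$, i.e. the smallest face of $X$ containing both $R(\Theta_1)$ and $\tau R(\Theta_2)$. -/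

import Mathlib

noncomputable section

/-- A real generalized Cartan matrix (certain noninteger entries are allowed). -/
structure IsGCM {I : Type*} (A : Matrix I I ℝ) : Prop where
  diag : ∀ i, A i i = 2
  sign : ∀ i j, i ≠ j → (A i j < 0 ∧ A j i < 0) ∨ (A i j = 0 ∧ A j i = 0)
  angle : ∀ i j, i ≠ j → A i j * A j i < 4 →
    ∃ m : ℕ, 2 ≤ m ∧ A i j * A j i = 4 * Real.cos (Real.pi / m) ^ 2

namespace GCM

variable {I : Type*} (A : Matrix I I ℝ)

/-- The graph on the index set in which two distinct indices are joined if they are adjacent.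
(For a generalized Cartan matrix both disjuncts are equivalent.) -/
def graph : SimpleGraph I where
  Adj i j := i ≠ j ∧ (A i j ≠ 0 ∨ A j i ≠ 0)
  symm := ⟨fun _ _ h => ⟨h.1.symm, h.2.symm⟩⟩
  loopless := ⟨fun _ h => h.1 rfl⟩

/-- `K` is a connected component of the subset `J` of the index set: a maximal (nonempty)
connected subset of `J`. -/
def IsComponent (J K : Set I) : Prop :=
  Maximal (fun L : Set I => L ⊆ J ∧ ((graph A).induce L).Connected) K

open scoped Classical in
/-- Finite type of the principal submatrix of `A` indexed by `K` (to be used for connected `K`):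
`det A_K ≠ 0`, there is `u > 0` with `A_K u > 0`, and `A_K v ≥ 0` implies `v > 0` or `v = 0`. -/
def IsFiniteType [Fintype I] (K : Set I) : Prop :=
  let B : Matrix K K ℝ := A.submatrix Subtype.val Subtype.val
  B.det ≠ 0 ∧
  (∃ u : K → ℝ, (∀ i, 0 < u i) ∧ ∀ i, 0 < (B.mulVec u) i) ∧
  ∀ v : K → ℝ, (∀ i, 0 ≤ (B.mulVec v) i) → (∀ i, 0 < v i) ∨ v = 0

/-- `J^∞`: the union of the connected components of `J` of nonfinite type. -/
def infPart [Fintype I] (J : Set I) : Set I :=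
  ⋃₀ {K | IsComponent A J K ∧ ¬ IsFiniteType A K}

/-- `J` is special if `J^∞ = J`. -/
def IsSpecial [Fintype I] (J : Set I) : Prop := infPart A J = J

/-- `J^⊥`: the indices not adjacent to any element of `J`. -/
def perp (J : Set I) : Set I := {i | ∀ j ∈ J, A i j = 0}

end GCM

/-- The set of nonempty faces of a convex set `K`. -/
def faceSet {V : Type*} [AddCommGroup V] [Module ℝ V] (K : Set V) : Set (Set V) :=
  {F | IsExtreme ℝ K F ∧ Convex ℝ F ∧ F.Nonempty}

/-- The closed ray spanned by `v`. -/
def closedRay {V : Type*} [AddCommGroup V] [Module ℝ V] (v : V) : Set V :=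
  {x | ∃ r : ℝ, 0 ≤ r ∧ x = r • v}

/-- A root base of a linear Coxeter system: a realization of a generalized Cartan matrix for which
the vectors `h i` are positively independent. -/
structure RootBase (I : Type*) [Fintype I] (𝔥 : Type*) [AddCommGroup 𝔥] [Module ℝ 𝔥] where
  A : Matrix I I ℝ
  h : I → 𝔥
  α : I → Module.Dual ℝ 𝔥
  isGCM : IsGCM A
  α_h : ∀ i j, α i (h j) = A j i
  posIndep : ∀ r : I → ℝ, (∀ i, 0 ≤ r i) → ∑ i, r i • h i = 0 → r = 0

namespace RootBase

variable {I : Type*} [Fintype I] {𝔥 : Type*} [AddCommGroup 𝔥] [Module ℝ 𝔥]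
  (B : RootBase I 𝔥)

/-- The simple reflection `σ_i` on `𝔥*`, `λ ↦ λ - λ(h_i) α_i`. -/
def simpleRefl (i : I) : Module.Dual ℝ 𝔥 ≃ₗ[ℝ] Module.Dual ℝ 𝔥 :=
  Module.reflection (x := B.α i) (f := Module.Dual.eval ℝ 𝔥 (B.h i))
    (by rw [Module.Dual.eval_apply, B.α_h, B.isGCM.diag])

theorem simpleRefl_apply (i : I) (l : Module.Dual ℝ 𝔥) :
    B.simpleRefl i l = l - l (B.h i) • B.α i := by
  simp [simpleRefl, Module.reflection_apply]

/-- The standard parabolic subgroup `W_J`, as a group of linear automorphisms of `𝔥*`. -/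
def parabolic (J : Set I) : Subgroup (Module.Dual ℝ 𝔥 ≃ₗ[ℝ] Module.Dual ℝ 𝔥) :=
  Subgroup.closure (B.simpleRefl '' J)

/-- The linear Coxeter group `W`. -/
def W : Subgroup (Module.Dual ℝ 𝔥 ≃ₗ[ℝ] Module.Dual ℝ 𝔥) :=
  B.parabolic Set.univ

/-- The product of the simple reflections along a word. -/
def wordProd (w : List I) : Module.Dual ℝ 𝔥 ≃ₗ[ℝ] Module.Dual ℝ 𝔥 :=
  (w.map B.simpleRefl).prod

/-- The length of an element of `W` with respect to the simple reflections
(only meaningful on `W`). -/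
def length (σ : Module.Dual ℝ 𝔥 ≃ₗ[ℝ] Module.Dual ℝ 𝔥) : ℕ :=
  sInf {k | ∃ w : List I, w.length = k ∧ B.wordProd w = σ}

/-- `w` is a reduced expression of `σ`. -/
def IsReducedWord (σ : Module.Dual ℝ 𝔥 ≃ₗ[ℝ] Module.Dual ℝ 𝔥) (w : List I) : Prop :=
  B.wordProd w = σ ∧ w.length = B.length σ

/-- `red σ`: the indices that occur in a reduced expression of `σ`
(all reduced expressions of `σ ∈ W` have the same set of indices). -/
def red (σ : Module.Dual ℝ 𝔥 ≃ₗ[ℝ] Module.Dual ℝ 𝔥) : Set I :=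
  {i | ∃ w : List I, B.IsReducedWord σ w ∧ i ∈ w}

/-- `τ` is a minimal `(J, K)` double coset representative: an element of `W` of minimal length in
its double coset `W_J τ W_K`. -/
def IsMinDoubleCosetRep (J K : Set I)
    (τ : Module.Dual ℝ 𝔥 ≃ₗ[ℝ] Module.Dual ℝ 𝔥) : Prop :=
  τ ∈ B.W ∧ ∀ a ∈ B.parabolic J, ∀ b ∈ B.parabolic K, B.length τ ≤ B.length (a * τ * b)

/-- The convex cone `∑_{j ∈ J} ℝ₀⁺ h_j` in `𝔥`. -/
def coneH (J : Set I) : Set 𝔥 :=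
  {v | ∃ r : I → ℝ, (∀ i, 0 ≤ r i) ∧ (∀ i, i ∉ J → r i = 0) ∧ v = ∑ i, r i • B.h i}

/-- `J` is facial if `∑_{j ∈ J} ℝ₀⁺ h_j` is a face of `∑_{i ∈ I} ℝ₀⁺ h_i`. -/
def IsFacial (J : Set I) : Prop := B.coneH J ∈ faceSet (B.coneH Set.univ)

/-- The facial closure: the intersection of all facial sets containing `L`. -/
def facialClosure (L : Set I) : Set I := ⋂₀ {J | B.IsFacial J ∧ L ⊆ J}

/-- The closed fundamental chamber. -/
def chamber : Set (Module.Dual ℝ 𝔥) := {l | ∀ i, 0 ≤ l (B.h i)}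

/-- The Tits cone `X`. -/
def titsCone : Set (Module.Dual ℝ 𝔥) := ⋃ σ ∈ B.W, σ '' B.chamber

/-- The closed facet of type `J` of the fundamental chamber. -/
def closedFacet (J : Set I) : Set (Module.Dual ℝ 𝔥) :=
  {l | (∀ i ∈ J, l (B.h i) = 0) ∧ ∀ i, i ∉ J → 0 ≤ l (B.h i)}

/-- `R(Θ) = W_{Θ^⊥} F̄_Θ`. -/
def R (Θ : Set I) : Set (Module.Dual ℝ 𝔥) :=
  ⋃ σ ∈ B.parabolic (GCM.perp B.A Θ), σ '' B.closedFacet Θ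

/-- The action of a linear automorphism `σ` of `𝔥*` on `𝔥` dual to the action on `𝔥*`. -/
def dualAct [FiniteDimensional ℝ 𝔥] (σ : Module.Dual ℝ 𝔥 ≃ₗ[ℝ] Module.Dual ℝ 𝔥) (x : 𝔥) : 𝔥 :=
  (Module.evalEquiv ℝ 𝔥).symm ((Module.Dual.eval ℝ 𝔥 x).comp σ.symm.toLinearMap)

theorem apply_dualAct [FiniteDimensional ℝ 𝔥]
    (σ : Module.Dual ℝ 𝔥 ≃ₗ[ℝ] Module.Dual ℝ 𝔥) (x : 𝔥) (l : Module.Dual ℝ 𝔥) :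
    (σ l) (dualAct σ x) = l x := by
  simp [dualAct]

/-- `J ∩ τ K`: the subset of `I` corresponding to the simple reduced coroots
`{ℝ₀⁺ h_i | i ∈ J} ∩ τ {ℝ₀⁺ h_j | j ∈ K}`. -/
def interTwist [FiniteDimensional ℝ 𝔥] (J : Set I)
    (τ : Module.Dual ℝ 𝔥 ≃ₗ[ℝ] Module.Dual ℝ 𝔥) (K : Set I) : Set I :=
  {i | i ∈ J ∧ ∃ j ∈ K, dualAct τ '' closedRay (B.h j) = closedRay (B.h i)}

end RootBase

end

noncomputable section

open scoped Classical

set_option linter.unusedSectionVars false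
set_option autoImplicit false

/-! ### Theorems of the alternative for finite systems of linear inequalities -/

section Alternatives

/-! A set J is special exactly when it is the support of some c ≥ 0 in ℝ^I with cA ≤ 0
(`isSpecial_iff`). In the geometric representation on ℝ^I, with simple roots e_i, such a c satisfies
gc ≥ c for every g (`le_rep_of_antidominant`), so its image in 𝔥 is nonnegative on the Tits cone X.
This gives a rigidity statement: an element taking each simple root of a special Θ to a positive
multiple of a simple root lies in W_{Θ^⊥} (`mem_para_perp`). Consequently, if gμ vanishes on Θ for a
dominant μ, then g is a product of an element of W_{Θ^⊥} and one of the parabolic fixing μ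
(`exists_eq_mul_of_vanish`). Hence R(Θ) is cut out of X by the equations λ(h_i) = 0, i ∈ Θ
(`mem_R_iff`), and it is a face (`vanish_of_mem_openSegment`).

Intersection. Let M = Θ₁ ∪ Θ₂ ∪ red(τ). A common point is wx with w ∈ W_M and x dominant on M.
Factoring w and τ⁻¹w as above puts an element of the double coset of τ into W_N, where N ⊆ M is the
set of zeros of x. A minimal double coset representative lies in every standard parabolic that meets
its double coset (`mem_para_of_double_coset`), so red(τ) ⊆ N and x vanishes on all of M. Passing to
the facial closure does not change R, because the added h_k enter a linear relation with positive
coefficients (`exists_relation`, `R_facialClosure`).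

Join. Let T = (Θ₁ ∩ τΘ₂)^∞. Rigidity gives τ ∈ W_{T^⊥}, so T lies in Θ₁ and Θ₂, and R(T) contains
both faces. Conversely let a face F contain both. Faciality supplies dominant x, y with zero sets
exactly Θ₁, Θ₂. The midpoint of x and τy is wμ with μ dominant, and a face through a dominant point
with zero set J contains R(J^∞) (`R_infPart_subset`; it rests on the fact that in finite type the
Tits cone is everything, `mem_titsCone_of_dominant`). Thus wR(D) ⊆ F with D = J^∞. As x and τy
vanish on wD, the roots w e_j, j ∈ D, are supported on Θ₁ ∩ τΘ₂. This forces D ⊆ T and R(T) ⊆ wR(D).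
-/

/-- The convex hull of the family is compact and, by positive independence, misses 0; Hahn–Banach
separates the two strictly. -/
theorem exists_dual_pos_fin {ι : Type*} [Fintype ι] {n : ℕ} (h : ι → Fin n → ℝ)
    (hp : ∀ r : ι → ℝ, (∀ i, 0 ≤ r i) → ∑ i, r i • h i = 0 → r = 0) :
    ∃ f : Module.Dual ℝ (Fin n → ℝ), ∀ i, 0 < f (h i) := by
  let Φ := Fintype.linearCombination ℝ h
  have hc : IsCompact (Φ '' stdSimplex ℝ ι) :=
    (isCompact_stdSimplex ℝ ι).image (LinearMap.continuous_of_finiteDimensional Φ)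
  have hcv : Convex ℝ (Φ '' stdSimplex ℝ ι) := (convex_stdSimplex ℝ ι).linear_image Φ
  have h0 : (0 : Fin n → ℝ) ∉ Φ '' stdSimplex ℝ ι := by
    rintro ⟨r, hr, hr0⟩
    have := hp r hr.1 (by simpa [Φ, Fintype.linearCombination_apply] using hr0)
    have h1 := hr.2
    simp [this] at h1
  obtain ⟨f, u, hu, hf⟩ := geometric_hahn_banach_point_closed hcv hc.isClosed h0
  refine ⟨f.toLinearMap, fun i => ?_⟩
  have h1 := hf (h i) ⟨Pi.single i 1, single_mem_stdSimplex ℝ i, by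
    simp [Φ, Fintype.linearCombination_apply_single]⟩
  simp only [map_zero] at hu
  exact hu.trans h1

/-- Gordan's theorem: a positively independent finite family lies in an open half space. -/
theorem exists_dual_pos {ι E : Type*} [Fintype ι] [AddCommGroup E] [Module ℝ E]
    [FiniteDimensional ℝ E] (h : ι → E)
    (hp : ∀ r : ι → ℝ, (∀ i, 0 ≤ r i) → ∑ i, r i • h i = 0 → r = 0) :
    ∃ f : Module.Dual ℝ E, ∀ i, 0 < f (h i) := by
  let e := (Module.finBasis ℝ E).equivFun
  obtain ⟨f, hf⟩ := exists_dual_pos_fin (fun i => e (h i)) (fun r hr h0 => hp r hr (by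
    apply e.injective
    simpa [map_sum] using h0))
  exact ⟨f.comp e.toLinearMap, fun i => hf i⟩

theorem exists_dual_pos_of_submodule {ι E : Type*} [Fintype ι] [AddCommGroup E] [Module ℝ E]
    [FiniteDimensional ℝ E] (S : Submodule ℝ E) (h : ι → E)
    (hp : ∀ r : ι → ℝ, (∀ i, 0 ≤ r i) → ∑ i, r i • h i ∈ S → r = 0) :
    ∃ f : Module.Dual ℝ E, (∀ x ∈ S, f x = 0) ∧ ∀ i, 0 < f (h i) := by
  obtain ⟨f, hf⟩ := exists_dual_pos (fun i => S.mkQ (h i)) (fun r hr h0 => hp r hr (by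
    rw [← S.ker_mkQ, LinearMap.mem_ker]
    simpa [map_sum] using h0))
  refine ⟨f.comp S.mkQ, fun x hx => ?_, fun i => hf i⟩
  simp [(Submodule.Quotient.mk_eq_zero S).2 hx]

/-- Ville's theorem. -/
theorem exists_nonneg_or_exists_pos {K : Type*} [Fintype K] (M : K → K → ℝ) :
    (∃ c : K → ℝ, (∀ k, 0 ≤ c k) ∧ c ≠ 0 ∧ ∀ i, ∑ k, c k * M k i ≤ 0) ∨
    ∃ y : K → ℝ, (∀ i, 0 < y i) ∧ ∀ k, 0 < ∑ i, M k i * y i := by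
  -- Gordan's theorem is applied to the rows of M together with the standard basis vectors:
  -- positivity on the former says My > 0, on the latter y > 0.
  by_cases hp : ∀ r : K ⊕ K → ℝ, (∀ i, 0 ≤ r i) →
      ∑ i, r i • (Sum.elim M (fun k => Pi.single k (1 : ℝ)) i) = 0 → r = 0
  · right
    obtain ⟨f, hf⟩ := exists_dual_pos _ hp
    refine ⟨fun i => f (Pi.single i 1), fun i => hf (Sum.inr i), fun k => ?_⟩
    have h1 := hf (Sum.inl k)
    simp only [Sum.elim_inl] at h1
    rw [LinearMap.pi_apply_eq_sum_univ f (M k)] at h1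
    convert h1 using 3
    simp only [smul_eq_mul]
    congr 2
    ext j
    simp [Pi.single_apply, eq_comm]
  · left
    push Not at hp
    obtain ⟨r, hr, h0, hne⟩ := hp
    have hi : ∀ i, ∑ k, r (Sum.inl k) * M k i + r (Sum.inr i) = 0 := by
      intro i
      have := congrFun h0 i
      simpa [Fintype.sum_sum_type, Finset.sum_apply, Pi.single_apply] using this
    refine ⟨fun k => r (Sum.inl k), fun k => hr _, fun hc => hne ?_, fun i => ?_⟩
    · have hc' : ∀ k, r (Sum.inl k) = 0 := fun k => congrFun hc k
      ext (k | k)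
      · exact hc' k
      · have := hi k
        simpa [hc'] using this
    · have := hi i
      have := hr (Sum.inr i)
      simp only
      linarith

/-- Take m minimizing v_m / u_m =: t. If t < 0, then v - tu is nonnegative and vanishes at m, so the
m-th entry of M(v - tu) is at most 0; but (Mv)_m ≥ 0 and -t(Mu)_m > 0. -/
theorem nonneg_of_forall_sum_nonneg {K : Type*} [Fintype K] (M : K → K → ℝ)
    (hM : ∀ i j, i ≠ j → M i j ≤ 0) (u : K → ℝ) (hu : ∀ i, 0 < u i)
    (hMu : ∀ i, 0 < ∑ j, M i j * u j) (v : K → ℝ) (hv : ∀ i, 0 ≤ ∑ j, M i j * v j) (i : K) :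
    0 ≤ v i := by
  by_contra hi
  push Not at hi
  obtain ⟨m, -, hm⟩ := Finset.exists_min_image Finset.univ (fun j => v j / u j) ⟨i, Finset.mem_univ i⟩
  have ht : v m / u m < 0 := (hm i (Finset.mem_univ i)).trans_lt (div_neg_of_neg_of_pos hi (hu i))
  set t := v m / u m with htd
  have h1 : ∀ j, 0 ≤ v j - t * u j := fun j => by
    have := hm j (Finset.mem_univ j)
    rw [le_div_iff₀ (hu j)] at this
    linarith
  have h2 : ∑ j, M m j * (v j - t * u j) ≤ 0 := by
    apply Finset.sum_nonpos
    intro j _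
    by_cases hj : m = j
    · subst hj
      have : v m - t * u m = 0 := by rw [htd]; field_simp [(hu m).ne']; ring
      simp [this]
    · exact mul_nonpos_of_nonpos_of_nonneg (hM m j hj) (h1 j)
  have h3 : ∑ j, M m j * (v j - t * u j) = ∑ j, M m j * v j - t * ∑ j, M m j * u j := by
    rw [Finset.mul_sum, ← Finset.sum_sub_distrib]
    exact Finset.sum_congr rfl fun j _ => by ring
  have := mul_pos_of_neg_of_neg ht (neg_lt_zero.2 (hMu m))
  have := hv m
  nlinarith

theorem sum_set_coe_eq_sum {I E : Type*} [Fintype I] [AddCommMonoid E] {K : Set I} [Fintype K]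
    (f : I → E)
    (hf : ∀ i, i ∉ K → f i = 0) : ∑ j : K, f j = ∑ j, f j := by
  rw [← Finset.sum_subtype (Finset.univ.filter (· ∈ K)) (by simp) f]
  apply Finset.sum_filter_of_ne
  intro i _ h
  by_contra h'
  exact h (hf i h')

end Alternatives

/-! ### Special sets as supports of antidominant vectors -/

namespace GCM

variable {I : Type*} [Fintype I] {A : Matrix I I ℝ}

/-- `J` is the support of a nonnegative vector `c` with `c A ≤ 0`. -/
def HasAntidominant (A : Matrix I I ℝ) (J : Set I) : Prop :=
  ∃ c : I → ℝ, (∀ i ∈ J, 0 < c i) ∧ (∀ i, i ∉ J → c i = 0) ∧ ∀ i, ∑ k, c k * A k i ≤ 0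

/-- `J` is the support of a nonnegative vector `u` with `A u > 0` on `J`. -/
def HasDominant (A : Matrix I I ℝ) (J : Set I) : Prop :=
  ∃ u : I → ℝ, (∀ i ∈ J, 0 < u i) ∧ (∀ i, i ∉ J → u i = 0) ∧ ∀ i ∈ J, 0 < ∑ k, A i k * u k

theorem offdiag_nonpos (hA : IsGCM A) {i j : I} (h : i ≠ j) : A i j ≤ 0 := by
  rcases hA.sign i j h with h | h
  · exact h.1.le
  · exact h.1.le

theorem eq_zero_comm (hA : IsGCM A) {i j : I} : A i j = 0 ↔ A j i = 0 := by
  by_cases h : i = j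
  · rw [h]
  rcases hA.sign i j h with h | h
  · exact ⟨fun h' => absurd h' h.1.ne, fun h' => absurd h' h.2.ne⟩
  · simp [h]

theorem sum_mul_nonpos_of_eq_zero (hA : IsGCM A) {c : I → ℝ} (hc : ∀ k, 0 ≤ c k) {i : I}
    (hi : c i = 0) : ∑ k, c k * A k i ≤ 0 := by
  apply Finset.sum_nonpos
  intro k _
  by_cases h : k = i
  · rw [h, hi, zero_mul]
  · exact mul_nonpos_of_nonneg_of_nonpos (hc k) (offdiag_nonpos hA h)

theorem sum_mul_neg_of_eq_zero (hA : IsGCM A) {c : I → ℝ} (hc : ∀ k, 0 ≤ c k) {i j : I}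
    (hi : c i = 0) (hj : 0 < c j) (hij : A j i ≠ 0) : ∑ k, c k * A k i < 0 := by
  have hji : j ≠ i := fun h => by rw [h, hi] at hj; exact lt_irrefl _ hj
  have h0 : ∑ k ∈ Finset.univ.erase j, c k * A k i ≤ 0 := by
    apply Finset.sum_nonpos
    intro k _
    by_cases h : k = i
    · rw [h, hi, zero_mul]
    · exact mul_nonpos_of_nonneg_of_nonpos (hc k) (offdiag_nonpos hA h)
  rw [← Finset.add_sum_erase _ _ (Finset.mem_univ j)]
  have := mul_neg_of_pos_of_neg hj (lt_of_le_of_ne (offdiag_nonpos hA hji) hij)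
  linarith

theorem mem_of_connected {K : Set I} (hA : IsGCM A) (hK : ((graph A).induce K).Connected)
    {S : Set I} {i : I} (hi : i ∈ S) (hiK : i ∈ K)
    (hS : ∀ i ∈ S, i ∈ K → ∀ j ∈ K, i ≠ j → A i j ≠ 0 → j ∈ S) {j : I} (hj : j ∈ K) : j ∈ S := by
  obtain ⟨p⟩ := hK.preconnected ⟨i, hiK⟩ ⟨j, hj⟩
  have key : ∀ (a b : K) (q : ((graph A).induce K).Walk a b), a.1 ∈ S → b.1 ∈ S := by
    intro a b q
    induction q with
    | nil => exact id
    | cons hadj _ ih =>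
      intro ha
      apply ih
      have h1 : (graph A).Adj _ _ := hadj
      refine hS _ ha (Subtype.property _) _ (Subtype.property _) h1.1 ?_
      rcases h1.2 with h | h
      · exact h
      · exact fun h' => h ((eq_zero_comm hA).1 h')
  exact key _ _ p hi

/-- Induction on the number of zeros of c in K. Connectedness gives a zero i next to a positive
entry, and there s = (cA)_i < 0. Raising c_i by -s/2 makes this entry 0, since a_ii = 2, and can
only lower the others. -/
theorem exists_pos_of_connected (hA : IsGCM A) {K : Set I}
    (hK : ((graph A).induce K).Connected) :
    ∀ (n : ℕ) (c : I → ℝ), (Finset.univ.filter fun i => i ∈ K ∧ c i = 0).card ≤ n →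
      (∀ k, 0 ≤ c k) → (∀ i, i ∉ K → c i = 0) → c ≠ 0 → (∀ i, ∑ k, c k * A k i ≤ 0) →
      HasAntidominant A K := by
  intro n
  induction n with
  | zero =>
    intro c hn hc hcK _ hcA
    rw [Nat.le_zero, Finset.card_eq_zero, Finset.filter_eq_empty_iff] at hn
    exact ⟨c, fun i hi => lt_of_le_of_ne (hc i) fun h => hn (Finset.mem_univ i) ⟨hi, h.symm⟩,
      hcK, hcA⟩
  | succ n ih =>
    intro c hn hc hcK hc0 hcA
    by_cases hpos : ∀ i ∈ K, 0 < c i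
    · exact ⟨c, hpos, hcK, hcA⟩
    push Not at hpos
    obtain ⟨i0, hi0, hci0⟩ := hpos
    obtain ⟨k0, hk0⟩ := Function.ne_iff.1 hc0
    have hk0K : k0 ∈ K := by
      by_contra h
      exact hk0 (hcK _ h)
    have hex : ∃ k ∈ K, 0 < c k ∧ ∃ i ∈ K, A k i ≠ 0 ∧ c i = 0 := by
      by_contra hno
      push Not at hno
      have := mem_of_connected hA hK (S := {k | 0 < c k}) (i := k0)
        (lt_of_le_of_ne (hc k0) (Ne.symm hk0)) hk0K
        (fun k hk hkK i hi _ hki => lt_of_le_of_ne (hc i) (hno k hkK hk i hi hki).symm) hi0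
      exact absurd this (not_lt.2 hci0)
    obtain ⟨k, hkK, hk, i, hiK, hki, hi⟩ := hex
    set s := ∑ k, c k * A k i with hs
    have hsneg : s < 0 := sum_mul_neg_of_eq_zero hA hc hi hk hki
    have hc' : ∀ j, 0 ≤ (c + Pi.single i (-s / 2) : I → ℝ) j := fun j => by
      have : 0 ≤ (Pi.single i (-s / 2) : I → ℝ) j := by
        by_cases h : j = i
        · subst h; simp; linarith
        · simp [h]
      exact add_nonneg (hc j) this
    have hci : 0 < (c + Pi.single i (-s / 2) : I → ℝ) i := by
      simp [hi]; linarith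
    refine ih (c + Pi.single i (-s / 2)) ?_ hc' ?_ ?_ ?_
    · rw [← Nat.lt_succ_iff]
      refine lt_of_lt_of_le (Finset.card_lt_card ?_) hn
      rw [Finset.ssubset_iff_of_subset]
      · exact ⟨i, by simp [hiK, hi], by simp [hiK]; simp at hci; exact hci.ne'⟩
      · intro j hj
        simp only [Finset.mem_filter, Finset.mem_univ, true_and] at hj ⊢
        refine ⟨hj.1, ?_⟩
        have : j ≠ i := fun h => by subst h; exact hci.ne' hj.2
        simpa [this] using hj.2
    · intro j hj
      have : j ≠ i := fun h => hj (h ▸ hiK)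
      simp [this, hcK j hj]
    · intro h0
      rw [h0] at hci
      exact lt_irrefl _ hci
    · intro j
      have : ∑ k, (c + Pi.single i (-s / 2) : I → ℝ) k * A k j
          = ∑ k, c k * A k j + (-s / 2) * A i j := by
        simp [add_mul, Finset.sum_add_distrib, Pi.single_apply]
      rw [this]
      by_cases h : i = j
      · subst h
        rw [hA.diag, ← hs]; linarith
      · have := mul_nonpos_of_nonneg_of_nonpos (by linarith : 0 ≤ -s / 2) (offdiag_nonpos hA h)
        have := hcA j
        linarith

theorem sum_mul_le_of_nonpos_on (hA : IsGCM A) {c : I → ℝ} {K : Set I} (hc : ∀ k, 0 ≤ c k)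
    (hcK : ∀ i, i ∉ K → c i = 0) (h : ∀ i ∈ K, ∑ k, c k * A k i ≤ 0) (i : I) :
    ∑ k, c k * A k i ≤ 0 := by
  by_cases hi : i ∈ K
  · exact h i hi
  · exact sum_mul_nonpos_of_eq_zero hA hc (hcK i hi)

theorem IsFiniteType.hasDominant {K : Set I} (h : IsFiniteType A K) : HasDominant A K := by
  obtain ⟨u, hu, hAu⟩ := h.2.1
  refine ⟨fun i => if hi : i ∈ K then u ⟨i, hi⟩ else 0, fun i hi => by simp [hi, hu],
    fun i hi => by simp [hi], fun i hi => ?_⟩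
  rw [← sum_set_coe_eq_sum (K := K) _ (fun j hj => by simp [hj])]
  simpa [Matrix.mulVec, dotProduct] using hAu ⟨i, hi⟩

/-- Comparison with y turns Av ≥ 0 into v ≥ 0, which also yields injectivity. A zero of such a v
forces zeros at all neighbours, hence on all of the connected set K. -/
theorem isFiniteType_of_pos (hA : IsGCM A) {K : Set I} (hK : ((graph A).induce K).Connected)
    (y : K → ℝ) (hy : ∀ i, 0 < y i) (hAy : ∀ i : K, 0 < ∑ k : K, A i k * y k) :
    IsFiniteType A K := by
  have hoff : ∀ i j : K, i ≠ j → A i j ≤ 0 := fun i j h =>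
    offdiag_nonpos hA fun h' => h (Subtype.ext h')
  have hnn : ∀ v : K → ℝ, (∀ i : K, 0 ≤ ∑ k : K, A i k * v k) → ∀ i, 0 ≤ v i :=
    fun v hv i => nonneg_of_forall_sum_nonneg (fun i j : K => A i j) hoff y hy hAy v hv i
  refine ⟨?_, ⟨y, hy, by simpa [Matrix.mulVec, dotProduct] using hAy⟩, fun v hv => ?_⟩
  · intro hdet
    obtain ⟨v, hv0, hv⟩ := Matrix.exists_mulVec_eq_zero_iff.2 hdet
    apply hv0
    have hv' : ∀ i : K, ∑ k : K, A i k * v k = 0 := fun i => by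
      simpa [Matrix.mulVec, dotProduct] using congrFun hv i
    ext i
    apply le_antisymm
    · have := hnn (-v) (fun i => by simp [hv' i]) i
      simpa using this
    · exact hnn v (fun i => (hv' i).ge) i
  · have hv' : ∀ i : K, 0 ≤ ∑ k : K, A i k * v k := fun i => by
      simpa [Matrix.mulVec, dotProduct] using hv i
    have hvn := hnn v hv'
    by_contra hcon
    push Not at hcon
    obtain ⟨⟨i, hi⟩, hvi⟩ := hcon.1
    have hvi0 : v ⟨i, hi⟩ = 0 := le_antisymm hvi (hvn _)
    apply hcon.2
    ext ⟨j, hj⟩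
    obtain ⟨_, h⟩ := mem_of_connected hA hK (S := {k | ∃ hk : k ∈ K, v ⟨k, hk⟩ = 0})
      ⟨hi, hvi0⟩ hi (by
        rintro k ⟨hk, hvk⟩ - l hl hkl hAkl
        refine ⟨hl, ?_⟩
        by_contra hne
        have hterm : ∀ m ∈ (Finset.univ : Finset K), A k m * v m ≤ 0 := fun m _ => by
          by_cases hm : (⟨k, hk⟩ : K) = m
          · rw [← hm, hvk, mul_zero]
          · exact mul_nonpos_of_nonpos_of_nonneg (hoff ⟨k, hk⟩ m hm) (hvn m)
        have h0 := (Finset.sum_eq_zero_iff_of_nonpos hterm).1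
          (le_antisymm (Finset.sum_nonpos hterm) (hv' ⟨k, hk⟩)) ⟨l, hl⟩ (Finset.mem_univ _)
        exact (mul_ne_zero hAkl hne) h0) hj
    exact h

theorem hasAntidominant_of_not_isFiniteType (hA : IsGCM A) {K : Set I}
    (hK : ((graph A).induce K).Connected) (h : ¬ IsFiniteType A K) : HasAntidominant A K := by
  rcases exists_nonneg_or_exists_pos (fun i j : K => A i j) with ⟨c, hc, hc0, hcA⟩ | ⟨y, hy, hAy⟩
  · have hc' : ∀ k, 0 ≤ (fun i => if hi : i ∈ K then c ⟨i, hi⟩ else 0 : I → ℝ) k := fun k => by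
      by_cases hk : k ∈ K
      · simp [hk, hc]
      · simp [hk]
    have hcK : ∀ i, i ∉ K → (fun i => if hi : i ∈ K then c ⟨i, hi⟩ else 0 : I → ℝ) i = 0 :=
      fun i hi => by simp [hi]
    refine exists_pos_of_connected hA hK _ _ le_rfl hc' hcK ?_
      (sum_mul_le_of_nonpos_on hA hc' hcK ?_)
    · obtain ⟨⟨i, hi⟩, hci⟩ := Function.ne_iff.1 hc0
      intro h0
      apply hci
      simpa [hi] using congrFun h0 i
    · intro i hi
      rw [← sum_set_coe_eq_sum (K := K) _ (fun j hj => by simp [hj])]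
      simpa using hcA ⟨i, hi⟩
  · exact absurd (isFiniteType_of_pos hA hK y hy hAy) h

/-- The number cAu would be positive when bracketed as c(Au) and nonpositive as (cA)u. -/
theorem not_hasDominant_of_sum_nonpos {K : Set I} (c : I → ℝ)
    (hc : ∀ k, 0 ≤ c k) (hcK : ∀ i, i ∉ K → c i = 0) (hc0 : c ≠ 0)
    (hcA : ∀ i ∈ K, ∑ k, c k * A k i ≤ 0) : ¬ HasDominant A K := by
  rintro ⟨u, hu, hu0, hAu⟩
  obtain ⟨k0, hk0⟩ := Function.ne_iff.1 hc0
  have hk0K : k0 ∈ K := by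
    by_contra h
    exact hk0 (hcK _ h)
  have h1 : 0 < ∑ k, c k * ∑ i, A k i * u i := by
    apply Finset.sum_pos'
    · intro k _
      by_cases hk : k ∈ K
      · exact mul_nonneg (hc k) (hAu k hk).le
      · simp [hcK k hk]
    · exact ⟨k0, Finset.mem_univ _, mul_pos (lt_of_le_of_ne (hc k0) (Ne.symm hk0)) (hAu k0 hk0K)⟩
  have h2 : ∑ k, c k * ∑ i, A k i * u i = ∑ i, (∑ k, c k * A k i) * u i := by
    simp only [Finset.mul_sum, Finset.sum_mul]
    rw [Finset.sum_comm]
    exact Finset.sum_congr rfl fun i _ => Finset.sum_congr rfl fun k _ => by ring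
  have h3 : ∑ i, (∑ k, c k * A k i) * u i ≤ 0 := by
    apply Finset.sum_nonpos
    intro i _
    by_cases hi : i ∈ K
    · exact mul_nonpos_of_nonpos_of_nonneg (hcA i hi) (hu i hi).le
    · simp [hu0 i hi]
  linarith

theorem exists_isComponent {J L : Set I} (hL : L ⊆ J) (hLc : ((graph A).induce L).Connected) :
    ∃ K, IsComponent A J K ∧ L ⊆ K := by
  obtain ⟨K, hLK, hK⟩ := (Set.toFinite {L : Set I | L ⊆ J ∧
    ((graph A).induce L).Connected}).exists_le_maximal (a := L) ⟨hL, hLc⟩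
  exact ⟨K, hK, hLK⟩

theorem exists_isComponent_mem {J : Set I} {i : I} (hi : i ∈ J) :
    ∃ K, IsComponent A J K ∧ i ∈ K := by
  obtain ⟨K, hK, h⟩ := exists_isComponent (A := A) (J := J) (L := {i}) (by simpa using hi)
    (by
      have : Subsingleton ({i} : Set I) := by infer_instance
      have : Nonempty ({i} : Set I) := ⟨⟨i, rfl⟩⟩
      exact SimpleGraph.Connected.mk (SimpleGraph.Preconnected.of_subsingleton))
  exact ⟨K, hK, h rfl⟩

theorem IsComponent.eq_of_inter {J K K' : Set I} (h : IsComponent A J K)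
    (h' : IsComponent A J K') (hne : (K ∩ K').Nonempty) : K = K' := by
  have hu : K ∪ K' ⊆ J ∧ ((graph A).induce (K ∪ K')).Connected :=
    ⟨Set.union_subset h.prop.1 h'.prop.1, SimpleGraph.induce_union_connected
      h.prop.2.preconnected h'.prop.2.preconnected hne⟩
  exact (h.eq_of_subset hu Set.subset_union_left).trans
    (h'.eq_of_subset hu Set.subset_union_right).symm

theorem IsComponent.mem_of_adj {J K : Set I} (h : IsComponent A J K) {i j : I} (hi : i ∈ K)
    (hj : j ∈ J) (hij : A i j ≠ 0) : j ∈ K := by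
  by_cases hne : i = j
  · exact hne ▸ hi
  have hadj : (graph A).Adj i j := ⟨hne, Or.inl hij⟩
  have hpair : ((graph A).induce {i, j}).Connected := by
    exact SimpleGraph.induce_pair_connected_of_adj hadj
  have hu : K ∪ {i, j} ⊆ J ∧ ((graph A).induce (K ∪ {i, j})).Connected := by
    refine ⟨Set.union_subset h.prop.1 ?_, SimpleGraph.induce_union_connected
      h.prop.2.preconnected hpair.preconnected ⟨i, hi, by simp⟩⟩
    rintro x (rfl | rfl)
    · exact h.prop.1 hi
    · exact hj
  rw [h.eq_of_subset hu Set.subset_union_left]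
  simp

theorem infPart_subset {J : Set I} : infPart A J ⊆ J := by
  rintro i ⟨K, ⟨hK, -⟩, hi⟩
  exact hK.prop.1 hi

theorem hasAntidominant_sUnion (C : Set (Set I)) (h : ∀ K ∈ C, HasAntidominant A K) :
    HasAntidominant A (⋃₀ C) := by
  choose! c hc hc0 hcA using h
  have hnn : ∀ K ∈ C, ∀ i, 0 ≤ c K i := fun K hK i => by
    by_cases hi : i ∈ K
    · exact (hc K hK i hi).le
    · exact (hc0 K hK i hi).ge
  refine ⟨fun i => ∑ K ∈ Finset.univ.filter (· ∈ C), c K i, ?_, ?_, ?_⟩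
  · rintro i ⟨K, hK, hi⟩
    exact Finset.sum_pos' (fun K hK => hnn K (by simpa using hK) i)
      ⟨K, by simpa using hK, hc K hK i hi⟩
  · intro i hi
    refine Finset.sum_eq_zero fun K hK => hc0 K (by simpa using hK) i fun h => hi ?_
    exact ⟨K, by simpa using hK, h⟩
  · intro i
    simp only [Finset.sum_mul]
    rw [Finset.sum_comm]
    exact Finset.sum_nonpos fun K hK => hcA K (by simpa using hK) i

theorem hasAntidominant_infPart (hA : IsGCM A) (J : Set I) : HasAntidominant A (infPart A J) :=
  hasAntidominant_sUnion _ fun _ hK => hasAntidominant_of_not_isFiniteType hA hK.1.prop.2 hK.2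

/-- Cut the antidominant vector of S down to a component K of J meeting S. Its pairings on K do not
change, because the rest of S is not adjacent to K, so K admits no dominant vector and cannot be of
finite type. -/
theorem subset_infPart (hA : IsGCM A) {S J : Set I} (hS : HasAntidominant A S) (hSJ : S ⊆ J) :
    S ⊆ infPart A J := by
  intro i hi
  obtain ⟨K, hK, hiK⟩ := exists_isComponent_mem (A := A) (hSJ hi)
  refine ⟨K, ⟨hK, fun hfin => ?_⟩, hiK⟩
  obtain ⟨c, hc, hc0, hcA⟩ := hS
  have hnn : ∀ i, 0 ≤ c i := fun i => by
    by_cases hi : i ∈ S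
    · exact (hc i hi).le
    · exact (hc0 i hi).ge
  refine not_hasDominant_of_sum_nonpos (fun k => if k ∈ K then c k else 0) ?_ ?_ ?_ ?_
    hfin.hasDominant
  · intro k
    by_cases hk : k ∈ K
    · simp [hk, hnn k]
    · simp [hk]
  · intro k hk
    simp [hk]
  · intro h0
    have := congrFun h0 i
    simp [hiK] at this
    exact (hc i hi).ne' this
  · intro j hj
    refine le_of_eq_of_le (Finset.sum_congr rfl fun k _ => ?_) (hcA j)
    by_cases hk : k ∈ K
    · simp [hk]
    · simp only [hk, if_false, zero_mul]
      by_cases hkS : k ∈ S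
      · have : A k j = 0 := by
          by_contra hne
          exact hk (hK.mem_of_adj hj (hSJ hkS) (fun h => hne ((eq_zero_comm hA).1 h)))
        simp [this]
      · simp [hc0 k hkS]

/-- This replaces connected components and finite type by a system of inequalities, the only form in
which specialness is used from here on. -/
theorem isSpecial_iff (hA : IsGCM A) {J : Set I} : IsSpecial A J ↔ HasAntidominant A J := by
  constructor
  · intro h
    have := hasAntidominant_infPart hA J
    rwa [show infPart A J = J from h] at this
  · intro h
    exact Set.Subset.antisymm infPart_subset (subset_infPart hA h subset_rfl)

theorem isSpecial_infPart (hA : IsGCM A) (J : Set I) : IsSpecial A (infPart A J) :=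
  (isSpecial_iff hA).2 (hasAntidominant_infPart hA J)

theorem eq_zero_of_mem_infPart {J : Set I} {i j : I} (hi : i ∈ infPart A J)
    (hj : j ∈ J) (hj' : j ∉ infPart A J) : A i j = 0 := by
  obtain ⟨K, ⟨hK, hK'⟩, hi⟩ := hi
  by_contra h
  exact hj' ⟨K, ⟨hK, hK'⟩, hK.mem_of_adj hi hj h⟩

theorem hasDominant_diff_infPart (hA : IsGCM A) (J : Set I) :
    HasDominant A (J \ infPart A J) := by
  let C : Set (Set I) := {K | IsComponent A J K ∧ IsFiniteType A K}
  have hd : ∀ K ∈ C, HasDominant A K := fun K hK => hK.2.hasDominant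
  choose! u hu hu0 hAu using hd
  have hnn : ∀ K ∈ C, ∀ i, 0 ≤ u K i := fun K hK i => by
    by_cases hi : i ∈ K
    · exact (hu K hK i hi).le
    · exact (hu0 K hK i hi).ge
  have hmem : ∀ i, i ∈ J \ infPart A J → ∃ K ∈ C, i ∈ K := by
    rintro i ⟨hi, hi'⟩
    obtain ⟨K, hK, hiK⟩ := exists_isComponent_mem (A := A) hi
    exact ⟨K, ⟨hK, by_contra fun h => hi' ⟨K, ⟨hK, h⟩, hiK⟩⟩, hiK⟩
  refine ⟨fun i => ∑ K ∈ Finset.univ.filter (· ∈ C), u K i, ?_, ?_, ?_⟩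
  · intro i hi
    obtain ⟨K, hK, hiK⟩ := hmem i hi
    exact Finset.sum_pos' (fun K hK => hnn K (by simpa using hK) i)
      ⟨K, by simpa using hK, hu K hK i hiK⟩
  · intro i hi
    refine Finset.sum_eq_zero fun K hK => ?_
    have hK : K ∈ C := by simpa using hK
    refine hu0 K hK i fun hiK => hi ⟨hK.1.prop.1 hiK, ?_⟩
    rintro ⟨K', ⟨hK', hnf⟩, hiK'⟩
    rw [hK'.eq_of_inter hK.1 ⟨i, hiK', hiK⟩] at hnf
    exact hnf hK.2
  · intro i hi
    obtain ⟨K0, hK0, hiK0⟩ := hmem i hi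
    simp only [Finset.mul_sum]
    rw [Finset.sum_comm]
    refine Finset.sum_pos' (fun K hK => ?_) ⟨K0, by simpa using hK0, hAu K0 hK0 i hiK0⟩
    have hK : K ∈ C := by simpa using hK
    by_cases hiK : i ∈ K
    · exact (hAu K hK i hiK).le
    · apply le_of_eq
      symm
      refine Finset.sum_eq_zero fun k _ => ?_
      by_cases hkK : k ∈ K
      · have : A i k = 0 := by
          by_contra hne
          exact hiK (hK.1.mem_of_adj hkK hi.1 fun h => hne ((eq_zero_comm hA).1 h))
        rw [this, zero_mul]
      · rw [hu0 K hK k hkK, mul_zero]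

end GCM

/-! ### The abstract Coxeter group and its geometric representation -/

/-- Powers of a product of two reflections have coefficients given by the Chebyshev polynomials `S`
at 2cos(2π/m); the ones needed vanish for even m and cancel for odd m. Reading this off from sines
requires sin(2π/m) ≠ 0, so m = 2 is separate: there `h0` makes the reflections commute. -/
theorem Module.reflection_mul_reflection_pow_eq_one {E : Type*} [AddCommGroup E] [Module ℝ E]
    {x y : E} {f g : Module.Dual ℝ E} (hf : f x = 2) (hg : g y = 2) {m : ℕ} (hm : 2 ≤ m)
    (h : f y * g x = 4 * Real.cos (Real.pi / m) ^ 2) (h0 : f y * g x = 0 → f y = 0 ∧ g x = 0) :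
    (Module.reflection hf * Module.reflection hg) ^ m = 1 := by
  rcases hm.eq_or_lt with rfl | hm
  · obtain ⟨h1, h2⟩ := h0 (by rw [h]; simp)
    ext z
    simp [pow_two, Module.reflection_apply, h1, h2, map_sub]
    module
  · have ht : 2 * Real.cos (2 * (Real.pi / m)) = f y * g x - 2 := by
      rw [Real.cos_two_mul, h]; ring
    set p := 2 * (Real.pi / m) with hp
    have hm0 : (0 : ℝ) < m := by positivity
    have hm3 : (3 : ℝ) ≤ m := by exact_mod_cast hm
    have hmp : (m : ℝ) * p = 2 * Real.pi := by rw [hp]; field_simp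
    have hppos : 0 < p := by positivity
    have hplt : p < Real.pi := by nlinarith [Real.pi_pos]
    have hsin : Real.sin p ≠ 0 := (Real.sin_pos_of_pos_of_lt_pi hppos hplt).ne'
    have hS := fun n : ℤ => Polynomial.Chebyshev.S_two_mul_real_cos p n
    ext z
    rw [Module.reflection_mul_reflection_pow_apply hf hg m z _ ht]
    rcases Nat.even_or_odd' m with ⟨k, hk | hk⟩
    · have hkp : (k : ℝ) * p = Real.pi := by
        rw [hk] at hmp; push_cast at hmp; linarith
      have h1 : (Polynomial.Chebyshev.S ℝ ((k : ℤ) - 1)).eval (2 * Real.cos p) = 0 := by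
        have := hS (k - 1)
        push_cast at this
        rw [sub_add_cancel, hkp, Real.sin_pi] at this
        exact (mul_eq_zero.1 this).resolve_right hsin
      have e1 : ((m : ℤ) - 2) / 2 = k - 1 := by omega
      have e2 : ((m : ℤ) - 1) / 2 = k - 1 := by omega
      rw [e1, e2, h1]
      simp
    · have hkp : (2 * (k : ℝ) + 1) * p = 2 * Real.pi := by
        rw [hk] at hmp; push_cast at hmp; linarith
      have h1 : (Polynomial.Chebyshev.S ℝ (k : ℤ)).eval (2 * Real.cos p) +
          (Polynomial.Chebyshev.S ℝ ((k : ℤ) - 1)).eval (2 * Real.cos p) = 0 := by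
        have h1 := hS k
        have h2 := hS (k - 1)
        push_cast at h1 h2
        rw [sub_add_cancel] at h2
        have h3 : ((k : ℝ) + 1) * p = 2 * Real.pi - k * p := by linarith
        rw [h3, Real.sin_two_pi_sub] at h1
        refine (mul_eq_zero.1 ?_).resolve_right hsin
        rw [add_mul, h1, h2]
        ring
      have e1 : ((m : ℤ) - 2) / 2 = k - 1 := by omega
      have e2 : ((m : ℤ) - 1) / 2 = k := by omega
      have e3 : ((m : ℤ) - 3) / 2 = k - 1 := by omega
      have e4 : (m : ℤ) / 2 = k := by omega
      rw [e1, e2, e3, e4, h1]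
      simp

namespace GCM

variable {I : Type*} [Fintype I] {A : Matrix I I ℝ}

/-- The order attached to the product of two opposite entries of a generalized Cartan matrix
(zero for an infinite order). -/
def order (p : ℝ) : ℕ :=
  if h : ∃ m : ℕ, 2 ≤ m ∧ p = 4 * Real.cos (Real.pi / m) ^ 2 then h.choose else 0

theorem order_spec {p : ℝ} (h : order p ≠ 0) :
    2 ≤ order p ∧ p = 4 * Real.cos (Real.pi / order p) ^ 2 := by
  by_cases hp : ∃ m : ℕ, 2 ≤ m ∧ p = 4 * Real.cos (Real.pi / m) ^ 2
  · rw [order, dif_pos hp]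
    exact hp.choose_spec
  · exact absurd (dif_neg hp) h

/-- The Coxeter matrix of a generalized Cartan matrix. -/
def coxeterMatrix (_ : IsGCM A) : CoxeterMatrix I where
  M i j := if i = j then 1 else order (A i j * A j i)
  isSymm := by
    ext i j
    simp only [Matrix.transpose, Matrix.of_apply, eq_comm (a := j), mul_comm (A j i)]
  diagonal i := if_pos rfl
  off_diagonal i j h := by
    rw [if_neg h]
    intro h1
    have := (order_spec (p := A i j * A j i) (by omega)).1
    omega

/-- The abstract Coxeter group of a generalized Cartan matrix. -/
abbrev CoxGroup (hA : IsGCM A) : Type _ := (coxeterMatrix hA).Group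

/-- Its Coxeter system. -/
abbrev cs (hA : IsGCM A) : CoxeterSystem (coxeterMatrix hA) (CoxGroup hA) :=
  (coxeterMatrix hA).toCoxeterSystem

/-- The module is arbitrary because the same relations are needed on ℝ^I and on 𝔥*. -/
theorem isLiftable_reflection (hA : IsGCM A) {E : Type*} [AddCommGroup E] [Module ℝ E]
    {x : I → E} {f : I → Module.Dual ℝ E} (hf : ∀ i, f i (x i) = 2)
    (h : ∀ i j, f i (x j) * f j (x i) = A i j * A j i)
    (h0 : ∀ i j, i ≠ j → A i j = 0 → f i (x j) = 0) :
    (coxeterMatrix hA).IsLiftable fun i => Module.reflection (hf i) := by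
  intro i j
  by_cases hij : i = j
  · subst hij
    ext z
    simp only [CoxeterMatrix.diagonal, pow_one, LinearEquiv.mul_apply, LinearEquiv.coe_one, id]
    exact Module.involutive_reflection (hf i) z
  · have hM : (coxeterMatrix hA) i j = order (A i j * A j i) := if_neg hij
    rw [hM]
    by_cases ho : order (A i j * A j i) = 0
    · rw [ho, pow_zero]
    · obtain ⟨h2, hp⟩ := order_spec ho
      refine Module.reflection_mul_reflection_pow_eq_one (hf i) (hf j) h2 ((h i j).trans hp) ?_
      intro hz
      rw [h] at hz
      have : A i j = 0 ∧ A j i = 0 := by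
        rcases mul_eq_zero.1 hz with hz | hz
        · exact ⟨hz, (eq_zero_comm hA).1 hz⟩
        · exact ⟨(eq_zero_comm hA).1 hz, hz⟩
      exact ⟨h0 i j hij this.1, h0 j i (Ne.symm hij) this.2⟩

/-- The functional `α_i` on `ℝ^I`. -/
def coroot (A : Matrix I I ℝ) (i : I) : Module.Dual ℝ (I → ℝ) :=
  Fintype.linearCombination ℝ (fun k => A k i)

theorem coroot_apply (i : I) (v : I → ℝ) : coroot A i v = ∑ k, v k * A k i := by
  simp [coroot, Fintype.linearCombination_apply]

/-- The basis vectors of `ℝ^I`. -/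
abbrev e (i : I) : I → ℝ := Pi.single i 1

@[simp] theorem coroot_e (i j : I) : coroot A i (e j) = A j i := by
  simp [coroot, Fintype.linearCombination_apply_single]

theorem coroot_e_self (hA : IsGCM A) (i : I) : coroot A i (e i) = 2 := by
  rw [coroot_e, hA.diag]

/-- The geometric representation on `ℝ^I`. -/
def rep (hA : IsGCM A) : CoxGroup hA →* ((I → ℝ) ≃ₗ[ℝ] (I → ℝ)) :=
  (cs hA).lift ⟨fun i => Module.reflection (coroot_e_self hA i),
    isLiftable_reflection hA (coroot_e_self hA) (fun i j => by simp [mul_comm])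
      (fun i j _ h => by simpa using (eq_zero_comm hA).1 h)⟩

theorem rep_simple (hA : IsGCM A) (i : I) (v : I → ℝ) :
    rep hA ((cs hA).simple i) v = v - coroot A i v • e i := by
  rw [rep, CoxeterSystem.lift_apply_simple, Module.reflection_apply]

theorem rep_simple_e (hA : IsGCM A) (i : I) : rep hA ((cs hA).simple i) (e i) = - e i := by
  rw [rep_simple, coroot_e, hA.diag]
  module

open CoxeterSystem in
-- Rescaling e_j by r replaces the possibly different entries a_ij and a_ji by the common value -t,
-- so one recursive sequence q serves both parities.
theorem rep_alternatingWord (hA : IsGCM A) {i j : I} {q : ℕ → ℝ} {t r : ℝ}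
    (hq0 : q 0 = 0) (hq1 : q 1 = 1) (hq : ∀ n, q (n + 2) = t * q (n + 1) - q n)
    (ha : r * t = - A i j) (hb : - A j i * r = t) (k : ℕ) :
    rep hA ((cs hA).wordProd (alternatingWord i j k)) (e i) =
      if Even k then q (k + 1) • e i + (r * q k) • e j
      else q k • e i + (r * q (k + 1)) • e j := by
  induction k with
  | zero => simp [alternatingWord, hq0, hq1]
  | succ k ih =>
    rw [alternatingWord_succ', CoxeterSystem.wordProd_cons, map_mul, LinearEquiv.mul_apply, ih]
    by_cases hk : Even k
    · have hk' : ¬ Even (k + 1) := by simpa [Nat.even_add_one] using hk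
      simp only [hk, hk', if_true, if_false, rep_simple, map_add, map_smul, coroot_e, hA.diag]
      have : r * q (k + 1 + 1) = - (A i j) * q (k + 1) - r * q k := by
        rw [hq, ← ha]; ring
      rw [this]
      module
    · have hk' : Even (k + 1) := by simpa [Nat.even_add_one] using hk
      simp only [hk, hk', if_true, if_false, rep_simple, map_add, map_smul, coroot_e, hA.diag]
      have : q (k + 1 + 1) = (- (A j i) * r) * q (k + 1) - q k := by
        rw [hq, ← hb]
      rw [this]
      module

/-- For finite order m the sequence is sin(nπ/m)/sin(π/m), nonnegative up to n = m. Otherwise √p ≥ 2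
and the recursion makes it nondecreasing. -/
theorem exists_chebyshev_nonneg {p : ℝ}
    (h4 : p < 4 → ∃ m : ℕ, 2 ≤ m ∧ p = 4 * Real.cos (Real.pi / m) ^ 2) :
    ∃ q : ℕ → ℝ, q 0 = 0 ∧ q 1 = 1 ∧ (∀ n, q (n + 2) = √p * q (n + 1) - q n) ∧
      ∀ n, (order p ≠ 0 → n ≤ order p) → 0 ≤ q n := by
  refine ⟨fun n => (Polynomial.Chebyshev.S ℝ ((n : ℤ) - 1)).eval (√p), by simp, by simp, ?_, ?_⟩
  · intro n
    have := Polynomial.Chebyshev.S_add_two ℝ ((n : ℤ) - 1)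
    have h1 : ((n + 2 : ℕ) : ℤ) - 1 = (n : ℤ) - 1 + 2 := by push_cast; ring
    have h2 : ((n + 1 : ℕ) : ℤ) - 1 = (n : ℤ) - 1 + 1 := by push_cast; ring
    simp only [h1, h2, this]
    simp
  · intro n hn
    by_cases ho : order p = 0
    · have hp4 : 4 ≤ p := by
        by_contra hlt
        have hex := h4 (not_le.1 hlt)
        rw [order, dif_pos hex] at ho
        have := hex.choose_spec.1
        omega
      have ht : 2 ≤ √p := Real.le_sqrt_of_sq_le (by linarith)
      have key : ∀ n : ℕ, 0 ≤ (Polynomial.Chebyshev.S ℝ ((n : ℤ) - 1)).eval (√p) ∧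
          (Polynomial.Chebyshev.S ℝ ((n : ℤ) - 1)).eval (√p) ≤
          (Polynomial.Chebyshev.S ℝ (n : ℤ)).eval (√p) := by
        intro n
        induction n with
        | zero => simp
        | succ n ih =>
          have h3 := Polynomial.Chebyshev.S_add_one ℝ (n : ℤ)
          push_cast
          rw [add_sub_cancel_right, h3]
          simp only [Polynomial.eval_sub, Polynomial.eval_mul, Polynomial.eval_X]
          constructor
          · linarith [ih.1, ih.2]
          · nlinarith [ih.1, ih.2]
      exact (key n).1
    · obtain ⟨h2, hpe⟩ := order_spec ho
      set m := order p
      have hm0 : (2 : ℝ) ≤ m := by exact_mod_cast h2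
      have hpm : Real.pi / m ≤ Real.pi / 2 := by
        apply div_le_div_of_nonneg_left Real.pi_pos.le (by norm_num) hm0
      have hpm0 : 0 < Real.pi / m := by positivity
      have hcos : 0 ≤ Real.cos (Real.pi / m) :=
        Real.cos_nonneg_of_neg_pi_div_two_le_of_le (by linarith) hpm
      have hs : √p = 2 * Real.cos (Real.pi / m) := by
        rw [hpe, show 4 * Real.cos (Real.pi / m) ^ 2 = (2 * Real.cos (Real.pi / m)) ^ 2 by ring]
        exact Real.sqrt_sq (by linarith)
      have hsin : 0 < Real.sin (Real.pi / m) :=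
        Real.sin_pos_of_pos_of_lt_pi hpm0 (by linarith [Real.pi_pos])
      have h3 := Polynomial.Chebyshev.S_two_mul_real_cos (Real.pi / m) ((n : ℤ) - 1)
      push_cast at h3
      rw [sub_add_cancel] at h3
      have hnm : (n : ℝ) ≤ m := by exact_mod_cast hn ho
      have h4 : 0 ≤ Real.sin (n * (Real.pi / m)) := by
        apply Real.sin_nonneg_of_nonneg_of_le_pi (by positivity)
        calc (n : ℝ) * (Real.pi / m) ≤ m * (Real.pi / m) := by gcongr
          _ = Real.pi := by field_simp
      rw [hs]
      rw [← h3] at h4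
      exact nonneg_of_mul_nonneg_left h4 hsin

open CoxeterSystem in
theorem rep_alternatingWord_nonneg (hA : IsGCM A) {i j : I} (hij : i ≠ j) {k : ℕ}
    (hk : coxeterMatrix hA i j ≠ 0 → k < coxeterMatrix hA i j) :
    ∃ x y : ℝ, 0 ≤ x ∧ 0 ≤ y ∧
      rep hA ((cs hA).wordProd (alternatingWord i j k)) (e i) = x • e i + y • e j := by
  have hM : (coxeterMatrix hA) i j = order (A i j * A j i) := if_neg hij
  rw [hM] at hk
  have hp : 0 ≤ A i j * A j i :=
    mul_nonneg_of_nonpos_of_nonpos (offdiag_nonpos hA hij) (offdiag_nonpos hA hij.symm)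
  obtain ⟨q, hq0, hq1, hq, hqn⟩ := exists_chebyshev_nonneg (hA.angle i j hij)
  set t := √(A i j * A j i) with ht
  have htt : t * t = A i j * A j i := Real.mul_self_sqrt hp
  have hr : 0 ≤ - A i j / t :=
    div_nonneg (neg_nonneg.2 (offdiag_nonpos hA hij)) (Real.sqrt_nonneg _)
  have hab : (- A i j / t) * t = - A i j ∧ - A j i * (- A i j / t) = t := by
    -- For t = 0 the entries vanish, and the scaling factor -a_ij/t is 0 by the convention on
    -- division by zero.
    by_cases h0 : t = 0
    · rw [h0, mul_zero] at htt
      have : A i j = 0 := by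
        rcases mul_eq_zero.1 htt.symm with hz | hz
        · exact hz
        · exact (eq_zero_comm hA).1 hz
      simp [this, h0]
    · refine ⟨div_mul_cancel₀ _ h0, ?_⟩
      rw [← mul_div_assoc, div_eq_iff h0, htt]
      ring
  rw [rep_alternatingWord hA hq0 hq1 hq hab.1 hab.2]
  have hk1 : 0 ≤ q (k + 1) := hqn _ fun h => hk h
  have hk0 : 0 ≤ q k := hqn _ fun h => (hk h).le
  by_cases hke : Even k
  · exact ⟨_, _, hk1, mul_nonneg hr hk0, by rw [if_pos hke]⟩
  · exact ⟨_, _, hk0, mul_nonneg hr hk1, by rw [if_neg hke]⟩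

open CoxeterSystem in
-- Right descents in {i, j} are stripped off one at a time. Two consecutive letters cannot agree,
-- since they would cancel and contradict the length count.
theorem exists_eq_mul_alternatingWord {M : CoxeterMatrix I} {W : Type*} [Group W]
    (cs : CoxeterSystem M W) (i j : I) (n : ℕ) :
    ∀ g : W, cs.length g = n → ∃ (v : W) (k : ℕ) (p q : I), ((p = i ∧ q = j) ∨ (p = j ∧ q = i)) ∧
      g = v * cs.wordProd (alternatingWord p q k) ∧ cs.length g = cs.length v + k ∧
      ¬ cs.IsRightDescent v i ∧ ¬ cs.IsRightDescent v j := by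
  induction n using Nat.strong_induction_on with
  | _ n ih =>
    intro g hg
    by_cases hd : ∃ l, (l = i ∨ l = j) ∧ cs.IsRightDescent g l
    · obtain ⟨l, hl, hgl⟩ := hd
      have hgl1 := cs.isRightDescent_iff.1 hgl
      obtain ⟨v, k, p, q, hpq, he, hlen, hv⟩ := ih (cs.length (g * cs.simple l)) (by omega) _ rfl
      have hg' : g = v * cs.wordProd (alternatingWord p q k) * cs.simple l := by
        rw [← he, CoxeterSystem.simple_mul_simple_cancel_right]
      by_cases hk : k = 0
      · subst hk
        obtain ⟨l', hl'⟩ : ∃ l', (l' = i ∧ l = j) ∨ (l' = j ∧ l = i) := by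
          rcases hl with rfl | rfl
          · exact ⟨j, Or.inr ⟨rfl, rfl⟩⟩
          · exact ⟨i, Or.inl ⟨rfl, rfl⟩⟩
        refine ⟨v, 1, l', l, hl', ?_, by omega, hv⟩
        rw [hg']
        simp [alternatingWord]
      · obtain ⟨k, rfl⟩ := Nat.exists_eq_succ_of_ne_zero hk
        by_cases hlq : l = q
        · exfalso
          subst hlq
          have h1 : g = v * cs.wordProd (alternatingWord l p k) := by
            rw [hg', alternatingWord_succ, CoxeterSystem.wordProd_concat, ← mul_assoc,
              CoxeterSystem.simple_mul_simple_cancel_right]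
          have h2 := cs.length_mul_le v (cs.wordProd (alternatingWord l p k))
          have h3 := cs.length_wordProd_le (alternatingWord l p k)
          rw [length_alternatingWord] at h3
          rw [← h1] at h2
          omega
        · have hlp : l = p := by
            rcases hpq with ⟨rfl, rfl⟩ | ⟨rfl, rfl⟩
            · exact hl.resolve_right hlq
            · exact hl.resolve_left hlq
          subst hlp
          refine ⟨v, k + 1 + 1, q, l, ?_, ?_, by omega, hv⟩
          · rcases hpq with h | h
            · exact Or.inr ⟨h.2, h.1⟩
            · exact Or.inl ⟨h.2, h.1⟩
          · rw [hg', alternatingWord_succ q l, CoxeterSystem.wordProd_concat, mul_assoc]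
    · push Not at hd
      exact ⟨g, 0, i, j, Or.inl ⟨rfl, rfl⟩, by simp [alternatingWord], by simp,
        hd i (Or.inl rfl), hd j (Or.inr rfl)⟩

theorem e_nonneg (i : I) : (0 : I → ℝ) ≤ e i := Pi.single_nonneg.2 zero_le_one

open CoxeterSystem in
-- Choose a right descent j and write g = v·d with d alternating in i, j and v without descents
-- there. As i is not a descent of g, the braid relation keeps d shorter than the order of s_i s_j,
-- so d(e_i) is a nonnegative combination of e_i and e_j. The induction hypothesis for the shorter v
-- finishes.
theorem rep_nonneg_of_not_isRightDescent (hA : IsGCM A) (n : ℕ) :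
    ∀ g : CoxGroup hA, (cs hA).length g = n → ∀ i, ¬ (cs hA).IsRightDescent g i →
      0 ≤ rep hA g (e i) := by
  induction n using Nat.strong_induction_on with
  | _ n ih =>
    intro g hg i hi
    by_cases hg1 : g = 1
    · subst hg1
      simp
    obtain ⟨j, hj⟩ := (cs hA).exists_rightDescent_of_ne_one hg1
    have hij : i ≠ j := fun h => hi (h ▸ hj)
    obtain ⟨v, k, p, q, hpq, he, hlen, hvi, hvj⟩ := exists_eq_mul_alternatingWord (cs hA) i j _ g rfl
    have hk : k ≠ 0 := by
      rintro rfl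
      have : g = v := by rw [he]; simp [alternatingWord]
      exact hvj (this ▸ hj)
    have hlast : ∀ (l l' : I) (k : ℕ), g = v * (cs hA).wordProd (alternatingWord l' l (k + 1)) →
        (cs hA).length g = (cs hA).length v + (k + 1) → (cs hA).IsRightDescent g l := by
      intro l l' k h1 h2
      have h3 : g * (cs hA).simple l = v * (cs hA).wordProd (alternatingWord l l' k) := by
        rw [h1, alternatingWord_succ, CoxeterSystem.wordProd_concat, ← mul_assoc,
          CoxeterSystem.simple_mul_simple_cancel_right]
      have h4 := (cs hA).length_mul_le v ((cs hA).wordProd (alternatingWord l l' k))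
      have h5 := (cs hA).length_wordProd_le (alternatingWord l l' k)
      rw [length_alternatingWord] at h5
      rw [IsRightDescent, h3]
      omega
    obtain ⟨k', rfl⟩ := Nat.exists_eq_succ_of_ne_zero hk
    rcases hpq with ⟨rfl, rfl⟩ | ⟨rfl, rfl⟩
    · have hkM : coxeterMatrix hA p q ≠ 0 → k' + 1 < coxeterMatrix hA p q := by
        intro hM
        by_contra hle
        rcases (not_lt.1 hle).eq_or_lt with heq | hlt
        · apply hi
          apply hlast p q k' _ hlen
          have hb := (cs hA).wordProd_braidWord_eq p q
          rw [braidWord, braidWord, (coxeterMatrix hA).symmetric q p, heq] at hb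
          rw [he, hb]
        · apply (cs hA).not_isReduced_alternatingWord p q hM hlt
          have h4 := (cs hA).length_mul_le v ((cs hA).wordProd (alternatingWord p q (k' + 1)))
          have h5 := (cs hA).length_wordProd_le (alternatingWord p q (k' + 1))
          rw [length_alternatingWord] at h5
          rw [← he] at h4
          rw [CoxeterSystem.IsReduced, length_alternatingWord]
          omega
      obtain ⟨x, y, hx, hy, hxy⟩ := rep_alternatingWord_nonneg hA hij hkM
      rw [he, map_mul, LinearEquiv.mul_apply, hxy, map_add, map_smul, map_smul]
      have h1 := ih _ (by omega) v rfl _ hvi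
      have h2 := ih _ (by omega) v rfl _ hvj
      exact add_nonneg (smul_nonneg hx h1) (smul_nonneg hy h2)
    · exact absurd (hlast _ _ _ he hlen) hi

theorem rep_nonneg_iff (hA : IsGCM A) (g : CoxGroup hA) (i : I) :
    0 ≤ rep hA g (e i) ↔ ¬ (cs hA).IsRightDescent g i := by
  refine ⟨fun h hd => ?_, rep_nonneg_of_not_isRightDescent hA _ g rfl i⟩
  have h1 := rep_nonneg_of_not_isRightDescent hA _ (g * (cs hA).simple i) rfl i
    ((cs hA).isRightDescent_iff_not_isRightDescent_mul.1 hd)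
  rw [map_mul, LinearEquiv.mul_apply, rep_simple_e, map_neg] at h1
  have h2 : rep hA g (e i) = 0 := le_antisymm (neg_nonneg.1 h1) h
  rw [LinearEquiv.map_eq_zero_iff] at h2
  simpa using congrFun h2 i

theorem rep_nonpos_iff (hA : IsGCM A) (g : CoxGroup hA) (i : I) :
    rep hA g (e i) ≤ 0 ↔ (cs hA).IsRightDescent g i := by
  rw [(cs hA).isRightDescent_iff_not_isRightDescent_mul, ← rep_nonneg_iff, map_mul,
    LinearEquiv.mul_apply, rep_simple_e, map_neg, neg_nonneg]

theorem rep_nonneg_or_nonpos (hA : IsGCM A) (g : CoxGroup hA) (i : I) :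
    0 ≤ rep hA g (e i) ∨ rep hA g (e i) ≤ 0 := by
  rw [rep_nonneg_iff, rep_nonpos_iff]
  exact (em _).symm

theorem eq_one_of_rep_nonneg (hA : IsGCM A) {g : CoxGroup hA} (h : ∀ i, 0 ≤ rep hA g (e i)) :
    g = 1 := by
  by_contra hg
  obtain ⟨i, hi⟩ := (cs hA).exists_rightDescent_of_ne_one hg
  exact (rep_nonneg_iff hA g i).1 (h i) hi

end GCM

/-! ### Standard parabolic subgroups, rigidity of special sets, double cosets -/

namespace GCM

variable {I : Type*} [Fintype I] {A : Matrix I I ℝ}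

theorem rep_mul_apply (hA : IsGCM A) (g g' : CoxGroup hA) (v : I → ℝ) :
    rep hA (g * g') v = rep hA g (rep hA g' v) := by
  rw [map_mul, LinearEquiv.mul_apply]

@[simp] theorem rep_inv_apply_self (hA : IsGCM A) (g : CoxGroup hA) (v : I → ℝ) :
    rep hA g⁻¹ (rep hA g v) = v := by
  rw [← rep_mul_apply, inv_mul_cancel, map_one, LinearEquiv.coe_one, id]

@[simp] theorem rep_apply_inv_self (hA : IsGCM A) (g : CoxGroup hA) (v : I → ℝ) :
    rep hA g (rep hA g⁻¹ v) = v := by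
  rw [← rep_mul_apply, mul_inv_cancel, map_one, LinearEquiv.coe_one, id]

theorem eq_sum_smul_e (v : I → ℝ) : v = ∑ k, v k • e k := by
  ext j
  simp [Finset.sum_apply, Pi.single_apply]

theorem rep_apply_eq_sum (hA : IsGCM A) (g : CoxGroup hA) (v : I → ℝ) :
    rep hA g v = ∑ k, v k • rep hA g (e k) := by
  conv_lhs => rw [eq_sum_smul_e v]
  simp only [map_sum, map_smul]

theorem not_e_nonpos {i : I} : ¬ (e i ≤ (0 : I → ℝ)) := fun h => by
  have := h i
  simp at this
  linarith

theorem not_smul_e_nonpos {i : I} {r : ℝ} (hr : 0 < r) : ¬ (r • e i ≤ (0 : I → ℝ)) := fun h => by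
  have := h i
  simp at this
  linarith

/-- The standard parabolic subgroups of the abstract Coxeter group. -/
def para (hA : IsGCM A) (J : Set I) : Subgroup (CoxGroup hA) :=
  Subgroup.closure ((cs hA).simple '' J)

theorem simple_mem_para (hA : IsGCM A) {J : Set I} {i : I} (hi : i ∈ J) :
    (cs hA).simple i ∈ para hA J := Subgroup.subset_closure ⟨i, hi, rfl⟩

theorem para_mono (hA : IsGCM A) {J K : Set I} (h : J ⊆ K) : para hA J ≤ para hA K :=
  Subgroup.closure_mono (Set.image_mono h)

theorem para_induction (hA : IsGCM A) {J : Set I} {P : CoxGroup hA → Prop} (one : P 1)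
    (mul : ∀ x ∈ para hA J, ∀ i ∈ J, P x → P (x * (cs hA).simple i)) {x : CoxGroup hA}
    (hx : x ∈ para hA J) : P x := by
  refine Subgroup.closure_induction_right (p := fun x _ => P x) one ?_ ?_ hx
  · rintro x hx _ ⟨i, hi, rfl⟩ h
    exact mul x hx i hi h
  · rintro x hx _ ⟨i, hi, rfl⟩ h
    rw [CoxeterSystem.inv_simple]
    exact mul x hx i hi h

theorem para_univ (hA : IsGCM A) : para hA Set.univ = ⊤ := by
  rw [para, Set.image_univ, CoxeterSystem.subgroup_closure_range_simple]

theorem wordProd_mem_para (hA : IsGCM A) {J : Set I} {ω : List I} (h : ∀ i ∈ ω, i ∈ J) :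
    (cs hA).wordProd ω ∈ para hA J := by
  induction ω with
  | nil => simp
  | cons i ω ih =>
    rw [CoxeterSystem.wordProd_cons]
    exact Subgroup.mul_mem _ (simple_mem_para hA (h i (by simp)))
      (ih fun j hj => h j (by simp [hj]))

theorem rep_apply_of_notMem (hA : IsGCM A) {J : Set I} {x : CoxGroup hA} (hx : x ∈ para hA J)
    {i : I} (hi : i ∉ J) : ∀ v : I → ℝ, rep hA x v i = v i := by
  refine para_induction hA (P := fun x => ∀ v : I → ℝ, rep hA x v i = v i) (by simp) ?_ hx
  · intro x hx j hj ih v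
    rw [rep_mul_apply, ih, rep_simple]
    have : i ≠ j := fun h => hi (h ▸ hj)
    simp [this]

/-- For i ∉ J the e_i-coordinate of x(e_i) is still 1, so x(e_i) is not nonpositive. -/
theorem mem_of_isRightDescent (hA : IsGCM A) {J : Set I} {x : CoxGroup hA} (hx : x ∈ para hA J)
    {i : I} (hi : (cs hA).IsRightDescent x i) : i ∈ J := by
  by_contra h
  have h1 := (rep_nonpos_iff hA x i).2 hi i
  rw [rep_apply_of_notMem hA hx h] at h1
  simp at h1
  linarith

theorem mem_of_isReduced (hA : IsGCM A) {J : Set I} {ω : List I} (hω : (cs hA).IsReduced ω)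
    (hx : (cs hA).wordProd ω ∈ para hA J) : ∀ i ∈ ω, i ∈ J := by
  induction ω using List.reverseRecOn with
  | nil => simp
  | append_singleton ω i ih =>
    have hred : (cs hA).IsReduced ω := by
      have := hω.take ω.length
      simpa using this
    have hmul : (cs hA).wordProd (ω ++ [i]) * (cs hA).simple i = (cs hA).wordProd ω := by
      rw [CoxeterSystem.wordProd_append, CoxeterSystem.wordProd_singleton,
        CoxeterSystem.simple_mul_simple_cancel_right]
    have hi : i ∈ J := by
      apply mem_of_isRightDescent hA hx
      rw [CoxeterSystem.IsRightDescent, hmul, hred.eq, hω.eq]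
      simp
    have hx' := Subgroup.mul_mem _ hx (simple_mem_para hA hi)
    rw [hmul] at hx'
    intro j hj
    rcases List.mem_append.1 hj with hj | hj
    · exact ih hred hx' j hj
    · rw [List.mem_singleton.1 hj]
      exact hi

theorem exists_eq_mul_para (hA : IsGCM A) (J : Set I) (n : ℕ) :
    ∀ g : CoxGroup hA, (cs hA).length g = n →
      ∃ g' x, x ∈ para hA J ∧ g = g' * x ∧ ∀ k ∈ J, 0 ≤ rep hA g' (e k) := by
  induction n using Nat.strong_induction_on with
  | _ n ih =>
    intro g hg
    by_cases h : ∃ k ∈ J, (cs hA).IsRightDescent g k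
    · obtain ⟨k, hk, hd⟩ := h
      obtain ⟨g', x, hx, he, hg'⟩ := ih _ (hg ▸ hd) (g * (cs hA).simple k) rfl
      refine ⟨g', x * (cs hA).simple k, Subgroup.mul_mem _ hx (simple_mem_para hA hk), ?_, hg'⟩
      rw [← mul_assoc, ← he, CoxeterSystem.simple_mul_simple_cancel_right]
    · push Not at h
      exact ⟨g, 1, Subgroup.one_mem _, by simp, fun k hk => (rep_nonneg_iff hA g k).2 (h k hk)⟩

theorem exists_eq_para_mul (hA : IsGCM A) (J : Set I) (g : CoxGroup hA) :
    ∃ x g', x ∈ para hA J ∧ g = x * g' ∧ ∀ k ∈ J, 0 ≤ rep hA g'⁻¹ (e k) := by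
  obtain ⟨g', x, hx, he, hg'⟩ := exists_eq_mul_para hA J _ g⁻¹ rfl
  refine ⟨x⁻¹, g'⁻¹, Subgroup.inv_mem _ hx, ?_, by simpa using hg'⟩
  rw [← mul_inv_rev, ← he, inv_inv]

theorem rep_nonneg_of_support (hA : IsGCM A) {J : Set I} {g : CoxGroup hA}
    (hg : ∀ k ∈ J, 0 ≤ rep hA g (e k)) {v : I → ℝ} (hv : 0 ≤ v) (hvJ : ∀ k, k ∉ J → v k = 0) :
    0 ≤ rep hA g v := by
  rw [rep_apply_eq_sum]
  refine Finset.sum_nonneg fun k _ => ?_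
  by_cases hk : k ∈ J
  · exact smul_nonneg (hv k) (hg k hk)
  · simp [hvJ k hk]

/-- The vector v = g⁻¹e_i is nonnegative on J, so e_i = gv is a sum of nonnegative vectors v_k
g(e_k). Extremality of e_i in the positive orthant makes each term with v_k > 0 a multiple of e_i.
-/
theorem rep_inv_e_eq_smul (hA : IsGCM A) {J : Set I} {g : CoxGroup hA}
    (hg : ∀ k ∈ J, 0 ≤ rep hA g (e k)) {i : I} (hi : ∀ k, k ∉ J → rep hA g⁻¹ (e i) k = 0) :
    ∃ k ∈ J, ∃ r : ℝ, 0 < r ∧ rep hA g⁻¹ (e i) = r • e k := by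
  set v := rep hA g⁻¹ (e i) with hv
  have hgv : rep hA g v = e i := rep_apply_inv_self hA g _
  have hv0 : 0 ≤ v := by
    rcases rep_nonneg_or_nonpos hA g⁻¹ i with h | h
    · exact h
    · have := rep_nonneg_of_support hA hg (v := -v) (neg_nonneg.2 h) (fun k hk => by simp [hi k hk])
      rw [map_neg, hgv, neg_nonneg] at this
      exact absurd this not_e_nonpos
  obtain ⟨k, hk⟩ : ∃ k, v k ≠ 0 := by
    by_contra hcon
    push Not at hcon
    have : v = 0 := funext hcon
    rw [this, map_zero] at hgv
    exact not_e_nonpos hgv.ge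
  have hkJ : k ∈ J := by
    by_contra h
    exact hk (hi k h)
  have hkpos : 0 < v k := lt_of_le_of_ne (hv0 k) hk.symm
  have hle : v k • rep hA g (e k) ≤ e i := by
    rw [← hgv, rep_apply_eq_sum hA g v]
    refine Finset.single_le_sum (f := fun k => v k • rep hA g (e k)) (fun l _ => ?_)
      (Finset.mem_univ k)
    by_cases hl : l ∈ J
    · exact smul_nonneg (hv0 l) (hg l hl)
    · simp [hi l hl]
  have hgk : rep hA g (e k) = (rep hA g (e k) i) • e i := by
    ext l
    by_cases hl : l = i
    · subst hl; simp
    · have h1 := hle l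
      have h2 := hg k hkJ l
      simp only [Pi.smul_apply, smul_eq_mul, Pi.single_apply, hl, if_false, mul_zero,
        Pi.zero_apply] at h1 h2 ⊢
      exact le_antisymm (by by_contra hc; nlinarith [not_le.1 hc]) h2
  set c := rep hA g (e k) i with hc
  have hek : e k = c • v := by
    have := congrArg (rep hA g⁻¹) hgk
    rw [rep_inv_apply_self, map_smul] at this
    exact this
  have hcpos : 0 < c := by
    have h1 := congrFun hek k
    simp only [Pi.single_eq_same, Pi.smul_apply, smul_eq_mul] at h1
    by_contra hcon
    nlinarith [not_lt.1 hcon]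
  refine ⟨k, hkJ, c⁻¹, inv_pos.2 hcpos, ?_⟩
  rw [hek, smul_smul, inv_mul_cancel₀ hcpos.ne', one_smul]

/-- Appending a letter i that is a right descent of g adds α_i(c)·g(e_i), a product of two
nonpositive factors. -/
theorem le_rep_of_antidominant (hA : IsGCM A) {c : I → ℝ} (hc : ∀ i, coroot A i c ≤ 0) (n : ℕ) :
    ∀ g : CoxGroup hA, (cs hA).length g = n → c ≤ rep hA g c := by
  induction n with
  | zero =>
    intro g hg
    rw [CoxeterSystem.length_eq_zero_iff] at hg
    simp [hg]
  | succ n ih =>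
    intro g hg
    obtain ⟨i, hi⟩ := (cs hA).exists_rightDescent_of_ne_one (w := g) (by
      rintro rfl
      simp at hg)
    have h1 := ih (g * (cs hA).simple i) (by
      have := (cs hA).isRightDescent_iff.1 hi
      omega)
    have h2 := (rep_nonpos_iff hA g i).2 hi
    have h3 : rep hA g c = rep hA (g * (cs hA).simple i) c + coroot A i c • rep hA g (e i) := by
      rw [rep_mul_apply, rep_simple, map_sub, map_smul]
      module
    rw [h3]
    exact le_add_of_le_of_nonneg h1 (smul_nonneg_of_nonpos_of_nonpos (hc i) h2)

theorem rep_e_of_mem_para_perp (hA : IsGCM A) {J : Set I} {x : CoxGroup hA}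
    (hx : x ∈ para hA (perp A J)) {j : I} (hj : j ∈ J) : rep hA x (e j) = e j := by
  refine para_induction hA (P := fun x => rep hA x (e j) = e j) (by simp) ?_ hx
  · intro x hx i hi ih
    have h0 : A j i = 0 := (eq_zero_comm hA).1 (hi j hj)
    rw [rep_mul_apply, rep_simple, coroot_e, h0, zero_smul, sub_zero, ih]

/-- A right descent i of u lies outside J. If i ∈ J^⊥, strip it and induct. Otherwise α_i(c) < 0 for
the antidominant c of J, and u s_i c = uc - α_i(c) u(e_i) is nonnegative. Since u(e_i) ≤ 0, it is
supported on the simple roots hit by uJ, so e_i lies in the span of J, a contradiction. -/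
theorem mem_para_perp (hA : IsGCM A) {J : Set I} (hJ : HasAntidominant A J) (n : ℕ) :
    ∀ u : CoxGroup hA, (cs hA).length u = n →
      (∀ j ∈ J, ∃ k, ∃ r : ℝ, 0 < r ∧ rep hA u (e j) = r • e k) → u ∈ para hA (perp A J) := by
  induction n with
  | zero =>
    intro u hu _
    rw [CoxeterSystem.length_eq_zero_iff] at hu
    rw [hu]
    exact Subgroup.one_mem _
  | succ n ih =>
    intro u hu huJ
    obtain ⟨i, hi⟩ := (cs hA).exists_rightDescent_of_ne_one (w := u) (by
      rintro rfl
      simp at hu)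
    have hle := (rep_nonpos_iff hA u i).2 hi
    have hiJ : i ∉ J := by
      intro h
      obtain ⟨k, r, hr, he⟩ := huJ i h
      rw [he] at hle
      exact not_smul_e_nonpos hr hle
    by_cases hip : i ∈ perp A J
    · have h1 := ih (u * (cs hA).simple i) (by
        have := (cs hA).isRightDescent_iff.1 hi
        omega) (by
          intro j hj
          have h0 : A j i = 0 := (eq_zero_comm hA).1 (hip j hj)
          obtain ⟨k, r, hr, he⟩ := huJ j hj
          refine ⟨k, r, hr, ?_⟩
          rw [rep_mul_apply, rep_simple, coroot_e, h0, zero_smul, sub_zero, he])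
      have h2 := Subgroup.mul_mem _ h1 (simple_mem_para hA hip)
      rwa [CoxeterSystem.simple_mul_simple_cancel_right] at h2
    · exfalso
      simp only [perp, Set.mem_ofPred_eq, not_forall] at hip
      obtain ⟨j0, hj0, hij0⟩ := hip
      obtain ⟨c, hc, hc0, hcA⟩ := hJ
      have hcnn : 0 ≤ c := fun k => by
        by_cases hk : k ∈ J
        · exact (hc k hk).le
        · exact (hc0 k hk).ge
      have hneg : coroot A i c < 0 := by
        rw [coroot_apply]
        exact sum_mul_neg_of_eq_zero hA hcnn (hc0 i hiJ) (hc j0 hj0)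
          (fun h => hij0 ((eq_zero_comm hA).1 h))
      have hpos : 0 ≤ rep hA (u * (cs hA).simple i) c :=
        hcnn.trans (le_rep_of_antidominant hA (fun i => by rw [coroot_apply]; exact hcA i) _ _ rfl)
      rw [rep_mul_apply, rep_simple, map_sub, map_smul] at hpos
      have hzero : ∀ l, (∀ j ∈ J, ∀ r : ℝ, 0 < r → rep hA u (e j) ≠ r • e l) →
          rep hA u (e i) l = 0 := by
        intro l hl
        have h1 : rep hA u c l = 0 := by
          rw [rep_apply_eq_sum, Finset.sum_apply]
          refine Finset.sum_eq_zero fun j _ => ?_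
          by_cases hj : j ∈ J
          · obtain ⟨k, r, hr, he⟩ := huJ j hj
            have : l ≠ k := by
              rintro rfl
              exact hl j hj r hr he
            simp [he, this]
          · simp [hc0 j hj]
        have h2 := hpos l
        simp only [Pi.zero_apply, Pi.sub_apply, h1, Pi.smul_apply, smul_eq_mul] at h2
        have h3 := hle l
        simp only [Pi.zero_apply] at h3
        nlinarith
      have h1 : rep hA u⁻¹ (rep hA u (e i)) i = 1 := by
        rw [rep_inv_apply_self]; simp
      rw [rep_apply_eq_sum, Finset.sum_apply, Finset.sum_eq_zero] at h1
      · exact zero_ne_one h1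
      · intro l _
        by_cases hl : ∃ j ∈ J, ∃ r : ℝ, 0 < r ∧ rep hA u (e j) = r • e l
        · obtain ⟨j, hj, r, hr, he⟩ := hl
          have h2 : rep hA u⁻¹ (e l) = r⁻¹ • e j := by
            rw [← rep_inv_apply_self hA u (e j), he, map_smul, smul_smul, inv_mul_cancel₀ hr.ne',
              one_smul]
          have h3 : i ≠ j := fun h => hiJ (h ▸ hj)
          rw [h2]
          simp [h3]
        · push Not at hl
          simp [hzero l hl]

/-- The element g⁻¹ s_k g s_j fixes e_j and changes any other e_l only by a multiple of e_j, so it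
makes no simple root negative and is 1. -/
theorem mul_simple_eq_simple_mul (hA : IsGCM A) {g : CoxGroup hA} {j k : I} {r : ℝ}
    (h : rep hA g (e j) = r • e k) : g * (cs hA).simple j = (cs hA).simple k * g := by
  have hk : rep hA g⁻¹ (r • e k) = e j := by rw [← h, rep_inv_apply_self]
  have hr : r ≠ 0 := by
    rintro rfl
    rw [zero_smul, map_zero] at hk
    exact not_e_nonpos hk.ge
  have hk' : rep hA g⁻¹ (e k) = r⁻¹ • e j := by
    rw [← hk, map_smul, smul_smul, inv_mul_cancel₀ hr, one_smul]
  have h1 : g⁻¹ * (cs hA).simple k * g * (cs hA).simple j = 1 := by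
    apply eq_one_of_rep_nonneg
    intro l
    by_cases hl : l = j
    · subst hl
      have : rep hA (g⁻¹ * (cs hA).simple k * g * (cs hA).simple l) (e l) = e l := by
        rw [rep_mul_apply, rep_simple_e, rep_mul_apply, map_neg, h, rep_mul_apply, ← smul_neg,
          map_smul, map_neg, rep_simple_e, neg_neg, hk]
      rw [this]
      exact e_nonneg l
    · refine (rep_nonneg_or_nonpos hA _ l).resolve_right fun hle => ?_
      have h2 := hle l
      simp only [rep_mul_apply, rep_simple, map_sub, map_smul, h, rep_inv_apply_self, hk'] at h2
      simp [hl] at h2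
      linarith
  have h2 := congrArg (fun x => (cs hA).simple k * g * x) h1
  simp only [mul_assoc, mul_one] at h2
  rw [mul_inv_cancel_left, CoxeterSystem.simple_mul_simple_cancel_left] at h2
  exact h2

/-- Let j be the first letter of a reduced word of b. Comparing signs of x and τ shows that τ(e_j)
is supported on J, hence a multiple of some e_k with k ∈ J. Then s_j passes through τ as s_k, is
absorbed in a, and b gets shorter. -/
theorem eq_of_mem_double_coset (hA : IsGCM A) {J K : Set I} {x τ : CoxGroup hA}
    (hx1 : ∀ i ∈ J, 0 ≤ rep hA x⁻¹ (e i)) (hx2 : ∀ i ∈ K, 0 ≤ rep hA x (e i))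
    (hτ1 : ∀ i ∈ J, 0 ≤ rep hA τ⁻¹ (e i)) (hτ2 : ∀ i ∈ K, 0 ≤ rep hA τ (e i)) (n : ℕ) :
    ∀ b ∈ para hA K, (cs hA).length b = n → ∀ a ∈ para hA J, x = a * τ * b → x = τ := by
  induction n using Nat.strong_induction_on with
  | _ n ih =>
    intro b hb hbn a ha he
    by_cases hb1 : b = 1
    · by_cases ha1 : a = 1
      · rw [he, ha1, hb1, one_mul, mul_one]
      · exfalso
        obtain ⟨i, hi⟩ := (cs hA).exists_rightDescent_of_ne_one (inv_ne_one.2 ha1)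
        have ha' := Subgroup.inv_mem _ ha
        have hiJ := mem_of_isRightDescent hA ha' hi
        have h1 := (rep_nonpos_iff hA _ i).2 hi
        have h2 := rep_nonneg_of_support hA hτ1 (neg_nonneg.2 h1) (fun k hk => by
          have : k ≠ i := fun h => hk (h ▸ hiJ)
          rw [Pi.neg_apply, rep_apply_of_notMem hA ha' hk]
          simp [this])
        have h3 := hx1 i hiJ
        rw [he, hb1, mul_one, mul_inv_rev, rep_mul_apply] at h3
        rw [map_neg, neg_nonneg] at h2
        have h4 := le_antisymm h2 h3
        rw [LinearEquiv.map_eq_zero_iff, LinearEquiv.map_eq_zero_iff] at h4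
        exact not_e_nonpos h4.le
    · obtain ⟨j, hj⟩ := (cs hA).exists_rightDescent_of_ne_one (inv_ne_one.2 hb1)
      have hb' := Subgroup.inv_mem _ hb
      have hjK := mem_of_isRightDescent hA hb' hj
      have h1 := (rep_nonpos_iff hA _ j).2 hj
      have h2 := rep_nonneg_of_support hA hx2 (neg_nonneg.2 h1) (fun k hk => by
        have : k ≠ j := fun h => hk (h ▸ hjK)
        rw [Pi.neg_apply, rep_apply_of_notMem hA hb' hk]
        simp [this])
      rw [map_neg, neg_nonneg, ← rep_mul_apply, he, mul_inv_cancel_right, rep_mul_apply] at h2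
      have h3 := hτ2 j hjK
      obtain ⟨k, hk, r, -, hr⟩ := rep_inv_e_eq_smul hA (g := τ⁻¹) hτ1 (i := j) (fun l hl => by
        have h4 := h2 l
        rw [rep_apply_of_notMem hA ha hl] at h4
        rw [inv_inv]
        exact le_antisymm h4 (h3 l))
      rw [inv_inv] at hr
      have hc := mul_simple_eq_simple_mul hA hr
      have hlt := (cs hA).isRightDescent_inv_iff.1 hj
      refine ih _ (hbn ▸ hlt) ((cs hA).simple j * b)
        (Subgroup.mul_mem _ (simple_mem_para hA hjK) hb) rfl (a * (cs hA).simple k)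
        (Subgroup.mul_mem _ ha (simple_mem_para hA hk)) ?_
      rw [mul_assoc a, ← hc, he]
      simp only [mul_assoc, CoxeterSystem.simple_mul_simple_cancel_left]

/-- Stripping descents in K on the right and in J on the left never leaves W_S and ends at a minimal
element of the double coset, which is τ. -/
theorem mem_para_of_double_coset (hA : IsGCM A) {J K S : Set I} {τ : CoxGroup hA}
    (hτ1 : ∀ i ∈ J, 0 ≤ rep hA τ⁻¹ (e i)) (hτ2 : ∀ i ∈ K, 0 ≤ rep hA τ (e i)) (n : ℕ) :
    ∀ x ∈ para hA S, (cs hA).length x = n → ∀ a ∈ para hA J, ∀ b ∈ para hA K, x = a * τ * b →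
      τ ∈ para hA S := by
  induction n using Nat.strong_induction_on with
  | _ n ih =>
    intro x hx hxn a ha b hb he
    by_cases h2 : ∃ j ∈ K, (cs hA).IsRightDescent x j
    · obtain ⟨j, hj, hd⟩ := h2
      have hjS := mem_of_isRightDescent hA hx hd
      refine ih _ (hxn ▸ hd) (x * (cs hA).simple j)
        (Subgroup.mul_mem _ hx (simple_mem_para hA hjS)) rfl a ha (b * (cs hA).simple j)
        (Subgroup.mul_mem _ hb (simple_mem_para hA hj)) ?_
      rw [he, mul_assoc]
    by_cases h1 : ∃ j ∈ J, (cs hA).IsRightDescent x⁻¹ j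
    · obtain ⟨j, hj, hd⟩ := h1
      have hjS := mem_of_isRightDescent hA (Subgroup.inv_mem _ hx) hd
      have hd' := (cs hA).isRightDescent_inv_iff.1 hd
      refine ih _ (hxn ▸ hd') ((cs hA).simple j * x)
        (Subgroup.mul_mem _ (simple_mem_para hA hjS) hx) rfl ((cs hA).simple j * a)
        (Subgroup.mul_mem _ (simple_mem_para hA hj) ha) b hb ?_
      rw [he]
      simp only [mul_assoc]
    push Not at h1 h2
    rw [← eq_of_mem_double_coset hA (fun i hi => (rep_nonneg_iff hA _ i).2 (h1 i hi))
      (fun i hi => (rep_nonneg_iff hA _ i).2 (h2 i hi)) hτ1 hτ2 _ b hb rfl a ha he]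
    exact hx

end GCM

/-! ### The action on 𝔥*, convexity of the Tits cone, and the faces R(Θ) -/

namespace RootBase

open GCM Module

variable {I : Type*} [Fintype I] {𝔥 : Type*} [AddCommGroup 𝔥] [Module ℝ 𝔥]
  (B : RootBase I 𝔥)

theorem isLiftable_simpleRefl : (coxeterMatrix B.isGCM).IsLiftable B.simpleRefl :=
  isLiftable_reflection B.isGCM (x := B.α) (f := fun i => Dual.eval ℝ 𝔥 (B.h i))
    (fun i => by rw [Dual.eval_apply, B.α_h, B.isGCM.diag])
    (fun i j => by simp [B.α_h]) (fun i j _ h => by simpa [B.α_h] using h)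

/-- The action of the abstract Coxeter group on `𝔥*`. -/
def act : CoxGroup B.isGCM →* (Dual ℝ 𝔥 ≃ₗ[ℝ] Dual ℝ 𝔥) :=
  (cs B.isGCM).lift ⟨B.simpleRefl, B.isLiftable_simpleRefl⟩

@[simp] theorem act_simple (i : I) : B.act ((cs B.isGCM).simple i) = B.simpleRefl i := by
  rw [act, CoxeterSystem.lift_apply_simple]

theorem act_mul_apply (g g' : CoxGroup B.isGCM) (l : Dual ℝ 𝔥) :
    B.act (g * g') l = B.act g (B.act g' l) := by
  rw [map_mul, LinearEquiv.mul_apply]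

@[simp] theorem act_inv_apply_self (g : CoxGroup B.isGCM) (l : Dual ℝ 𝔥) :
    B.act g⁻¹ (B.act g l) = l := by
  rw [← act_mul_apply, inv_mul_cancel, map_one, LinearEquiv.coe_one, id]

/-- The equivariant map `ℝ^I → 𝔥` with `e_i ↦ h_i`. -/
def comb : (I → ℝ) →ₗ[ℝ] 𝔥 := Fintype.linearCombination ℝ B.h

@[simp] theorem comb_e (i : I) : B.comb (e i) = B.h i := by
  simp [comb, Fintype.linearCombination_apply_single]

theorem comb_apply (v : I → ℝ) : B.comb v = ∑ k, v k • B.h k := by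
  simp [comb, Fintype.linearCombination_apply]

theorem apply_comb (l : Dual ℝ 𝔥) (v : I → ℝ) : l (B.comb v) = ∑ k, v k * l (B.h k) := by
  simp [comb_apply]

theorem α_comb (i : I) (v : I → ℝ) : B.α i (B.comb v) = coroot B.A i v := by
  simp [apply_comb, coroot_apply, B.α_h]

theorem act_apply_comb_rep (g : CoxGroup B.isGCM) :
    ∀ (l : Dual ℝ 𝔥) (v : I → ℝ), B.act g l (B.comb (rep B.isGCM g v)) = l (B.comb v) := by
  induction g using (cs B.isGCM).simple_induction_left with
  | one => simp
  | mul_simple_left g i ih =>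
    intro l v
    rw [act_mul_apply, rep_mul_apply, act_simple, simpleRefl_apply, rep_simple, map_sub, map_smul,
      comb_e]
    simp only [LinearMap.sub_apply, LinearMap.smul_apply, map_sub, map_smul, ih, α_comb, B.α_h,
      B.isGCM.diag, smul_eq_mul]
    ring

theorem act_apply_comb (g : CoxGroup B.isGCM) (l : Dual ℝ 𝔥) (v : I → ℝ) :
    B.act g l (B.comb v) = l (B.comb (rep B.isGCM g⁻¹ v)) := by
  rw [← B.act_apply_comb_rep g l, rep_apply_inv_self]

theorem act_apply_h (g : CoxGroup B.isGCM) (l : Dual ℝ 𝔥) (i : I) :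
    B.act g l (B.h i) = l (B.comb (rep B.isGCM g⁻¹ (e i))) := by
  rw [← act_apply_comb, comb_e]

theorem act_wordProd (ω : List I) : B.act ((cs B.isGCM).wordProd ω) = B.wordProd ω := by
  induction ω with
  | nil => simp [wordProd]
  | cons i ω ih =>
    rw [CoxeterSystem.wordProd_cons, map_mul, ih, act_simple]
    simp [wordProd]

theorem parabolic_eq_map (J : Set I) : B.parabolic J = (para B.isGCM J).map B.act := by
  rw [parabolic, para, MonoidHom.map_closure, Set.image_image]
  simp only [act_simple]

theorem mem_parabolic {J : Set I} {σ : Dual ℝ 𝔥 ≃ₗ[ℝ] Dual ℝ 𝔥} :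
    σ ∈ B.parabolic J ↔ ∃ g ∈ para B.isGCM J, B.act g = σ := by
  rw [parabolic_eq_map, Subgroup.mem_map]

theorem mem_W {σ : Dual ℝ 𝔥 ≃ₗ[ℝ] Dual ℝ 𝔥} : σ ∈ B.W ↔ ∃ g, B.act g = σ := by
  rw [W, mem_parabolic, para_univ]
  simp

theorem apply_comb_nonneg {l : Dual ℝ 𝔥} {v : I → ℝ} (hv : 0 ≤ v)
    (hl : ∀ k, v k ≠ 0 → 0 ≤ l (B.h k)) : 0 ≤ l (B.comb v) := by
  rw [apply_comb]
  refine Finset.sum_nonneg fun k _ => ?_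
  by_cases hk : v k = 0
  · simp [hk]
  · exact mul_nonneg (hv k) (hl k hk)

theorem eq_zero_of_apply_comb_eq_zero {l : Dual ℝ 𝔥} {v : I → ℝ} (hv : 0 ≤ v)
    (hl : ∀ k, v k ≠ 0 → 0 ≤ l (B.h k)) (h : l (B.comb v) = 0) {k : I} (hk : v k ≠ 0) :
    l (B.h k) = 0 := by
  rw [apply_comb, Finset.sum_eq_zero_iff_of_nonneg] at h
  · exact (mul_eq_zero.1 (h k (Finset.mem_univ k))).resolve_left hk
  · intro j _
    by_cases hj : v j = 0
    · simp [hj]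
    · exact mul_nonneg (hv j) (hl j hj)

theorem exists_pos [FiniteDimensional ℝ 𝔥] : ∃ l : Dual ℝ 𝔥, ∀ i, 0 < l (B.h i) :=
  exists_dual_pos B.h B.posIndep

theorem rep_nonneg_of_comb_eq [FiniteDimensional ℝ 𝔥] {g : CoxGroup B.isGCM} {i j : I} {r : ℝ}
    (hr : 0 < r) (h : B.comb (rep B.isGCM g (e j)) = r • B.h i) :
    0 ≤ rep B.isGCM g (e j) := by
  refine (rep_nonneg_or_nonpos B.isGCM g j).resolve_right fun hle => ?_
  obtain ⟨l, hl⟩ := B.exists_pos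
  have h1 : 0 ≤ l (B.comb (- rep B.isGCM g (e j))) :=
    B.apply_comb_nonneg (neg_nonneg.2 hle) fun k _ => (hl k).le
  rw [map_neg, map_neg, h, map_smul, smul_eq_mul] at h1
  nlinarith [hl i]

/-- The map from ℝ^I to 𝔥 may have a kernel, but a functional positive on all h_i still detects the
sign of a root. Thus the linear group is the abstract Coxeter group, and lengths and reduced words
transfer. -/
theorem act_injective [FiniteDimensional ℝ 𝔥] : Function.Injective B.act := by
  rw [injective_iff_map_eq_one]
  intro g hg
  rw [← inv_eq_one]
  apply eq_one_of_rep_nonneg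
  intro i
  refine (rep_nonneg_or_nonpos B.isGCM g⁻¹ i).resolve_right fun hle => ?_
  obtain ⟨l, hl⟩ := B.exists_pos
  have h1 : 0 ≤ l (B.comb (- rep B.isGCM g⁻¹ (e i))) :=
    B.apply_comb_nonneg (neg_nonneg.2 hle) fun k _ => (hl k).le
  rw [map_neg, map_neg, ← act_apply_h, hg] at h1
  simp only [LinearEquiv.coe_one, id] at h1
  linarith [hl i]

theorem wordProd_eq_act_iff [FiniteDimensional ℝ 𝔥] {ω : List I} {g : CoxGroup B.isGCM} :
    B.wordProd ω = B.act g ↔ (cs B.isGCM).wordProd ω = g := by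
  rw [← act_wordProd, B.act_injective.eq_iff]

theorem length_act [FiniteDimensional ℝ 𝔥] (g : CoxGroup B.isGCM) :
    B.length (B.act g) = (cs B.isGCM).length g := by
  simp only [length, wordProd_eq_act_iff]
  apply le_antisymm
  · obtain ⟨ω, hω, rfl⟩ := (cs B.isGCM).exists_isReduced g
    exact Nat.sInf_le ⟨ω, hω.symm, rfl⟩
  · refine le_csInf ?_ ?_
    · obtain ⟨ω, hω, rfl⟩ := (cs B.isGCM).exists_isReduced g
      exact ⟨_, ω, rfl, rfl⟩
    · rintro k ⟨ω, rfl, rfl⟩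
      exact (cs B.isGCM).length_wordProd_le ω

theorem isReducedWord_act [FiniteDimensional ℝ 𝔥] {ω : List I} {g : CoxGroup B.isGCM} :
    B.IsReducedWord (B.act g) ω ↔ (cs B.isGCM).IsReduced ω ∧ (cs B.isGCM).wordProd ω = g := by
  rw [IsReducedWord, wordProd_eq_act_iff, length_act, CoxeterSystem.IsReduced, and_comm]
  constructor
  · rintro ⟨h1, rfl⟩
    exact ⟨h1.symm, rfl⟩
  · rintro ⟨h1, rfl⟩
    exact ⟨h1.symm, rfl⟩

theorem red_act_subset_iff [FiniteDimensional ℝ 𝔥] {g : CoxGroup B.isGCM} {S : Set I} :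
    B.red (B.act g) ⊆ S ↔ g ∈ para B.isGCM S := by
  constructor
  · intro h
    obtain ⟨ω, hω, rfl⟩ := (cs B.isGCM).exists_isReduced g
    exact wordProd_mem_para _ fun i hi => h ⟨ω, B.isReducedWord_act.2 ⟨hω, rfl⟩, hi⟩
  · rintro hg i ⟨ω, hω, hi⟩
    obtain ⟨h1, rfl⟩ := B.isReducedWord_act.1 hω
    exact mem_of_isReduced _ h1 hg i hi

theorem act_eq_self {g : CoxGroup B.isGCM} {J : Set I} (hg : g ∈ para B.isGCM J) {l : Dual ℝ 𝔥}
    (hl : ∀ i ∈ J, l (B.h i) = 0) : B.act g l = l := by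
  refine para_induction B.isGCM (P := fun g => B.act g l = l) (by simp) ?_ hg
  intro x _ i hi ih
  rw [act_mul_apply, act_simple, simpleRefl_apply, hl i hi, zero_smul, sub_zero, ih]

theorem mem_titsCone {l : Dual ℝ 𝔥} :
    l ∈ B.titsCone ↔ ∃ g, ∃ μ ∈ B.chamber, l = B.act g μ := by
  simp only [titsCone, Set.mem_iUnion, mem_W, Set.mem_image]
  constructor
  · rintro ⟨_, ⟨g, rfl⟩, μ, hμ, rfl⟩
    exact ⟨g, μ, hμ, rfl⟩
  · rintro ⟨g, μ, hμ, rfl⟩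
    exact ⟨_, ⟨g, rfl⟩, μ, hμ, rfl⟩

theorem act_mem_titsCone (g : CoxGroup B.isGCM) {l : Dual ℝ 𝔥} (h : l ∈ B.titsCone) :
    B.act g l ∈ B.titsCone := by
  obtain ⟨g', μ, hμ, rfl⟩ := B.mem_titsCone.1 h
  exact B.mem_titsCone.2 ⟨g * g', μ, hμ, (B.act_mul_apply _ _ _).symm⟩

theorem act_mem_titsCone_iff (g : CoxGroup B.isGCM) {l : Dual ℝ 𝔥} :
    B.act g l ∈ B.titsCone ↔ l ∈ B.titsCone := by
  refine ⟨fun h => ?_, B.act_mem_titsCone g⟩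
  simpa using B.act_mem_titsCone g⁻¹ h

theorem chamber_subset_titsCone : B.chamber ⊆ B.titsCone := fun μ hμ =>
  B.mem_titsCone.2 ⟨1, μ, hμ, by simp⟩

theorem smul_mem_chamber {t : ℝ} (ht : 0 ≤ t) {l : Dual ℝ 𝔥} (h : l ∈ B.chamber) :
    t • l ∈ B.chamber := fun i => by
  simpa using mul_nonneg ht (h i)

theorem smul_mem_titsCone {t : ℝ} (ht : 0 ≤ t) {l : Dual ℝ 𝔥} (h : l ∈ B.titsCone) :
    t • l ∈ B.titsCone := by
  obtain ⟨g, μ, hμ, rfl⟩ := B.mem_titsCone.1 h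
  exact B.mem_titsCone.2 ⟨g, t • μ, B.smul_mem_chamber ht hμ, by simp⟩

theorem isLeftDescent_of_act_apply_neg {g : CoxGroup B.isGCM} {μ : Dual ℝ 𝔥}
    (hμ : μ ∈ B.chamber) {i : I} (h : B.act g μ (B.h i) < 0) :
    (cs B.isGCM).IsLeftDescent g i := by
  rw [← CoxeterSystem.isRightDescent_inv_iff]
  by_contra hd
  have h1 := B.apply_comb_nonneg ((rep_nonneg_iff B.isGCM g⁻¹ i).2 hd) (fun k _ => hμ k)
  rw [← act_apply_h] at h1
  exact absurd h (not_lt.2 h1)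

/-- Move from x in the direction y = gμ until a wall i is met, at x + θy. Then s_i fixes this point
and turns the remainder (1 - θ)y into (1 - θ)s_i gμ, where s_i g is shorter than g because y(h_i) <
0. -/
theorem chamber_add_act_mem_titsCone (n : ℕ) :
    ∀ g : CoxGroup B.isGCM, (cs B.isGCM).length g = n → ∀ x ∈ B.chamber, ∀ μ ∈ B.chamber,
      x + B.act g μ ∈ B.titsCone := by
  induction n using Nat.strong_induction_on with
  | _ n ih =>
    intro g hg x hx μ hμ
    by_cases hall : ∀ i, 0 ≤ (x + B.act g μ) (B.h i)
    · exact B.chamber_subset_titsCone hall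
    push Not at hall
    obtain ⟨i0, hi0⟩ := hall
    have hneg : ∀ i, (x + B.act g μ) (B.h i) < 0 → B.act g μ (B.h i) < 0 := fun i hi => by
      have := hx i
      rw [LinearMap.add_apply] at hi
      linarith
    obtain ⟨i, hi, hmin⟩ := Finset.exists_min_image
      (Finset.univ.filter fun i => B.act g μ (B.h i) < 0)
      (fun i => x (B.h i) / (- B.act g μ (B.h i))) ⟨i0, by simpa using hneg i0 hi0⟩
    simp only [Finset.mem_filter, Finset.mem_univ, true_and] at hi hmin
    set y := B.act g μ with hy
    set θ := x (B.h i) / (- y (B.h i)) with hθ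
    have hθ0 : 0 ≤ θ := div_nonneg (hx i) (by linarith)
    have hz : x + θ • y ∈ B.chamber := by
      intro k
      simp only [LinearMap.add_apply, LinearMap.smul_apply, smul_eq_mul]
      by_cases hk : y (B.h k) < 0
      · have := hmin k hk
        rw [le_div_iff₀ (by linarith)] at this
        linarith
      · have := hx k
        have := mul_nonneg hθ0 (not_lt.1 hk)
        linarith
    have hzi : (x + θ • y) (B.h i) = 0 := by
      simp only [LinearMap.add_apply, LinearMap.smul_apply, smul_eq_mul, hθ]
      rw [div_neg, neg_mul, div_mul_cancel₀ _ hi.ne, add_neg_cancel]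
    have hθ1 : θ ≤ 1 := by
      have h1 := hmin i0 (hneg i0 hi0)
      refine h1.trans ?_
      rw [div_le_one (by linarith [hneg i0 hi0])]
      rw [LinearMap.add_apply] at hi0
      linarith
    have hd : _ < _ := B.isLeftDescent_of_act_apply_neg hμ hi
    have h2 := ih _ (hg ▸ hd) _ rfl _ hz _ (B.smul_mem_chamber (sub_nonneg.2 hθ1) hμ)
    rw [← B.act_mem_titsCone_iff ((cs B.isGCM).simple i)]
    convert h2 using 1
    have h3 : x + y = (x + θ • y) + (1 - θ) • y := by module
    rw [h3, map_add, act_mul_apply, map_smul, map_smul, map_smul, ← hy]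
    congr 1
    rw [act_simple, simpleRefl_apply, hzi, zero_smul, sub_zero]

theorem add_mem_titsCone {x y : Dual ℝ 𝔥} (hx : x ∈ B.titsCone) (hy : y ∈ B.titsCone) :
    x + y ∈ B.titsCone := by
  obtain ⟨g, μ, hμ, rfl⟩ := B.mem_titsCone.1 hx
  obtain ⟨g', μ', hμ', rfl⟩ := B.mem_titsCone.1 hy
  have h := B.chamber_add_act_mem_titsCone _ (g⁻¹ * g') rfl μ hμ μ' hμ'
  rw [← B.act_mem_titsCone_iff g, map_add, ← act_mul_apply, mul_inv_cancel_left] at h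
  exact h

theorem convex_titsCone : Convex ℝ B.titsCone := fun _ hx _ hy _ _ ha hb _ =>
  B.add_mem_titsCone (B.smul_mem_titsCone ha hx) (B.smul_mem_titsCone hb hy)

theorem exists_dominant {l : Dual ℝ 𝔥} (hl : l ∈ B.titsCone) (M : Set I) :
    ∃ g ∈ para B.isGCM M, ∃ x ∈ B.titsCone, (∀ k ∈ M, 0 ≤ x (B.h k)) ∧ l = B.act g x := by
  obtain ⟨g, μ, hμ, rfl⟩ := B.mem_titsCone.1 hl
  obtain ⟨x, g', hx, rfl, hg'⟩ := exists_eq_para_mul B.isGCM M g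
  refine ⟨x, hx, B.act g' μ, B.mem_titsCone.2 ⟨g', μ, hμ, rfl⟩, fun k hk => ?_,
    B.act_mul_apply _ _ _⟩
  rw [act_apply_h]
  exact B.apply_comb_nonneg (hg' k hk) fun k _ => hμ k

/-- Let g' be minimal in gW_N, N being the zeros of μ in M. For i ∈ Θ the root g'⁻¹e_i has constant
sign and pairs to zero with μ, so it is supported on N; minimality makes it a multiple of a simple
root, and rigidity applies to g'⁻¹. The version relative to M is needed because x is dominant only
on M in the computation of intersections. -/
theorem exists_eq_mul_of_vanish {Θ M : Set I} (hΘ : HasAntidominant B.A Θ) (hΘM : Θ ⊆ M)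
    {μ : Dual ℝ 𝔥} (hμ : ∀ k ∈ M, 0 ≤ μ (B.h k)) {g : CoxGroup B.isGCM}
    (hg : g ∈ para B.isGCM M) (hv : ∀ i ∈ Θ, B.act g μ (B.h i) = 0) :
    (∃ a ∈ para B.isGCM (perp B.A Θ), ∃ x ∈ para B.isGCM {k | k ∈ M ∧ μ (B.h k) = 0},
      g = a * x) ∧ ∀ i ∈ Θ, μ (B.h i) = 0 := by
  set N : Set I := {k | k ∈ M ∧ μ (B.h k) = 0} with hN
  obtain ⟨g', x, hx, rfl, hg'⟩ := exists_eq_mul_para B.isGCM N _ g rfl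
  have hxμ : B.act x μ = μ := B.act_eq_self hx fun i hi => hi.2
  have hxM : x ∈ para B.isGCM M := para_mono B.isGCM (fun i hi => hi.1) hx
  have hg'M : g' ∈ para B.isGCM M := (Subgroup.mul_mem_cancel_right _ hxM).1 hg
  rw [act_mul_apply, hxμ] at hv
  have hmem : g'⁻¹ ∈ para B.isGCM (perp B.A Θ) := by
    refine mem_para_perp B.isGCM hΘ _ _ rfl fun i hi => ?_
    have hsuppN : ∀ k, k ∉ N → rep B.isGCM g'⁻¹ (e i) k = 0 := by
      intro k hkN
      have hsupp : ∀ k, rep B.isGCM g'⁻¹ (e i) k ≠ 0 → k ∈ M := by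
        intro k hk
        by_contra hkM
        rw [rep_apply_of_notMem B.isGCM (Subgroup.inv_mem _ hg'M) hkM] at hk
        have : k ≠ i := fun h => hkM (h ▸ hΘM hi)
        simp [this] at hk
      by_contra hk
      apply hkN
      refine ⟨hsupp k hk, ?_⟩
      have h0 := hv i hi
      rw [act_apply_h] at h0
      rcases rep_nonneg_or_nonpos B.isGCM g'⁻¹ i with h | h
      · exact B.eq_zero_of_apply_comb_eq_zero h (fun k hk => hμ k (hsupp k hk)) h0 hk
      · refine B.eq_zero_of_apply_comb_eq_zero (neg_nonneg.2 h)
          (fun k hk => hμ k (hsupp k (by simpa using hk))) ?_ (k := k) (by simpa using hk)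
        rw [map_neg, map_neg, h0, neg_zero]
    obtain ⟨k, -, r, hr, he⟩ := rep_inv_e_eq_smul B.isGCM hg' hsuppN
    exact ⟨k, r, hr, he⟩
  refine ⟨⟨g', by simpa using Subgroup.inv_mem _ hmem, x, hx, rfl⟩, fun i hi => ?_⟩
  have h0 := hv i hi
  rwa [act_apply_h, rep_e_of_mem_para_perp B.isGCM hmem hi, comb_e] at h0

theorem mem_R {Θ : Set I} {l : Dual ℝ 𝔥} :
    l ∈ B.R Θ ↔ ∃ a ∈ para B.isGCM (perp B.A Θ), ∃ μ ∈ B.closedFacet Θ, l = B.act a μ := by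
  simp only [R, Set.mem_iUnion, mem_parabolic, Set.mem_image]
  constructor
  · rintro ⟨_, ⟨a, ha, rfl⟩, μ, hμ, rfl⟩
    exact ⟨a, ha, μ, hμ, rfl⟩
  · rintro ⟨a, ha, μ, hμ, rfl⟩
    exact ⟨_, ⟨a, ha, rfl⟩, μ, hμ, rfl⟩

theorem closedFacet_subset_chamber {Θ : Set I} : B.closedFacet Θ ⊆ B.chamber := by
  intro l hl i
  by_cases hi : i ∈ Θ
  · exact (hl.1 i hi).ge
  · exact hl.2 i hi

theorem mem_closedFacet {Θ : Set I} {l : Dual ℝ 𝔥} :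
    l ∈ B.closedFacet Θ ↔ l ∈ B.chamber ∧ ∀ i ∈ Θ, l (B.h i) = 0 :=
  ⟨fun h => ⟨B.closedFacet_subset_chamber h, h.1⟩, fun h => ⟨h.2, fun i _ => h.1 i⟩⟩

theorem mem_R_iff {Θ : Set I} (hΘ : HasAntidominant B.A Θ) {l : Dual ℝ 𝔥} :
    l ∈ B.R Θ ↔ l ∈ B.titsCone ∧ ∀ i ∈ Θ, l (B.h i) = 0 := by
  rw [mem_R]
  constructor
  · rintro ⟨a, ha, μ, hμ, rfl⟩
    refine ⟨B.act_mem_titsCone _ (B.chamber_subset_titsCone (B.closedFacet_subset_chamber hμ)),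
      fun i hi => ?_⟩
    rw [act_apply_h, rep_e_of_mem_para_perp B.isGCM (Subgroup.inv_mem _ ha) hi, comb_e]
    exact hμ.1 i hi
  · rintro ⟨hl, hv⟩
    obtain ⟨g, μ, hμ, rfl⟩ := B.mem_titsCone.1 hl
    obtain ⟨⟨a, ha, x, hx, rfl⟩, h0⟩ := B.exists_eq_mul_of_vanish hΘ (Set.subset_univ _)
      (fun k _ => hμ k) (g := g) (by rw [para_univ]; trivial) hv
    refine ⟨a, ha, μ, B.mem_closedFacet.2 ⟨hμ, h0⟩, ?_⟩
    rw [act_mul_apply, B.act_eq_self hx fun i hi => hi.2]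

theorem apply_comb_nonneg_of_antidominant {c : I → ℝ} (hc : 0 ≤ c)
    (hcA : ∀ i, ∑ k, c k * B.A k i ≤ 0) {l : Dual ℝ 𝔥} (hl : l ∈ B.titsCone) :
    0 ≤ l (B.comb c) := by
  obtain ⟨g, μ, hμ, rfl⟩ := B.mem_titsCone.1 hl
  rw [act_apply_comb]
  exact B.apply_comb_nonneg (hc.trans (le_rep_of_antidominant B.isGCM
    (fun i => by rw [coroot_apply]; exact hcA i) _ _ rfl)) fun k _ => hμ k

/-- Nonnegativity of c on X alone would give only x(c) = 0. Writing x = ux' with u ∈ W_Θ and x'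
dominant on Θ, and testing with uc, which is again supported on Θ, gives x'(c) = 0. As c > 0 on Θ,
x' vanishes on Θ, whence x = x'. -/
theorem vanish_of_mem_openSegment {Θ : Set I} (hΘ : HasAntidominant B.A Θ) {x y z : Dual ℝ 𝔥}
    (hx : x ∈ B.titsCone) (hy : y ∈ B.titsCone) (hz : ∀ i ∈ Θ, z (B.h i) = 0)
    (h : z ∈ openSegment ℝ x y) : ∀ i ∈ Θ, x (B.h i) = 0 := by
  obtain ⟨c, hc, hc0, hcA⟩ := hΘ
  have hcnn : 0 ≤ c := fun k => by
    by_cases hk : k ∈ Θ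
    · exact (hc k hk).le
    · exact (hc0 k hk).ge
  obtain ⟨u, hu, x', hx', hdom, rfl⟩ := B.exists_dominant hx Θ
  have horb : ∀ l ∈ B.titsCone, 0 ≤ l (B.comb (rep B.isGCM u c)) := fun l hl => by
    have := B.apply_comb_nonneg_of_antidominant hcnn hcA (B.act_mem_titsCone u⁻¹ hl)
    rwa [act_apply_comb, inv_inv] at this
  have hz0 : z (B.comb (rep B.isGCM u c)) = 0 := by
    rw [apply_comb]
    refine Finset.sum_eq_zero fun k _ => ?_
    by_cases hk : k ∈ Θ
    · rw [hz k hk, mul_zero]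
    · rw [rep_apply_of_notMem B.isGCM hu hk, hc0 k hk, zero_mul]
  obtain ⟨a, b, ha, hb, -, rfl⟩ := h
  have h1 := horb _ hx
  have h2 := horb _ hy
  have h3 : B.act u x' (B.comb (rep B.isGCM u c)) = 0 := by
    simp only [LinearMap.add_apply, LinearMap.smul_apply, smul_eq_mul] at hz0
    have := mul_nonneg hb.le h2
    apply le_antisymm _ h1
    by_contra hcon
    nlinarith [mul_pos ha (not_le.1 hcon)]
  rw [act_apply_comb_rep] at h3
  have h4 : ∀ i ∈ Θ, x' (B.h i) = 0 := fun i hi =>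
    B.eq_zero_of_apply_comb_eq_zero hcnn
      (fun k hk => hdom k (by by_contra hkΘ; exact hk (hc0 k hkΘ))) h3 (hc i hi).ne'
  rw [B.act_eq_self hu h4]
  exact h4

theorem R_mem_faceSet {Θ : Set I} (hΘ : HasAntidominant B.A Θ) :
    B.R Θ ∈ faceSet B.titsCone := by
  refine ⟨⟨fun l hl => ((B.mem_R_iff hΘ).1 hl).1, ?_⟩, ?_, 0, ?_⟩
  · intro x hx y hy z hz h
    exact (B.mem_R_iff hΘ).2
      ⟨hx, B.vanish_of_mem_openSegment hΘ hx hy ((B.mem_R_iff hΘ).1 hz).2 h⟩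
  · intro x hx y hy a b ha hb hab
    rw [mem_R_iff B hΘ] at hx hy ⊢
    refine ⟨B.convex_titsCone hx.1 hy.1 ha hb hab, fun i hi => ?_⟩
    simp [hx.2 i hi, hy.2 i hi]
  · rw [mem_R_iff B hΘ]
    exact ⟨B.chamber_subset_titsCone fun i => by simp, fun i _ => by simp⟩

theorem image_mem_faceSet (g : CoxGroup B.isGCM) {F : Set (Dual ℝ 𝔥)}
    (hF : F ∈ faceSet B.titsCone) : B.act g '' F ∈ faceSet B.titsCone := by
  refine ⟨⟨?_, ?_⟩, hF.2.1.linear_image (B.act g).toLinearMap, hF.2.2.image _⟩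
  · rintro _ ⟨l, hl, rfl⟩
    exact B.act_mem_titsCone g (hF.1.subset hl)
  · rintro x hx y hy _ ⟨z, hz, rfl⟩ h
    refine ⟨B.act g⁻¹ x, ?_, by simp⟩
    refine hF.1.left_mem_of_mem_openSegment (B.act_mem_titsCone g⁻¹ hx)
      (B.act_mem_titsCone g⁻¹ hy) hz ?_
    obtain ⟨a, b, ha, hb, hab, h⟩ := h
    refine ⟨a, b, ha, hb, hab, ?_⟩
    have := congrArg (B.act g⁻¹) h
    simpa only [map_add, map_smul, act_inv_apply_self] using this

end RootBase

/-! ### Facial sets and facial closure -/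

namespace RootBase

open GCM Module

variable {I : Type*} [Fintype I] {𝔥 : Type*} [AddCommGroup 𝔥] [Module ℝ 𝔥]
  (B : RootBase I 𝔥)

theorem mem_coneH {J : Set I} {v : 𝔥} :
    v ∈ B.coneH J ↔ ∃ r : I → ℝ, 0 ≤ r ∧ (∀ i, i ∉ J → r i = 0) ∧ v = B.comb r := by
  simp only [coneH, comb_apply]
  rfl

theorem eq_zero_of_comb_eq_h {r : I → ℝ} (hr : 0 ≤ r) {j : I} (hj : r j = 0) : B.comb r ≠ B.h j := by
  intro h
  have h1 := congrArg (B.α j) h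
  rw [α_comb, coroot_apply, B.α_h, B.isGCM.diag] at h1
  have := sum_mul_nonpos_of_eq_zero B.isGCM hr hj
  linarith

theorem h_mem_coneH {J : Set I} {j : I} (h : B.h j ∈ B.coneH J) : j ∈ J := by
  obtain ⟨r, hr, hrJ, he⟩ := B.mem_coneH.1 h
  by_contra hj
  exact B.eq_zero_of_comb_eq_h hr (hrJ j hj) he.symm

theorem smul_mem_coneH {J : Set I} {t : ℝ} (ht : 0 ≤ t) {v : 𝔥} (h : v ∈ B.coneH J) :
    t • v ∈ B.coneH J := by
  obtain ⟨r, hr, hrJ, rfl⟩ := B.mem_coneH.1 h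
  exact B.mem_coneH.2 ⟨t • r, smul_nonneg ht hr, fun i hi => by simp [hrJ i hi], by simp⟩

theorem comb_mem_coneH_univ {r : I → ℝ} (hr : 0 ≤ r) : B.comb r ∈ B.coneH Set.univ :=
  B.mem_coneH.2 ⟨r, hr, fun i hi => absurd (Set.mem_univ i) hi, rfl⟩

theorem isFacial_iff {J : Set I} : B.IsFacial J ↔ ∀ r s : I → ℝ, 0 ≤ r → 0 ≤ s →
    (∀ i, i ∉ J → s i = 0) → B.comb r = B.comb s → ∀ k, r k ≠ 0 → k ∈ J := by
  constructor
  · intro h r s hr hs hsJ he k hk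
    have hrk : 0 < r k := lt_of_le_of_ne (hr k) hk.symm
    have h1 : 0 ≤ r - Pi.single k (r k) := fun l => by
      by_cases hl : l = k
      · subst hl; simp
      · simpa [hl] using hr l
    -- The vector r is the midpoint of 2r_k e_k and 2(r - r_k e_k).
    have h2 := h.1.left_mem_of_mem_openSegment
      (B.comb_mem_coneH_univ (r := (2 * r k) • e k) (smul_nonneg (by linarith) (e_nonneg k)))
      (B.comb_mem_coneH_univ (smul_nonneg (zero_le_two (α := ℝ)) h1))
      (B.mem_coneH.2 ⟨s, hs, hsJ, rfl⟩)
      ⟨1 / 2, 1 / 2, by norm_num, by norm_num, by norm_num, by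
        rw [← he, ← map_smul, ← map_smul, ← map_add]
        congr 1
        ext l
        by_cases hl : l = k
        · subst hl; simp
        · simp [hl]⟩
    rw [map_smul, comb_e] at h2
    have h3 := B.smul_mem_coneH (inv_nonneg.2 (by linarith : 0 ≤ 2 * r k)) h2
    rw [smul_smul, inv_mul_cancel₀ (by positivity), one_smul] at h3
    exact B.h_mem_coneH h3
  · intro h
    refine ⟨⟨?_, ?_⟩, ?_, 0, B.mem_coneH.2 ⟨0, le_rfl, fun _ _ => rfl, by simp⟩⟩
    · intro v hv
      obtain ⟨r, hr, -, rfl⟩ := B.mem_coneH.1 hv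
      exact B.comb_mem_coneH_univ hr
    · intro x hx y hy z hz hseg
      obtain ⟨r, hr, -, rfl⟩ := B.mem_coneH.1 hx
      obtain ⟨r', hr', -, rfl⟩ := B.mem_coneH.1 hy
      obtain ⟨s, hs, hsJ, rfl⟩ := B.mem_coneH.1 hz
      obtain ⟨a, b, ha, hb, -, he⟩ := hseg
      rw [← map_smul, ← map_smul, ← map_add] at he
      refine B.mem_coneH.2 ⟨r, hr, fun i hi => ?_, rfl⟩
      by_contra hri
      apply hi
      refine h _ s (add_nonneg (smul_nonneg ha.le hr) (smul_nonneg hb.le hr')) hs hsJ he i ?_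
      have h1 : 0 < r i := lt_of_le_of_ne (hr i) (Ne.symm hri)
      have h2 := mul_nonneg hb.le (hr' i)
      simp only [Pi.add_apply, Pi.smul_apply, smul_eq_mul]
      positivity
    · intro x hx y hy a b ha hb _
      obtain ⟨r, hr, hrJ, rfl⟩ := B.mem_coneH.1 hx
      obtain ⟨s, hs, hsJ, rfl⟩ := B.mem_coneH.1 hy
      exact B.mem_coneH.2 ⟨a • r + b • s, add_nonneg (smul_nonneg ha hr) (smul_nonneg hb hs),
        fun i hi => by simp [hrJ i hi, hsJ i hi], by simp⟩

/-- The indicator vector of a subset of the index set. -/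
def ind (J : Set I) : I → ℝ := J.indicator 1

theorem ind_nonneg (J : Set I) : 0 ≤ ind J := Set.indicator_nonneg fun _ _ => zero_le_one

theorem facialClosure_subset {M J : Set I} (hJ : B.IsFacial J) (h : M ⊆ J) :
    B.facialClosure M ⊆ J := Set.sInter_subset_of_mem ⟨hJ, h⟩

/-- The closure consists of those j for which some multiple of the sum of the h_i, i ∈ M, exceeds
h_j by an element of the cone: this is the smallest face through that sum. -/
theorem facialClosure_eq (M : Set I) : B.IsFacial (B.facialClosure M) ∧
    ∀ j ∈ B.facialClosure M, ∃ N : ℝ, 0 ≤ N ∧ ∃ r : I → ℝ, 0 ≤ r ∧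
      B.comb (N • ind M) = B.comb (e j + r) := by
  let S : Set I := {j | ∃ N : ℝ, 0 ≤ N ∧ ∃ r : I → ℝ, 0 ≤ r ∧ B.comb (N • ind M) = B.comb (e j + r)}
  have hS : B.IsFacial S := by
    rw [isFacial_iff]
    intro r s hr hs hsS he k hk
    have hrk : 0 < r k := lt_of_le_of_ne (hr k) hk.symm
    have hch : ∀ j, ∃ N : ℝ, 0 ≤ N ∧ ∃ t : I → ℝ, 0 ≤ t ∧
        B.comb (N • ind M) = B.comb (s j • e j + t) := by
      intro j
      by_cases hj : j ∈ S
      · obtain ⟨N, hN, t, ht, h⟩ := hj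
        refine ⟨s j * N, mul_nonneg (hs j) hN, s j • t, smul_nonneg (hs j) ht, ?_⟩
        rw [mul_smul, map_smul, h, ← map_smul, smul_add]
      · exact ⟨0, le_rfl, 0, le_rfl, by simp [hsS j hj]⟩
    choose N hN t ht h using hch
    have hsum : B.comb ((∑ j, N j) • ind M) = B.comb (r + ∑ j, t j) := by
      rw [Finset.sum_smul, map_sum, Finset.sum_congr rfl fun j _ => h j, ← map_sum,
        Finset.sum_add_distrib, ← eq_sum_smul_e s, map_add, map_add, he]
    refine ⟨(r k)⁻¹ * ∑ j, N j, mul_nonneg (inv_nonneg.2 hrk.le)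
      (Finset.sum_nonneg fun j _ => hN j), (r k)⁻¹ • (r + ∑ j, t j) - e k, ?_, ?_⟩
    · intro l
      have h1 : 0 ≤ (∑ j, t j) l := (Finset.sum_nonneg fun j _ => ht j : 0 ≤ ∑ j, t j) l
      by_cases hl : l = k
      · subst hl
        have h2 : 0 ≤ (r l)⁻¹ * (∑ j, t j) l := mul_nonneg (inv_nonneg.2 hrk.le) h1
        simp only [Pi.zero_apply, Pi.sub_apply, Pi.smul_apply, Pi.add_apply, smul_eq_mul,
          Pi.single_eq_same, mul_add, inv_mul_cancel₀ hk]
        linarith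
      · simp only [Pi.zero_apply, Pi.sub_apply, Pi.smul_apply, Pi.add_apply, smul_eq_mul,
          Pi.single_apply, hl, if_false, sub_zero]
        exact mul_nonneg (inv_nonneg.2 hrk.le) (add_nonneg (hr l) h1)
    · rw [mul_smul, map_smul, hsum, ← map_smul, add_sub_cancel]
  have hMS : M ⊆ S := by
    intro j hj
    refine ⟨1, zero_le_one, ind M - e j, fun l => ?_, by simp⟩
    by_cases hl : l = j
    · subst hl; simp [ind, hj]
    · simpa [hl] using ind_nonneg M l
  have heq : B.facialClosure M = S := by
    apply Set.Subset.antisymm (B.facialClosure_subset hS hMS)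
    rintro j ⟨N, hN, r, hr, h⟩ J ⟨hJ, hMJ⟩
    refine B.isFacial_iff.1 hJ _ _ (add_nonneg (e_nonneg j) hr)
      (smul_nonneg hN (ind_nonneg M)) (fun i hi => ?_) h.symm j ?_
    · have : i ∉ M := fun h => hi (hMJ h)
      simp [ind, this]
    · have := hr j
      simp only [Pi.add_apply, Pi.single_eq_same, Pi.zero_apply] at this ⊢
      linarith
  rw [heq]
  exact ⟨hS, fun j hj => hj⟩

theorem isFacial_facialClosure (M : Set I) : B.IsFacial (B.facialClosure M) :=
  (B.facialClosure_eq M).1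

theorem subset_facialClosure (M : Set I) : M ⊆ B.facialClosure M :=
  Set.subset_sInter fun _ hJ => hJ.2

/-- Add up the relations describing membership of each j in the closure. The indices added to M
acquire positive coefficients, which is all that is needed to carry antidominance, orthogonality and
vanishing from M to its closure. -/
theorem exists_relation (M : Set I) : ∃ ρ : I → ℝ, B.comb ρ = 0 ∧
    (∀ k ∈ B.facialClosure M, k ∉ M → 0 < ρ k) ∧ ∀ k, k ∉ B.facialClosure M → ρ k = 0 := by
  obtain ⟨hf, hr⟩ := B.facialClosure_eq M
  set S := B.facialClosure M with hS
  choose! N hN r hr0 he using hr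
  have hrS : ∀ j ∈ S, ∀ k, k ∉ S → r j k = 0 := by
    intro j hj k hk
    by_contra hne
    apply hk
    refine B.isFacial_iff.1 hf _ _ (add_nonneg (e_nonneg j) (hr0 j hj))
      (smul_nonneg (hN j hj) (ind_nonneg M)) (fun i hi => ?_) (he j hj).symm k ?_
    · have : i ∉ M := fun h => hi (B.subset_facialClosure M h)
      simp [ind, this]
    · have h1 := e_nonneg j k
      have h2 : 0 < r j k := lt_of_le_of_ne (hr0 j hj k) (Ne.symm hne)
      simp only [Pi.add_apply, Pi.zero_apply] at h1 ⊢
      linarith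
  refine ⟨∑ j ∈ Finset.univ.filter (· ∈ S), (e j + r j - N j • ind M), ?_, ?_, ?_⟩
  · rw [map_sum]
    refine Finset.sum_eq_zero fun j hj => ?_
    rw [map_sub, he j (by simpa using hj), sub_self]
  · intro k hk hkM
    rw [Finset.sum_apply]
    refine Finset.sum_pos' (fun j hj => ?_) ⟨k, by simpa using hk, ?_⟩
    · have h1 := e_nonneg j k
      have h2 := hr0 j (by simpa using hj) k
      simp only [Pi.zero_apply] at h1 h2
      simp [ind, hkM]
      linarith
    · have h2 := hr0 k hk k
      simp only [Pi.zero_apply] at h2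
      simp [ind, hkM]
      linarith
  · intro k hk
    rw [Finset.sum_apply]
    refine Finset.sum_eq_zero fun j hj => ?_
    have hj : j ∈ S := by simpa using hj
    have h1 : k ≠ j := fun h => hk (h ▸ hj)
    have h2 : k ∉ M := fun h => hk (B.subset_facialClosure M h)
    simp [ind, h1, h2, hrS j hj k hk]

theorem hasAntidominant_facialClosure {M : Set I} (hM : HasAntidominant B.A M) :
    HasAntidominant B.A (B.facialClosure M) := by
  obtain ⟨c, hc, hc0, hcA⟩ := hM
  obtain ⟨ρ, hρ, hρ1, hρ0⟩ := B.exists_relation M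
  -- The new antidominant vector is Nc + ρ: every α_i kills ρ, and a large N outweighs negative
  -- entries of ρ on M.
  have hev : ∀ᶠ N : ℝ in Filter.atTop, 0 < N ∧ ∀ k ∈ M, 0 < N * c k + ρ k := by
    refine (Filter.eventually_gt_atTop 0).and (Filter.eventually_all.2 fun k => ?_)
    by_cases hk : k ∈ M
    · filter_upwards [Filter.eventually_gt_atTop (- ρ k / c k)] with N hN _
      rw [div_lt_iff₀ (hc k hk)] at hN
      linarith
    · simp [hk]
  obtain ⟨N, hN, hNk⟩ := hev.exists
  refine ⟨N • c + ρ, fun i hi => ?_, fun i hi => ?_, fun i => ?_⟩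
  · by_cases hiM : i ∈ M
    · exact hNk i hiM
    · simpa [hc0 i hiM] using hρ1 i hi hiM
  · have : i ∉ M := fun h => hi (B.subset_facialClosure M h)
    simp [hc0 i this, hρ0 i hi]
  · rw [← coroot_apply, map_add, map_smul, coroot_apply, ← B.α_comb i ρ, hρ, map_zero, add_zero]
    exact mul_nonpos_of_nonneg_of_nonpos hN.le (hcA i)

theorem mem_perp_facialClosure {M : Set I} {i : I} (hi : i ∈ perp B.A M)
    (hi' : i ∉ B.facialClosure M) : i ∈ perp B.A (B.facialClosure M) := by
  obtain ⟨ρ, hρ, hρ1, hρ0⟩ := B.exists_relation M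
  have h := B.α_comb i ρ
  rw [hρ, map_zero, coroot_apply] at h
  have hterm : ∀ k ∈ Finset.univ, ρ k * B.A k i ≤ 0 := by
    intro k _
    by_cases hkM : k ∈ M
    · rw [(eq_zero_comm B.isGCM).1 (hi k hkM), mul_zero]
    by_cases hk : k ∈ B.facialClosure M
    · exact mul_nonpos_of_nonneg_of_nonpos (hρ1 k hk hkM).le
        (offdiag_nonpos B.isGCM fun h => hi' (h ▸ hk))
    · rw [hρ0 k hk, zero_mul]
  intro k hk
  by_cases hkM : k ∈ M
  · exact hi k hkM
  have h1 := (Finset.sum_eq_zero_iff_of_nonpos hterm).1 h.symm k (Finset.mem_univ k)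
  exact (eq_zero_comm B.isGCM).1 ((mul_eq_zero.1 h1).resolve_left (hρ1 k hk hkM).ne')

/-- On a dominant point vanishing on M the relation ρ is a sum of nonnegative terms, so the point
vanishes on the closure. Elements of W_{M^⊥} preserve this, since each i ∈ M^⊥ is in the closure or
orthogonal to it. -/
theorem R_facialClosure {M : Set I} (hM : HasAntidominant B.A M) :
    B.R (B.facialClosure M) = B.R M := by
  ext l
  rw [mem_R_iff B (B.hasAntidominant_facialClosure hM)]
  constructor
  · rintro ⟨h1, h2⟩
    exact (B.mem_R_iff hM).2 ⟨h1, fun i hi => h2 i (B.subset_facialClosure M hi)⟩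
  · intro h
    refine ⟨((B.mem_R_iff hM).1 h).1, ?_⟩
    obtain ⟨a, ha, μ, hμ, rfl⟩ := B.mem_R.1 h
    have hμ0 : ∀ k ∈ B.facialClosure M, μ (B.h k) = 0 := by
      intro k hk
      by_cases hkM : k ∈ M
      · exact hμ.1 k hkM
      obtain ⟨ρ, hρ, hρ1, hρ0⟩ := B.exists_relation M
      have h0 : ∑ k, ρ k * μ (B.h k) = 0 := by
        rw [← apply_comb, hρ, map_zero]
      rw [Finset.sum_eq_zero_iff_of_nonneg] at h0
      · exact (mul_eq_zero.1 (h0 k (Finset.mem_univ k))).resolve_left (hρ1 k hk hkM).ne'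
      · intro j _
        by_cases hjM : j ∈ M
        · rw [hμ.1 j hjM, mul_zero]
        by_cases hj : j ∈ B.facialClosure M
        · exact mul_nonneg (hρ1 j hj hjM).le (hμ.2 j hjM)
        · rw [hρ0 j hj, zero_mul]
    refine para_induction B.isGCM (P := fun a => ∀ μ : Dual ℝ 𝔥,
      (∀ k ∈ B.facialClosure M, μ (B.h k) = 0) →
      ∀ k ∈ B.facialClosure M, B.act a μ (B.h k) = 0) (by simp) ?_ ha μ hμ0
    intro x _ i hi ih μ hμ k hk
    rw [act_mul_apply]
    refine ih _ (fun k hk => ?_) k hk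
    rw [act_simple, simpleRefl_apply, LinearMap.sub_apply, LinearMap.smul_apply, hμ k hk, B.α_h]
    by_cases hif : i ∈ B.facialClosure M
    · simp [hμ i hif]
    · have := (eq_zero_comm B.isGCM).1 (B.mem_perp_facialClosure hi hif k hk)
      simp [this]

/-- Gordan's theorem modulo the span of the h_j, j ∈ J; faciality says that the remaining h_k stay
positively independent in that quotient. -/
theorem exists_mem_chamber_of_isFacial [FiniteDimensional ℝ 𝔥] {J : Set I} (hJ : B.IsFacial J) :
    ∃ l ∈ B.chamber, ∀ i, l (B.h i) = 0 ↔ i ∈ J := by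
  let U : Submodule ℝ (I → ℝ) :=
    { carrier := {v | ∀ k, k ∉ J → v k = 0}
      add_mem' := fun {a b} ha hb k hk => by simp [ha k hk, hb k hk]
      zero_mem' := fun k _ => rfl
      smul_mem' := fun c {x} hx k hk => by simp [hx k hk] }
  obtain ⟨f, hf0, hf⟩ := exists_dual_pos_of_submodule (U.map B.comb)
    (fun k : (Jᶜ : Set I) => B.h k) (by
      rintro r hr ⟨s, hs, he⟩
      let r' : I → ℝ := fun k => if hk : k ∉ J then r ⟨k, hk⟩ else 0
      have hr' : 0 ≤ r' := fun k => by
        by_cases hk : k ∈ J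
        · simp [r', hk]
        · simpa [r', hk] using hr ⟨k, hk⟩
      have hcr : B.comb r' = ∑ k : (Jᶜ : Set I), r k • B.h k := by
        rw [comb_apply, ← sum_set_coe_eq_sum (K := Jᶜ) _ fun k hk => ?_]
        · refine Finset.sum_congr rfl fun k _ => ?_
          have : k.1 ∉ J := k.2
          simp [r', this]
        · simp [r', not_not.1 hk]
      ext ⟨k, hk⟩
      by_contra hne
      refine hk (B.isFacial_iff.1 hJ (r' + s⁻) s⁺ (add_nonneg hr' (negPart_nonneg s))
        (posPart_nonneg s) (fun i hi => ?_) ?_ k ?_)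
      · have : s i = 0 := hs i hi
        simp [Pi.posPart_apply, this]
      · rw [map_add, hcr, ← he, ← map_add]
        congr 1
        rw [← sub_eq_iff_eq_add.1 (posPart_sub_negPart s)]
      · have h1 : 0 < r ⟨k, hk⟩ := lt_of_le_of_ne (hr _) (Ne.symm hne)
        have h2 := negPart_nonneg s k
        simp only [Pi.zero_apply] at h2
        have h3 : r' k = r ⟨k, hk⟩ := dif_pos hk
        rw [Pi.add_apply, h3]
        linarith)
  have hmem : ∀ i ∈ J, f (B.h i) = 0 := fun i hi => hf0 _ ⟨e i, fun k hk => by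
    have : k ≠ i := fun h => hk (h ▸ hi)
    simp [this], B.comb_e i⟩
  refine ⟨f, fun i => ?_, fun i => ⟨fun h => ?_, hmem i⟩⟩
  · by_cases hi : i ∈ J
    · exact (hmem i hi).ge
    · exact (hf ⟨i, hi⟩).le
  · by_contra hi
    exact (hf ⟨i, hi⟩).ne' h

end RootBase

/-! ### In finite type the Tits cone is the whole space -/

open GCM in
/-- The root base given by the standard basis of `ℝ^I`. -/
def GCM.freeBase {I : Type*} [Fintype I] {A : Matrix I I ℝ} (hA : IsGCM A) :
    RootBase I (I → ℝ) where
  A := A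
  h := e
  α := coroot A
  isGCM := hA
  α_h i j := coroot_e i j
  posIndep r _ h := by
    rw [← eq_sum_smul_e r] at h
    exact h

namespace RootBase

open GCM Module

variable {I : Type*} [Fintype I] {𝔥 : Type*} [AddCommGroup 𝔥] [Module ℝ 𝔥]
  (B : RootBase I 𝔥)

/-- If the Tits cone is not the whole space, some nonzero vector of `ℝ^I` is nonnegative on it. -/
theorem exists_nonneg_on_titsCone (B : RootBase I (I → ℝ)) (hB : ∀ i, B.h i = e i)
    {l : Dual ℝ (I → ℝ)} (hl : l ∉ B.titsCone) :
    ∃ x : I → ℝ, x ≠ 0 ∧ ∀ μ ∈ B.titsCone, 0 ≤ μ x := by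
  let D := (Pi.basisFun ℝ I).constr ℝ (M' := ℝ)
  have hD : ∀ b v, D b v = ∑ k, v k * b k := fun b v => by
    simp [D, Basis.constr_apply_fintype]
  have hDe : ∀ b k, D b (e k) = b k := fun b k => by simp [hD, Pi.single_apply]
  let X : Set (I → ℝ) := {b | D b ∈ B.titsCone}
  have hX : Convex ℝ X := B.convex_titsCone.linear_preimage D.toLinearMap
  have hpos : {b : I → ℝ | ∀ i, 0 < b i} ⊆ X := fun b hb =>
    B.chamber_subset_titsCone fun i => by
      rw [hB, hDe]
      exact (hb i).le
  have hopen : IsOpen {b : I → ℝ | ∀ i, 0 < b i} := by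
    simp only [Set.ofPred_forall]
    exact isOpen_iInter_of_finite fun i => isOpen_lt continuous_const (continuous_apply i)
  have hint : (interior X).Nonempty :=
    ⟨fun _ => 1, interior_maximal hpos hopen (by simp)⟩
  obtain ⟨b0, hb0⟩ := D.surjective l
  have hb0X : b0 ∉ interior X := fun h => hl (by
    have := interior_subset h
    rw [← hb0]
    exact this)
  obtain ⟨f, hf0, hf⟩ := geometric_hahn_banach_of_nonempty_interior_point hX hb0X hint
  have hfX : ∀ b ∈ X, f b ≤ 0 := by
    intro b hb
    by_contra hcon
    push Not at hcon
    -- On this multiple f takes the value |f b0| + f b, larger than the bound f b0.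
    have hmem : (|f b0| / f b + 1) • b ∈ X := by
      change D _ ∈ B.titsCone
      rw [map_smul]
      exact B.smul_mem_titsCone (by positivity) hb
    have h1 := hf _ hmem
    rw [map_smul, smul_eq_mul, add_mul, div_mul_cancel₀ _ hcon.ne'] at h1
    linarith [le_abs_self (f b0)]
  have hfe : ∀ b, f b = ∑ k, b k * f (e k) := fun b => by
    conv_lhs => rw [eq_sum_smul_e b]
    simp
  refine ⟨fun k => - f (e k), fun h => hf0 ?_, fun μ hμ => ?_⟩
  · ext b
    rw [hfe]
    refine Finset.sum_eq_zero fun k _ => ?_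
    have := congrFun h k
    simp only [Pi.zero_apply, neg_eq_zero] at this
    rw [this, mul_zero]
  · obtain ⟨b, rfl⟩ := D.surjective μ
    have := hfX b hμ
    rw [hfe] at this
    rw [hD]
    simp only [neg_mul, Finset.sum_neg_distrib, mul_comm (f _)]
    linarith

end RootBase

namespace GCM

open Module

variable {I : Type*} [Fintype I] {A : Matrix I I ℝ}

theorem det_ne_zero_of_dominant [DecidableEq I] (M : Matrix I I ℝ) (hM : ∀ i j, i ≠ j → M i j ≤ 0) {u : I → ℝ}
    (hu : ∀ i, 0 < u i) (hMu : ∀ i, 0 < ∑ j, M i j * u j) : M.det ≠ 0 := by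
  intro hdet
  obtain ⟨w, hw0, hw⟩ := Matrix.exists_mulVec_eq_zero_iff.2 hdet
  have hw' : ∀ i, ∑ j, M i j * w j = 0 := fun i => by
    simpa [Matrix.mulVec, dotProduct] using congrFun hw i
  apply hw0
  ext i
  apply le_antisymm
  · simpa using nonneg_of_forall_sum_nonneg M hM u hu hMu (-w) (fun i => by simp [hw' i]) i
  · exact nonneg_of_forall_sum_nonneg M hM u hu hMu w (fun i => (hw' i).ge) i

theorem exists_coroot_eq_add (hA : IsGCM A) {u : I → ℝ} (hu : ∀ i, 0 < u i) {δ : ℝ}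
    (hAu : ∀ i, δ * u i < ∑ k, A i k * u k) (x : I → ℝ) :
    ∃ v : I → ℝ, ∀ i, coroot A i v = δ * v i + x i := by
  let M : Matrix I I ℝ := A - δ • (1 : Matrix I I ℝ)
  have hMs : ∀ (w : I → ℝ) i, ∑ j, M i j * w j = ∑ j, A i j * w j - δ * w i := by
    intro w i
    simp [M, sub_mul, Finset.sum_sub_distrib, Matrix.one_apply]
  have hoff : ∀ i j, i ≠ j → M i j ≤ 0 := fun i j h => by
    simpa [M, Matrix.one_apply, h] using offdiag_nonpos hA h
  have hdet : M.det ≠ 0 := det_ne_zero_of_dominant M hoff hu fun i => by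
    rw [hMs]
    linarith [hAu i]
  have hdetT : IsUnit (M.transpose).det := by
    rw [Matrix.det_transpose]
    exact isUnit_iff_ne_zero.2 hdet
  refine ⟨(M.transpose)⁻¹.mulVec x, fun i => ?_⟩
  have h1 : M.transpose.mulVec ((M.transpose)⁻¹.mulVec x) = x := by
    rw [Matrix.mulVec_mulVec, Matrix.mul_nonsing_inv _ hdetT, Matrix.one_mulVec]
  set v := (M.transpose)⁻¹.mulVec x
  have h2 := congrFun h1 i
  simp only [Matrix.mulVec, dotProduct, Matrix.transpose_apply] at h2
  simp only [M, Matrix.sub_apply, Matrix.smul_apply, smul_eq_mul, sub_mul,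
    Finset.sum_sub_distrib, Matrix.one_apply] at h2
  simp only [mul_ite, mul_one, mul_zero, ite_mul, zero_mul, Finset.sum_ite_eq',
    Finset.mem_univ, if_true] at h2
  rw [coroot_apply, ← h2, Finset.sum_congr rfl fun k _ => mul_comm (v k) (A k i)]
  ring

/-- The sum of the simple reflections and twice the identity. -/
def reflSum (hA : IsGCM A) : (I → ℝ) →ₗ[ℝ] (I → ℝ) :=
  (2 : ℝ) • LinearMap.id + ∑ i, (rep hA ((cs hA).simple i)).toLinearMap

theorem reflSum_apply (hA : IsGCM A) (v : I → ℝ) :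
    reflSum hA v = (2 : ℝ) • v + ∑ i, rep hA ((cs hA).simple i) v := by
  simp [reflSum]

theorem reflSum_apply_apply (hA : IsGCM A) (v : I → ℝ) (i : I) :
    reflSum hA v i = (Fintype.card I + 2) * v i - coroot A i v := by
  rw [reflSum_apply]
  simp only [Pi.add_apply, Pi.smul_apply, smul_eq_mul, Finset.sum_apply, rep_simple,
    Pi.sub_apply, Finset.sum_sub_distrib, Finset.sum_const, Finset.card_univ, nsmul_eq_mul]
  simp [Pi.single_apply]
  ring

theorem sum_mul_coroot (u v : I → ℝ) :
    ∑ i, u i * coroot A i v = ∑ k, v k * ∑ i, A k i * u i := by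
  simp only [coroot_apply, Finset.mul_sum]
  rw [Finset.sum_comm]
  exact Finset.sum_congr rfl fun i _ => Finset.sum_congr rfl fun k _ => by ring

/-- The operator is (|I| + 2) - Aᵀ, whose matrix has nonnegative entries; the hypothesis on u bounds
its norm in the ℓ¹ norm weighted by u. -/
theorem sum_abs_reflSum_le (hA : IsGCM A) {u : I → ℝ} (hu : ∀ i, 0 < u i) {δ : ℝ}
    (hAu : ∀ i, δ * u i ≤ ∑ k, A i k * u k) (v : I → ℝ) :
    ∑ i, u i * |reflSum hA v i| ≤ (Fintype.card I + 2 - δ) * ∑ i, u i * |v i| := by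
  have h1 : ∀ i, |reflSum hA v i| ≤ (Fintype.card I + 2) * |v i| - coroot A i fun k => |v k| := by
    intro i
    rw [reflSum_apply_apply, coroot_apply, coroot_apply, ← Finset.add_sum_erase _ _
      (Finset.mem_univ i), ← Finset.add_sum_erase _ (fun k => |v k| * A k i) (Finset.mem_univ i),
      hA.diag]
    have h2 : |∑ k ∈ Finset.univ.erase i, v k * A k i| ≤
        - ∑ k ∈ Finset.univ.erase i, |v k| * A k i := by
      rw [← Finset.sum_neg_distrib]
      refine (Finset.abs_sum_le_sum_abs _ _).trans (Finset.sum_le_sum fun k hk => ?_)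
      rw [abs_mul, abs_of_nonpos (offdiag_nonpos hA (Finset.ne_of_mem_erase hk)), mul_neg]
    have h3 : (Fintype.card I + 2) * v i - (v i * 2 + ∑ k ∈ Finset.univ.erase i, v k * A k i)
        = Fintype.card I * v i - ∑ k ∈ Finset.univ.erase i, v k * A k i := by ring
    rw [h3]
    refine (abs_sub _ _).trans ?_
    rw [abs_mul, Nat.abs_cast]
    linarith
  have h2 : ∑ i, u i * |reflSum hA v i| ≤
      ∑ i, u i * ((Fintype.card I + 2) * |v i| - coroot A i fun k => |v k|) :=
    Finset.sum_le_sum fun i _ => mul_le_mul_of_nonneg_left (h1 i) (hu i).le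
  have h3 : ∑ i, u i * ((Fintype.card I + 2) * |v i| - coroot A i fun k => |v k|) =
      (Fintype.card I + 2) * ∑ i, u i * |v i| - ∑ k, |v k| * ∑ i, A k i * u i := by
    rw [← sum_mul_coroot, Finset.mul_sum, ← Finset.sum_sub_distrib]
    exact Finset.sum_congr rfl fun i _ => by ring
  have h4 : δ * ∑ i, u i * |v i| ≤ ∑ k, |v k| * ∑ i, A k i * u i := by
    rw [Finset.mul_sum]
    refine Finset.sum_le_sum fun k _ => ?_
    have := mul_le_mul_of_nonneg_left (hAu k) (abs_nonneg (v k))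
    linarith
  linarith

open RootBase in
/-- For `A u > 0` with `u > 0` the Tits cone is the whole space. -/
theorem mem_titsCone_of_dominant (B : RootBase I (I → ℝ)) (hB : ∀ i, B.h i = e i) {u : I → ℝ} (hu : ∀ i, 0 < u i)
    (hAu : ∀ i, 0 < ∑ k, B.A i k * u k) (l : Dual ℝ (I → ℝ)) : l ∈ B.titsCone := by
  by_contra hl
  obtain ⟨x, hx0, hx⟩ := exists_nonneg_on_titsCone B hB hl
  set X := B.titsCone with hXdef
  have hcomb : ∀ v, B.comb v = v := fun v => by
    rw [comb_apply]
    simp only [hB]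
    exact (eq_sum_smul_e v).symm
  -- the dual cone of the Tits cone
  have hdual_rep : ∀ y : I → ℝ, (∀ μ ∈ X, 0 ≤ μ y) → ∀ g, ∀ μ ∈ X, 0 ≤ μ (rep B.isGCM g y) := by
    intro y hy g μ hμ
    have h1 := hy _ (B.act_mem_titsCone g⁻¹ hμ)
    have h2 := B.act_apply_comb g⁻¹ μ y
    rw [hcomb, hcomb, inv_inv] at h2
    rw [h2] at h1
    exact h1
  have hdual_nonneg : ∀ y : I → ℝ, (∀ μ ∈ X, 0 ≤ μ y) → 0 ≤ y := by
    intro y hy k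
    refine hy (LinearMap.proj k) (B.chamber_subset_titsCone fun i => ?_)
    rw [hB]
    exact e_nonneg i k
  -- constants
  obtain ⟨δ, hδ0, hδ1, hδ⟩ : ∃ δ : ℝ, 0 < δ ∧ δ ≤ 1 ∧ ∀ i, δ * u i ≤ ∑ k, B.A i k * u k := by
    have hev : ∀ᶠ δ : ℝ in nhdsWithin 0 (Set.Ioi 0), 0 < δ ∧ δ ≤ 1 ∧
        ∀ i, δ * u i ≤ ∑ k, B.A i k * u k := by
      refine (eventually_mem_nhdsWithin).and
        ((Filter.Eventually.filter_mono nhdsWithin_le_nhds (eventually_le_nhds zero_lt_one)).and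
        (Filter.eventually_all.2 fun i => Filter.Eventually.filter_mono nhdsWithin_le_nhds ?_))
      filter_upwards [eventually_le_nhds (div_pos (hAu i) (hu i))] with δ hδ
      exact (le_div_iff₀ (hu i)).1 hδ
    exact hev.exists
  -- Here v solves (n - δ/2 - T)v = x with T = `reflSum` and n = |I| + 2. Formally it is a geometric
  -- series in T applied to x, so it should lie in the dual cone of X. Using δ/2 leaves a gap to the
  -- norm bound n - δ of T, which makes the error terms below decay.
  obtain ⟨v, hv⟩ := exists_coroot_eq_add B.isGCM hu (δ := δ / 2) (fun i => by
    nlinarith [hδ i, hu i]) x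
  set n : ℝ := Fintype.card I + 2 with hn
  have hn2 : 2 ≤ n := by
    have : (0 : ℝ) ≤ Fintype.card I := Nat.cast_nonneg _
    linarith
  have hTv : ∀ y, (∀ μ ∈ X, 0 ≤ μ y) → ∀ μ ∈ X, 0 ≤ μ (reflSum B.isGCM y) := by
    intro y hy μ hμ
    rw [reflSum_apply, map_add, map_smul, map_sum]
    exact add_nonneg (smul_nonneg zero_le_two (hy μ hμ))
      (Finset.sum_nonneg fun i _ => hdual_rep y hy _ μ hμ)
  have hTvx : reflSum B.isGCM v = (n - δ / 2) • v - x := by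
    ext i
    rw [reflSum_apply_apply, hv]
    simp
    ring
  have hvdual : ∀ μ ∈ X, 0 ≤ μ v := by
    intro μ hμ
    have hTx : ∀ m : ℕ, ∀ μ ∈ X, 0 ≤ μ (((reflSum B.isGCM) ^ m) x) := by
      intro m
      induction m with
      | zero => simpa using hx
      | succ m ih =>
        intro μ hμ
        rw [pow_succ', Module.End.mul_apply]
        exact hTv _ ih μ hμ
    have hstep : ∀ m : ℕ, μ (((reflSum B.isGCM) ^ m) v) ≤ (n - δ / 2) ^ m * μ v := by
      intro m
      induction m with
      | zero => simp
      | succ m ih =>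
        rw [pow_succ, Module.End.mul_apply, hTvx, map_sub, map_sub, map_smul, map_smul, smul_eq_mul,
          pow_succ]
        have h1 := hTx m μ hμ
        have h2 : 0 < n - δ / 2 := by linarith
        nlinarith [mul_le_mul_of_nonneg_left ih h2.le]
    have hF : ∀ m : ℕ, ∑ i, u i * |((reflSum B.isGCM) ^ m) v i| ≤ (n - δ) ^ m * ∑ i, u i * |v i| := by
      intro m
      induction m with
      | zero => simp
      | succ m ih =>
        rw [pow_succ', Module.End.mul_apply]
        refine (sum_abs_reflSum_le B.isGCM hu hδ _).trans ?_
        rw [pow_succ', mul_assoc]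
        exact mul_le_mul_of_nonneg_left ih (by linarith)
    set C := ∑ k, |μ (e k)| / u k with hC
    have hC0 : 0 ≤ C := Finset.sum_nonneg fun k _ => div_nonneg (abs_nonneg _) (hu k).le
    have hbd : ∀ y : I → ℝ, |μ y| ≤ C * ∑ i, u i * |y i| := by
      intro y
      conv_lhs => rw [eq_sum_smul_e y]
      rw [map_sum]
      refine (Finset.abs_sum_le_sum_abs _ _).trans ?_
      rw [hC, Finset.sum_mul]
      refine Finset.sum_le_sum fun k _ => ?_
      rw [map_smul, smul_eq_mul, abs_mul]
      have h1 : u k * |y k| ≤ ∑ i, u i * |y i| :=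
        Finset.single_le_sum (f := fun i => u i * |y i|)
          (fun i _ => mul_nonneg (hu i).le (abs_nonneg _)) (Finset.mem_univ k)
      calc |y k| * |μ (e k)| = |μ (e k)| / u k * (u k * |y k|) := by
            have := (hu k).ne'
            field_simp
        _ ≤ _ := mul_le_mul_of_nonneg_left h1 (div_nonneg (abs_nonneg _) (hu k).le)
    set q := (n - δ) / (n - δ / 2) with hq
    have hd0 : 0 < n - δ / 2 := by linarith
    have hq0 : 0 ≤ q := div_nonneg (by linarith) hd0.le
    have hq1 : q < 1 := by
      rw [hq, div_lt_one hd0]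
      linarith
    have hlow : ∀ m : ℕ, - (q ^ m * (C * ∑ i, u i * |v i|)) ≤ μ v := by
      intro m
      have h1 := (abs_le.1 (hbd (((reflSum B.isGCM) ^ m) v))).1
      have h2 := mul_le_mul_of_nonneg_left (hF m) hC0
      have h3 := hstep m
      have h4 : 0 < (n - δ / 2) ^ m := pow_pos hd0 m
      have h5 : q ^ m * (n - δ / 2) ^ m = (n - δ) ^ m := by
        rw [← mul_pow, hq, div_mul_cancel₀ _ hd0.ne']
      have h6 : - (q ^ m * (C * ∑ i, u i * |v i|)) * (n - δ / 2) ^ m ≤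
          μ v * (n - δ / 2) ^ m := by
        have : - (q ^ m * (C * ∑ i, u i * |v i|)) * (n - δ / 2) ^ m
            = - (C * ((n - δ) ^ m * ∑ i, u i * |v i|)) := by
          rw [← h5]; ring
        rw [this]
        linarith
      exact le_of_mul_le_mul_right h6 h4
    have hlim := ((tendsto_pow_atTop_nhds_zero_of_lt_one hq0 hq1).mul_const
      (C * ∑ i, u i * |v i|)).neg
    rw [zero_mul, neg_zero] at hlim
    exact le_of_tendsto' hlim hlow
  have hv0 : 0 ≤ v := hdual_nonneg v hvdual
  have hxnn : 0 ≤ x := hdual_nonneg x hx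
  -- So v is dominant, strictly wherever v_i ≠ 0, and its orbit stays between 0 and v. The
  -- contradiction will be that the weight f can be lowered along the orbit by a fixed amount
  -- forever.
  have hvdom : ∀ i, 0 ≤ coroot B.A i v := fun i => by
    rw [hv]
    exact add_nonneg (mul_nonneg (by linarith) (hv0 i)) (hxnn i)
  have hvpos : ∀ i, v i ≠ 0 → 0 < coroot B.A i v := fun i hi => by
    have h1 : 0 < v i := lt_of_le_of_ne (hv0 i) hi.symm
    rw [hv]
    have := hxnn i
    simp only [Pi.zero_apply] at this
    positivity
  have horb0 : ∀ g, 0 ≤ rep B.isGCM g v := fun g => hdual_nonneg _ (hdual_rep v hvdual g)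
  have horb1 : ∀ g, rep B.isGCM g v ≤ v := fun g => by
    have := le_rep_of_antidominant B.isGCM (c := -v) (fun i => by simpa using hvdom i) _ g rfl
    rwa [map_neg, neg_le_neg_iff] at this
  have hvne : v ≠ 0 := by
    rintro rfl
    apply hx0
    ext i
    have := hv i
    simpa using this.symm
  set f : (I → ℝ) → ℝ := fun y => ∑ i, u i * y i with hf
  have hfmono : ∀ y z : I → ℝ, y ≤ z → f y ≤ f z := fun y z h =>
    Finset.sum_le_sum fun i _ => mul_le_mul_of_nonneg_left (h i) (hu i).le
  have hf0 : ∀ y : I → ℝ, 0 ≤ y → 0 ≤ f y := fun y hy =>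
    Finset.sum_nonneg fun i _ => mul_nonneg (hu i).le (hy i)
  have hfsub : ∀ y z : I → ℝ, f (y - z) = f y - f z := fun y z => by
    simp [hf, mul_sub, Finset.sum_sub_distrib]
  have hfsmul : ∀ (t : ℝ) (y : I → ℝ), f (t • y) = t * f y := fun t y => by
    simp only [hf, Pi.smul_apply, smul_eq_mul, Finset.mul_sum]
    exact Finset.sum_congr rfl fun i _ => by ring
  obtain ⟨i0, hi0⟩ := Function.ne_iff.1 hvne
  have hfv : 0 < f v := Finset.sum_pos' (fun i _ => mul_nonneg (hu i).le (hv0 i))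
    ⟨i0, Finset.mem_univ _, mul_pos (hu i0) (lt_of_le_of_ne (hv0 i0) (Ne.symm hi0))⟩
  -- a lower bound for the orbit
  set D := ∑ i, if v i = 0 then 0 else (coroot B.A i v * u i)⁻¹ with hD
  have hDterm : ∀ i, 0 ≤ if v i = 0 then (0 : ℝ) else (coroot B.A i v * u i)⁻¹ := fun i => by
    split_ifs
    · exact le_rfl
    · exact inv_nonneg.2 (mul_nonneg (hvdom i) (hu i).le)
  -- Expand v = g⁻¹(gv) in the roots g⁻¹e_i. Each relevant f(g⁻¹e_i) is at most f(v)/α_i(v), because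
  -- g⁻¹s_i v ≥ 0; hence f is bounded below on the orbit.
  have horbf : ∀ g, f v ≤ D * f v * f (rep B.isGCM g v) := by
    intro g
    have h1 : f v = ∑ i, rep B.isGCM g v i * f (rep B.isGCM g⁻¹ (e i)) := by
      conv_lhs => rw [← rep_inv_apply_self B.isGCM g v, rep_apply_eq_sum B.isGCM g⁻¹]
      simp only [hf, Finset.sum_apply, Pi.smul_apply, smul_eq_mul, Finset.mul_sum]
      rw [Finset.sum_comm]
      exact Finset.sum_congr rfl fun i _ => Finset.sum_congr rfl fun k _ => by ring
    rw [h1]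
    rw [← h1, hD, Finset.sum_mul, Finset.sum_mul]
    conv_lhs => rw [h1]
    refine Finset.sum_le_sum fun i _ => ?_
    by_cases hvi : v i = 0
    · have : rep B.isGCM g v i = 0 := le_antisymm ((horb1 g i).trans hvi.le) (horb0 g i)
      simp [this, hvi]
    · have ha := hvpos i hvi
      have h2 : coroot B.A i v * f (rep B.isGCM g⁻¹ (e i)) ≤ f v := by
        have h3 : rep B.isGCM (g⁻¹ * (cs B.isGCM).simple i) v =
            rep B.isGCM g⁻¹ v - coroot B.A i v • rep B.isGCM g⁻¹ (e i) := by
          rw [rep_mul_apply, rep_simple, map_sub, map_smul]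
        have h4 := hf0 _ (horb0 (g⁻¹ * (cs B.isGCM).simple i))
        rw [h3, hfsub, hfsmul] at h4
        have h5 := hfmono _ _ (horb1 g⁻¹)
        linarith
      have h6 : f (rep B.isGCM g⁻¹ (e i)) ≤ (coroot B.A i v)⁻¹ * f v := by
        rw [le_inv_mul_iff₀ ha]
        exact h2
      have h7 : u i * rep B.isGCM g v i ≤ f (rep B.isGCM g v) :=
        Finset.single_le_sum (f := fun i => u i * rep B.isGCM g v i)
          (fun i _ => mul_nonneg (hu i).le (horb0 g i)) (Finset.mem_univ i)
      rw [if_neg hvi]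
      calc rep B.isGCM g v i * f (rep B.isGCM g⁻¹ (e i))
          ≤ rep B.isGCM g v i * ((coroot B.A i v)⁻¹ * f v) :=
            mul_le_mul_of_nonneg_left h6 (horb0 g i)
        _ = (coroot B.A i v * u i)⁻¹ * f v * (u i * rep B.isGCM g v i) := by
            have := (hu i).ne'
            field_simp
        _ ≤ _ := mul_le_mul_of_nonneg_left h7 (mul_nonneg
            (inv_nonneg.2 (mul_nonneg ha.le (hu i).le)) hfv.le)
  have hDpos : 0 < D := by
    have h1 := horbf 1
    simp only [map_one, LinearEquiv.coe_one, id] at h1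
    have hD0 : 0 ≤ D := Finset.sum_nonneg fun i _ => hDterm i
    refine lt_of_le_of_ne hD0 fun h => ?_
    rw [← h] at h1
    linarith
  have hcard : (0 : ℝ) < Fintype.card I := by
    have : 0 < Fintype.card I := Fintype.card_pos_iff.2 ⟨i0⟩
    exact_mod_cast this
  set ε := δ * D⁻¹ / Fintype.card I with hε
  have hεpos : 0 < ε := by positivity
  -- For y in the orbit the drops u_i α_i(y) of f under the simple reflections add up to at least δ
  -- f(y) ≥ δ/D, so one of them is at least ε.
  have hdesc : ∀ g, ∃ g', f (rep B.isGCM g' v) ≤ f (rep B.isGCM g v) - ε := by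
    intro g
    set y := rep B.isGCM g v with hy
    have h1 : D⁻¹ ≤ f y := by
      have := horbf g
      rw [inv_le_iff_one_le_mul₀ hDpos]
      have h2 : f v * 1 ≤ f v * (f y * D) := by linarith
      exact le_of_mul_le_mul_left h2 hfv
    have h2 : δ * f y ≤ ∑ i, u i * coroot B.A i y := by
      rw [sum_mul_coroot, hf, Finset.mul_sum]
      refine Finset.sum_le_sum fun k _ => ?_
      have := mul_le_mul_of_nonneg_left (hδ k) (horb0 g k)
      linarith
    obtain ⟨i, hi⟩ : ∃ i, ε ≤ u i * coroot B.A i y := by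
      by_contra hcon
      push Not at hcon
      have h3 : ∑ i, u i * coroot B.A i y < ∑ _i : I, ε :=
        Finset.sum_lt_sum_of_nonempty ⟨i0, Finset.mem_univ _⟩ fun i _ => hcon i
      rw [Finset.sum_const, Finset.card_univ, nsmul_eq_mul, hε, mul_div_cancel₀ _ hcard.ne'] at h3
      have := mul_le_mul_of_nonneg_left h1 hδ0.le
      linarith
    refine ⟨(cs B.isGCM).simple i * g, ?_⟩
    rw [rep_mul_apply, ← hy, rep_simple, hfsub, hfsmul]
    have : f (e i) = u i := by simp [hf, Pi.single_apply]
    rw [this]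
    linarith
  have hiter : ∀ N : ℕ, ∃ g, f (rep B.isGCM g v) ≤ f v - N * ε := by
    intro N
    induction N with
    | zero => exact ⟨1, by simp⟩
    | succ N ih =>
      obtain ⟨g, hg⟩ := ih
      obtain ⟨g', hg'⟩ := hdesc g
      refine ⟨g', ?_⟩
      push_cast
      linarith
  obtain ⟨N, hN⟩ := exists_nat_gt (f v / ε)
  obtain ⟨g, hg⟩ := hiter N
  rw [div_lt_iff₀ hεpos] at hN
  have := hf0 _ (horb0 g)
  linarith

theorem isGCM_submatrix (hA : IsGCM A) (L : Set I) :
    IsGCM (A.submatrix (Subtype.val : L → I) Subtype.val) where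
  diag i := hA.diag i
  sign i j h := hA.sign i j fun h' => h (Subtype.ext h')
  angle i j h := hA.angle i j fun h' => h (Subtype.ext h')

end GCM

namespace RootBase

open GCM Module

variable {I : Type*} [Fintype I] {𝔥 : Type*} [AddCommGroup 𝔥] [Module ℝ 𝔥]
  (B : RootBase I 𝔥)

/-- W_L acts on the values at the h_k, k ∈ L, exactly as in the free root base of the submatrix A_L,
whose Tits cone is everything. -/
theorem exists_act_dominant {L : Set I} (hL : HasDominant B.A L) (η : Dual ℝ 𝔥) :
    ∃ g ∈ para B.isGCM L, ∀ k ∈ L, 0 ≤ B.act g η (B.h k) := by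
  obtain ⟨u, hu, hu0, hAu⟩ := hL
  have hA' := isGCM_submatrix B.isGCM L
  obtain ⟨B', hB', hA⟩ : ∃ B' : RootBase L (L → ℝ), (∀ i, B'.h i = e i) ∧
      ∀ i j, B'.A i j = B.A i j := ⟨freeBase hA', fun _ => rfl, fun _ _ => rfl⟩
  have hl := mem_titsCone_of_dominant B' hB' (u := fun i : L => u i) (fun i => hu i i.2)
    (fun i => by
      have := hAu i i.2
      rw [← sum_set_coe_eq_sum (K := L) _ (fun j hj => by rw [hu0 j hj, mul_zero])] at this
      simpa only [hA] using this) (Fintype.linearCombination ℝ fun k : L => η (B.h k))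
  obtain ⟨g, μ, hμ, he⟩ := B'.mem_titsCone.1 hl
  obtain ⟨ω, hω⟩ := (cs B'.isGCM).wordProd_surjective g⁻¹
  have key : ∀ ω : List L, ∀ k : L,
      B.act ((cs B.isGCM).wordProd (ω.map Subtype.val)) η (B.h k) =
      B'.act ((cs B'.isGCM).wordProd ω) (Fintype.linearCombination ℝ fun k : L => η (B.h k))
        (B'.h k) := by
    intro ω
    induction ω with
    | nil =>
      intro k
      rw [List.map_nil, CoxeterSystem.wordProd_nil, CoxeterSystem.wordProd_nil, map_one, map_one,
        hB']
      simp [e, Fintype.linearCombination_apply_single]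
    | cons i ω ih =>
      intro k
      rw [List.map_cons, CoxeterSystem.wordProd_cons, CoxeterSystem.wordProd_cons, act_mul_apply,
        act_mul_apply, act_simple, act_simple, simpleRefl_apply, simpleRefl_apply,
        LinearMap.sub_apply, LinearMap.sub_apply, LinearMap.smul_apply, LinearMap.smul_apply,
        ih, ih, B.α_h, B'.α_h, hA]
  refine ⟨(cs B.isGCM).wordProd (ω.map Subtype.val), wordProd_mem_para _ fun i hi => ?_, ?_⟩
  · obtain ⟨j, _, rfl⟩ := List.mem_map.1 hi
    exact j.2
  intro k hk
  have h1 := key ω ⟨k, hk⟩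
  rw [he, hω, act_inv_apply_self] at h1
  rw [h1]
  exact hμ ⟨k, hk⟩

end RootBase

/-! ### Faces of the Tits cone through a dominant point -/

namespace GCM

variable {I : Type*} [Fintype I] {A : Matrix I I ℝ}

theorem HasDominant.exists_sum_eq (hA : IsGCM A) {L : Set I} (hL : HasDominant A L) (b : I → ℝ) :
    ∃ c : I → ℝ, (∀ i, i ∉ L → c i = 0) ∧ ∀ i ∈ L, ∑ k, A i k * c k = b i := by
  obtain ⟨u, hu, hu0, hAu⟩ := hL
  obtain ⟨M, hM⟩ : ∃ M : Matrix L L ℝ, ∀ i j, M i j = A i j :=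
    ⟨A.submatrix Subtype.val Subtype.val, fun _ _ => rfl⟩
  have hdet : IsUnit M.det := isUnit_iff_ne_zero.2 <|
    det_ne_zero_of_dominant M (fun i j h => by
      rw [hM]
      exact offdiag_nonpos hA fun h' => h (Subtype.ext h'))
      (u := fun i : L => u i) (fun i => hu i i.2) fun i => by
        have := hAu i i.2
        rw [← sum_set_coe_eq_sum (K := L) _ (fun j hj => by rw [hu0 j hj, mul_zero])] at this
        simpa only [hM] using this
  obtain ⟨c, hc⟩ : ∃ c : L → ℝ, M.mulVec c = fun i : L => b i :=
    ⟨M⁻¹.mulVec fun i : L => b i, by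
      rw [Matrix.mulVec_mulVec, Matrix.mul_nonsing_inv _ hdet, Matrix.one_mulVec]⟩
  refine ⟨fun i => if h : i ∈ L then c ⟨i, h⟩ else 0, fun i hi => dif_neg hi, fun i hi => ?_⟩
  rw [← sum_set_coe_eq_sum (K := L) _ (fun j hj => by simp only [dif_neg hj, mul_zero])]
  refine (Finset.sum_congr rfl fun k _ => ?_).trans (congrFun hc (⟨i, hi⟩ : L))
  simp only [dif_pos k.2, hM]

end GCM

namespace RootBase

open GCM Module Filter Topology

variable {I : Type*} [Fintype I] {𝔥 : Type*} [AddCommGroup 𝔥] [Module ℝ 𝔥]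
  (B : RootBase I 𝔥)

theorem smul_mem_of_mem_faceSet {F : Set (Dual ℝ 𝔥)} (hF : F ∈ faceSet B.titsCone)
    {z : Dual ℝ 𝔥} (hz : z ∈ F) {t : ℝ} (ht : 0 < t) : t • z ∈ F := by
  have hzX := hF.1.subset hz
  refine hF.1.2 (B.smul_mem_titsCone ht.le hzX)
    (B.smul_mem_titsCone (inv_nonneg.2 ht.le) hzX) hz ?_
  refine ⟨1 / (1 + t), t / (1 + t), by positivity, by positivity, by field_simp, ?_⟩
  rw [smul_smul, smul_smul, ← add_smul]
  have : 1 / (1 + t) * t + t / (1 + t) * t⁻¹ = 1 := by field_simp; ring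
  rw [this, one_smul]

theorem mem_of_sub_smul_mem {F : Set (Dual ℝ 𝔥)} (hF : F ∈ faceSet B.titsCone)
    {μ z : Dual ℝ 𝔥} (hμ : μ ∈ F) (hz : z ∈ B.titsCone) {ε : ℝ} (hε : 0 < ε)
    (h : μ - ε • z ∈ B.titsCone) : z ∈ F := by
  have h1 : (2 * ε) • z ∈ F := by
    refine hF.1.2 (B.smul_mem_titsCone (by positivity) hz)
      (B.smul_mem_titsCone zero_le_two h) hμ
      ⟨1 / 2, 1 / 2, by norm_num, by norm_num, by norm_num, ?_⟩
    module
  have h2 := B.smul_mem_of_mem_faceSet hF h1 (t := (2 * ε)⁻¹) (by positivity)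
  rwa [inv_smul_smul₀ (by positivity)] at h2

theorem eventually_sub_smul_mem_chamber {μ l : Dual ℝ 𝔥} (hμ : μ ∈ B.chamber)
    (hl : ∀ i, μ (B.h i) = 0 → l (B.h i) ≤ 0) :
    ∀ᶠ ε : ℝ in 𝓝[>] 0, μ - ε • l ∈ B.chamber := by
  refine eventually_all.2 fun i => ?_
  by_cases hi : μ (B.h i) = 0
  · filter_upwards [self_mem_nhdsWithin] with ε hε
    have := mul_nonpos_of_nonneg_of_nonpos (le_of_lt hε) (hl i hi)
    simpa [hi] using this
  · have hpos : 0 < μ (B.h i) := lt_of_le_of_ne (hμ i) (Ne.symm hi)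
    have ht : Tendsto (fun ε : ℝ => (μ - ε • l) (B.h i)) (𝓝 0) (𝓝 (μ (B.h i))) := by
      have : Continuous fun ε : ℝ => (μ - ε • l) (B.h i) := by
        simp only [LinearMap.sub_apply, LinearMap.smul_apply, smul_eq_mul]
        fun_prop
      simpa using this.tendsto 0
    exact (ht.eventually (eventually_ge_nhds hpos)).filter_mono nhdsWithin_le_nhds

/-- It suffices to subtract a small multiple of z from μ without leaving X. With L = J \ J^∞, which
has a dominant vector, split z = (z - η) + η, where η is a combination of the α_j, j ∈ L, agreeing
with z on J. Subtracting ε(z - η) keeps μ in the chamber, as z - η vanishes on J. Subtracting εη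
does so after applying a w ∈ W_L that makes -η dominant on L; w fixes μ. -/
theorem closedFacet_infPart_subset {F : Set (Dual ℝ 𝔥)} (hF : F ∈ faceSet B.titsCone)
    {μ : Dual ℝ 𝔥} (hμF : μ ∈ F) (hμ : μ ∈ B.chamber) :
    B.closedFacet (infPart B.A {i | μ (B.h i) = 0}) ⊆ F := by
  intro z hz
  set J : Set I := {i | μ (B.h i) = 0} with hJ
  set T := infPart B.A J with hT
  have hL := hasDominant_diff_infPart B.isGCM J
  rw [← hT] at hL
  obtain ⟨c, hc0, hc⟩ := hL.exists_sum_eq B.isGCM fun i => z (B.h i)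
  let η : Dual ℝ 𝔥 := ∑ j, c j • B.α j
  have hη : ∀ i, η (B.h i) = ∑ j, B.A i j * c j := fun i => by
    simp only [η, LinearMap.sum_apply, LinearMap.smul_apply, B.α_h, smul_eq_mul]
    exact Finset.sum_congr rfl fun j _ => mul_comm _ _
  have hTL : J \ T ⊆ perp B.A T := fun k hk j hj =>
    (eq_zero_comm B.isGCM).1 (eq_zero_of_mem_infPart hj hk.1 hk.2)
  have hηT : ∀ i ∈ T, η (B.h i) = 0 := fun i hi => by
    rw [hη]
    refine Finset.sum_eq_zero fun j _ => ?_
    by_cases hj : j ∈ J \ T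
    · rw [eq_zero_of_mem_infPart hi hj.1 hj.2, zero_mul]
    · rw [hc0 j hj, mul_zero]
  have hηL : ∀ i ∈ J \ T, η (B.h i) = z (B.h i) := fun i hi => by rw [hη, hc i hi]
  have h1 : ∀ᶠ ε : ℝ in 𝓝[>] 0, μ - ε • (z - η) ∈ B.chamber :=
    B.eventually_sub_smul_mem_chamber hμ fun i hi => by
      by_cases hiT : i ∈ T
      · rw [LinearMap.sub_apply, hηT i hiT, hz.1 i hiT, sub_zero]
      · rw [LinearMap.sub_apply, hηL i ⟨hi, hiT⟩, sub_self]
  obtain ⟨w, hw, hwη⟩ := B.exists_act_dominant hL (-η)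
  have h2 : ∀ᶠ ε : ℝ in 𝓝[>] 0, μ - ε • B.act w η ∈ B.chamber :=
    B.eventually_sub_smul_mem_chamber hμ fun i hi => by
      by_cases hiT : i ∈ T
      · rw [act_apply_h, rep_e_of_mem_para_perp B.isGCM
          (Subgroup.inv_mem _ (para_mono _ hTL hw)) hiT, comb_e, hηT i hiT]
      · have := hwη i ⟨hi, hiT⟩
        rw [map_neg, LinearMap.neg_apply] at this
        linarith
  obtain ⟨ε, ⟨h1, h2⟩, hε⟩ := ((h1.and h2).and self_mem_nhdsWithin).exists
  have hε : 0 < ε := hε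
  have h3 : μ - ε • η ∈ B.titsCone := by
    rw [← B.act_mem_titsCone_iff w, map_sub, map_smul,
      B.act_eq_self (l := μ) hw fun i hi => hi.1]
    exact B.chamber_subset_titsCone h2
  -- The factor ε/2 arises from averaging μ - ε(z - η) and μ - εη.
  refine B.mem_of_sub_smul_mem hF hμF
    (B.chamber_subset_titsCone (B.closedFacet_subset_chamber hz)) (ε := ε / 2) (by positivity) ?_
  have h4 := B.smul_mem_titsCone (t := 1 / 2) (by norm_num)
    (B.add_mem_titsCone (B.chamber_subset_titsCone h1) h3)
  convert h4 using 1
  module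

/-- For i ∈ T^⊥ the midpoint of z and s_i z lies again in the closed facet, so the face property
brings in s_i z; iterate along a word. -/
theorem R_subset_of_closedFacet_subset {F : Set (Dual ℝ 𝔥)} (hF : F ∈ faceSet B.titsCone)
    {T : Set I} (hT : B.closedFacet T ⊆ F) : B.R T ⊆ F := by
  intro l hl
  obtain ⟨a, ha, z, hz, rfl⟩ := B.mem_R.1 hl
  clear hl
  revert z
  refine para_induction B.isGCM (P := fun a => ∀ z ∈ B.closedFacet T, B.act a z ∈ F) ?_ ?_ ha
  · intro z hz
    simpa using hT hz
  · intro a ha i hi ih z hz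
    have hz' := B.closedFacet_subset_chamber hz
    set t := z (B.h i) / 2 with ht
    have ht0 : 0 ≤ t := div_nonneg (hz' i) zero_le_two
    have hz1 : z - t • B.α i ∈ B.closedFacet T := by
      refine B.mem_closedFacet.2 ⟨fun k => ?_, fun k hk => ?_⟩
      · rw [LinearMap.sub_apply, LinearMap.smul_apply, B.α_h, smul_eq_mul]
        by_cases hki : k = i
        · subst hki
          rw [B.isGCM.diag, ht]
          linarith
        · have := mul_nonpos_of_nonneg_of_nonpos ht0 (offdiag_nonpos B.isGCM hki)
          linarith [hz' k]
      · rw [LinearMap.sub_apply, LinearMap.smul_apply, B.α_h,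
          (eq_zero_comm B.isGCM).1 (hi k hk), hz.1 k hk]
        simp
    refine hF.1.2 (B.act_mem_titsCone _ (B.chamber_subset_titsCone hz')) (B.act_mem_titsCone a
      (B.chamber_subset_titsCone hz')) (ih _ hz1)
      ⟨1 / 2, 1 / 2, by norm_num, by norm_num, by norm_num, ?_⟩
    rw [act_mul_apply, act_simple, simpleRefl_apply, ← map_smul, ← map_smul, ← map_add]
    congr 1
    rw [ht]
    module

/-- A face of the Tits cone containing a point of the chamber of type `J` contains `R(J^∞)`. -/
theorem R_infPart_subset {F : Set (Dual ℝ 𝔥)} (hF : F ∈ faceSet B.titsCone)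
    {μ : Dual ℝ 𝔥} (hμF : μ ∈ F) (hμ : μ ∈ B.chamber) :
    B.R (infPart B.A {i | μ (B.h i) = 0}) ⊆ F :=
  B.R_subset_of_closedFacet_subset hF (B.closedFacet_infPart_subset hF hμF hμ)

end RootBase

/-! ### Intersection and join of two faces -/

namespace GCM

variable {I : Type*} [Fintype I] {A : Matrix I I ℝ}

theorem exists_eq_mul_of_mem_para_union (hA : IsGCM A) {S T : Set I} (hST : T ⊆ perp A S)
    {x : CoxGroup hA} (hx : x ∈ para hA (S ∪ T)) :
    ∃ b ∈ para hA T, ∃ a ∈ para hA S, x = b * a := by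
  refine para_induction hA (P := fun x => ∃ b ∈ para hA T, ∃ a ∈ para hA S, x = b * a)
    ⟨1, one_mem _, 1, one_mem _, (one_mul 1).symm⟩ ?_ hx
  rintro x - i hi ⟨b, hb, a, ha, rfl⟩
  rcases hi with hi | hi
  · exact ⟨b, hb, a * (cs hA).simple i, mul_mem ha (simple_mem_para hA hi), mul_assoc _ _ _⟩
  · refine ⟨b * (cs hA).simple i, mul_mem hb (simple_mem_para hA hi), a, ha, ?_⟩
    have hS : S ⊆ perp A T := fun s hs t ht => (eq_zero_comm hA).1 (hST ht s hs)
    have h1 : rep hA a (e i) = (1 : ℝ) • e i := by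
      rw [rep_e_of_mem_para_perp hA (para_mono hA hS ha) hi, one_smul]
    rw [mul_assoc, mul_simple_eq_simple_mul hA h1, mul_assoc]

theorem exists_isRightDescent (hA : IsGCM A) {g : CoxGroup hA} (hg : g ≠ 1) :
    ∃ i, (cs hA).IsRightDescent g i := by
  by_contra! h
  exact hg (eq_one_of_rep_nonneg hA fun i => (rep_nonneg_iff hA g i).2 (h i))

/-- Write g = ba with b ∈ W_T, a ∈ W_S. A right descent of a lies in S and, since b fixes the roots
of S, is also a descent of g; so a = 1. -/
theorem mem_para_of_nonneg_of_perp (hA : IsGCM A) {S T : Set I} (hST : T ⊆ perp A S)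
    {g : CoxGroup hA} (hg : g ∈ para hA (S ∪ T)) (hS : ∀ i ∈ S, 0 ≤ rep hA g (e i)) :
    g ∈ para hA T := by
  obtain ⟨b, hb, a, ha, rfl⟩ := exists_eq_mul_of_mem_para_union hA hST hg
  rcases eq_or_ne a 1 with rfl | ha1
  · rwa [mul_one]
  obtain ⟨i, hi⟩ := exists_isRightDescent hA ha1
  have hiS := mem_of_isRightDescent hA ha hi
  have h1 := rep_nonneg_of_support hA (J := S) (g := b) (v := - rep hA a (e i))
    (fun k hk => by
      rw [rep_e_of_mem_para_perp hA (para_mono hA hST hb) hk]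
      exact e_nonneg k)
    (neg_nonneg.2 ((rep_nonpos_iff hA a i).2 hi)) fun k hk => by
      have hki : k ≠ i := fun h => hk (h ▸ hiS)
      rw [Pi.neg_apply, rep_apply_of_notMem hA ha hk]
      simp [e, hki]
  rw [map_neg, ← rep_mul_apply, neg_nonneg, rep_nonpos_iff] at h1
  exact absurd h1 ((rep_nonneg_iff hA _ i).1 (hS i hiS))

theorem eq_of_e_eq_smul_e {i j : I} {r : ℝ} (h : e i = r • e j) : i = j := by
  by_contra hij
  have := congrFun h i
  simp [e, hij] at this

/-- The sets of indices `i ∈ J` whose root is up to a positive factor the image under `g` of a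
simple root in `K`. -/
def twist (hA : IsGCM A) (J : Set I) (g : CoxGroup hA) (K : Set I) : Set I :=
  {i | i ∈ J ∧ ∃ j ∈ K, ∃ r : ℝ, 0 < r ∧ rep hA g (e j) = r • e i}

/-- All terms v_l g(e_l) are nonnegative, so nothing cancels: each contributing g(e_l) is supported
on J and hence is a multiple of a simple root. -/
theorem rep_apply_eq_zero_of_notMem_twist (hA : IsGCM A) {J K : Set I} {g : CoxGroup hA}
    (hJ : ∀ i ∈ J, 0 ≤ rep hA g⁻¹ (e i)) (hK : ∀ i ∈ K, 0 ≤ rep hA g (e i)) {v : I → ℝ}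
    (hv : 0 ≤ v) (hvK : ∀ k, k ∉ K → v k = 0) (hgv : ∀ k, k ∉ J → rep hA g v k = 0) :
    ∀ k, k ∉ twist hA J g K → rep hA g v k = 0 := by
  intro k hk
  rw [rep_apply_eq_sum, Finset.sum_apply]
  refine Finset.sum_eq_zero fun l _ => ?_
  by_cases hl : v l = 0
  · simp [hl]
  have hlK : l ∈ K := by
    by_contra h
    exact hl (hvK l h)
  have hsupp : ∀ m, m ∉ J → rep hA g (e l) m = 0 := by
    intro m hm
    have h1 := hgv m hm
    rw [rep_apply_eq_sum, Finset.sum_apply, Finset.sum_eq_zero_iff_of_nonneg] at h1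
    · have := h1 l (Finset.mem_univ l)
      rw [Pi.smul_apply, smul_eq_mul] at this
      exact (mul_eq_zero.1 this).resolve_left hl
    · intro n _
      by_cases hn : n ∈ K
      · exact mul_nonneg (hv n) (hK n hn m)
      · simp [hvK n hn]
  obtain ⟨i, hi, r, hr, he⟩ := rep_inv_e_eq_smul hA (g := g⁻¹) hJ (i := l) (by simpa using hsupp)
  rw [inv_inv] at he
  have hki : k ≠ i := by
    rintro rfl
    exact hk ⟨hi, l, hlK, r, hr, he⟩
  rw [he]
  simp [e, hki]

end GCM

namespace RootBase

open GCM Module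

variable {I : Type*} [Fintype I] {𝔥 : Type*} [AddCommGroup 𝔥] [Module ℝ 𝔥]
  (B : RootBase I 𝔥)

/-- This substitutes for injectivity of `comb`: equalities of rays in 𝔥 lift to equalities of rays
in ℝ^I, as `interTwist_act` requires. -/
theorem eq_e_of_comb_eq_h {s : I → ℝ} (hs : 0 ≤ s) {i : I} (h : B.comb s = B.h i) : s = e i := by
  set t : I → ℝ := s - s i • e i with ht
  have hti : t i = 0 := by simp [ht, e]
  have ht0 : 0 ≤ t := fun k => by
    by_cases hk : k = i
    · subst hk
      exact hti.ge
    · simpa [ht, e, hk] using hs k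
  have hc : B.comb t = (1 - s i) • B.h i := by
    rw [ht, map_sub, map_smul, comb_e, h, sub_smul, one_smul]
  have hi1 : 1 ≤ s i := by
    by_contra! hlt
    have hpos : 0 < 1 - s i := by linarith
    refine B.eq_zero_of_comb_eq_h (r := (1 - s i)⁻¹ • t)
      (smul_nonneg (inv_nonneg.2 hpos.le) ht0) (j := i) (by simp [hti]) ?_
    rw [map_smul, hc, inv_smul_smul₀ hpos.ne']
  have h0 : t + (s i - 1) • e i = 0 := by
    refine B.posIndep _ (fun k => ?_) ?_
    · exact add_nonneg (ht0 k) (mul_nonneg (by linarith) (e_nonneg i k))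
    · rw [← comb_apply, map_add, map_smul, hc, comb_e]
      module
  have h1 : s i = 1 := by
    have := congrFun h0 i
    simp [hti, e] at this
    linarith
  rw [h1, sub_self, zero_smul, add_zero, ht, h1, one_smul, sub_eq_zero] at h0
  exact h0

theorem dualAct_act_comb [FiniteDimensional ℝ 𝔥] (g : CoxGroup B.isGCM) (v : I → ℝ) :
    dualAct (B.act g) (B.comb v) = B.comb (rep B.isGCM g v) := by
  rw [← sub_eq_zero, ← Module.forall_dual_apply_eq_zero_iff ℝ]
  intro l
  obtain ⟨l, rfl⟩ := (B.act g).surjective l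
  rw [map_sub, apply_dualAct, act_apply_comb_rep, sub_self]

theorem interTwist_act [FiniteDimensional ℝ 𝔥] (J K : Set I) (g : CoxGroup B.isGCM) :
    B.interTwist J (B.act g) K = twist B.isGCM J g K := by
  ext i
  refine and_congr_right fun _ => exists_congr fun j => and_congr_right fun _ => ?_
  constructor
  · intro h
    have h1 : dualAct (B.act g) (B.h j) ∈ closedRay (B.h i) := by
      rw [← h]
      exact ⟨_, ⟨1, zero_le_one, (one_smul ℝ _).symm⟩, rfl⟩
    obtain ⟨r, hr, he⟩ := h1
    rw [← comb_e, dualAct_act_comb] at he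
    have hr0 : r ≠ 0 := by
      rintro rfl
      have h2 := B.act_apply_comb_rep g (B.α j) (e j)
      rw [he, zero_smul, map_zero, comb_e, B.α_h, B.isGCM.diag] at h2
      norm_num at h2
    have hrpos : 0 < r := lt_of_le_of_ne hr hr0.symm
    refine ⟨r, hrpos, ?_⟩
    have h3 := B.rep_nonneg_of_comb_eq hrpos he
    have h4 := B.eq_e_of_comb_eq_h (s := r⁻¹ • rep B.isGCM g (e j)) (i := i)
      (smul_nonneg (inv_nonneg.2 hr) h3) (by rw [map_smul, he, inv_smul_smul₀ hr0])
    rw [← h4, smul_inv_smul₀ hr0]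
  · rintro ⟨r, hr, he⟩
    have h1 : ∀ t : ℝ, dualAct (B.act g) (t • B.h j) = (t * r) • B.h i := fun t => by
      rw [← comb_e, ← map_smul, dualAct_act_comb, map_smul, he, map_smul, map_smul, comb_e,
        smul_smul]
    ext x
    constructor
    · rintro ⟨_, ⟨t, ht, rfl⟩, rfl⟩
      exact ⟨t * r, mul_nonneg ht hr.le, h1 t⟩
    · rintro ⟨t, ht, rfl⟩
      refine ⟨_, ⟨t / r, div_nonneg ht hr.le, rfl⟩, ?_⟩
      rw [h1, div_mul_cancel₀ _ hr.ne']

theorem IsMinDoubleCosetRep.exists_act [FiniteDimensional ℝ 𝔥] {J K : Set I}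
    {τ : Dual ℝ 𝔥 ≃ₗ[ℝ] Dual ℝ 𝔥} (hτ : B.IsMinDoubleCosetRep J K τ) :
    ∃ g, B.act g = τ ∧ (∀ i ∈ J, 0 ≤ rep B.isGCM g⁻¹ (e i)) ∧
      ∀ i ∈ K, 0 ≤ rep B.isGCM g (e i) := by
  obtain ⟨hW, hmin⟩ := hτ
  obtain ⟨g, rfl⟩ := B.mem_W.1 hW
  refine ⟨g, rfl, fun i hi => (rep_nonneg_iff _ _ i).2 fun hd => ?_,
    fun i hi => (rep_nonneg_iff _ _ i).2 fun hd => ?_⟩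
  · rw [CoxeterSystem.isRightDescent_inv_iff] at hd
    have h1 := hmin _ (B.mem_parabolic.2 ⟨_, simple_mem_para _ hi, rfl⟩) 1 (one_mem _)
    rw [mul_one, ← map_mul, length_act, length_act] at h1
    exact absurd hd (not_lt.2 h1)
  · have h1 := hmin 1 (one_mem _) _ (B.mem_parabolic.2 ⟨_, simple_mem_para _ hi, rfl⟩)
    rw [one_mul, ← map_mul, length_act, length_act] at h1
    exact absurd hd (not_lt.2 h1)

section DoubleCoset

variable {Θ₁ Θ₂ : Set I} {g : CoxGroup B.isGCM}

/-- Put Q = M^∞, which contains Θ₁ and Θ₂. The rest M \ Q is orthogonal to Q, hence inside Θ₂^⊥, so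
minimality of g makes g positive on it; therefore g ∈ W_Q and M = Q. -/
theorem hasAntidominant_union_red [FiniteDimensional ℝ 𝔥] (hs₁ : HasAntidominant B.A Θ₁)
    (hs₂ : HasAntidominant B.A Θ₂)
    (hg₂ : ∀ i ∈ Θ₂ ∪ perp B.A Θ₂, 0 ≤ rep B.isGCM g (e i)) :
    HasAntidominant B.A (Θ₁ ∪ Θ₂ ∪ B.red (B.act g)) := by
  set M := Θ₁ ∪ Θ₂ ∪ B.red (B.act g) with hM
  set Q := infPart B.A M with hQ
  have h1 : Θ₁ ⊆ Q := subset_infPart B.isGCM hs₁ fun i hi => Or.inl (Or.inl hi)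
  have h2 : Θ₂ ⊆ Q := subset_infPart B.isGCM hs₂ fun i hi => Or.inl (Or.inr hi)
  have hgM : g ∈ para B.isGCM (M \ Q ∪ Q) := by
    rw [Set.sdiff_union_of_subset (infPart_subset), ← red_act_subset_iff]
    exact fun i hi => Or.inr hi
  have hgQ : g ∈ para B.isGCM Q := by
    refine mem_para_of_nonneg_of_perp B.isGCM (fun i hi j hj => ?_) hgM fun i hi => hg₂ i ?_
    · exact eq_zero_of_mem_infPart hi hj.1 hj.2
    · exact Or.inr fun j hj =>
        (eq_zero_comm B.isGCM).1 (eq_zero_of_mem_infPart (h2 hj) hi.1 hi.2)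
  have hMQ : M ⊆ Q := Set.union_subset (Set.union_subset h1 h2) (B.red_act_subset_iff.2 hgQ)
  rw [← infPart_subset.antisymm hMQ]
  exact hasAntidominant_infPart B.isGCM M

theorem R_inter_image_R [FiniteDimensional ℝ 𝔥] (hs₁ : HasAntidominant B.A Θ₁)
    (hs₂ : HasAntidominant B.A Θ₂)
    (hg₁ : ∀ i ∈ Θ₁ ∪ perp B.A Θ₁, 0 ≤ rep B.isGCM g⁻¹ (e i))
    (hg₂ : ∀ i ∈ Θ₂ ∪ perp B.A Θ₂, 0 ≤ rep B.isGCM g (e i)) :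
    B.R Θ₁ ∩ B.act g '' B.R Θ₂ = B.R (Θ₁ ∪ Θ₂ ∪ B.red (B.act g)) := by
  have hsM := B.hasAntidominant_union_red hs₁ hs₂ hg₂
  set M := Θ₁ ∪ Θ₂ ∪ B.red (B.act g) with hM
  have h1 : Θ₁ ⊆ M := fun i hi => Or.inl (Or.inl hi)
  have h2 : Θ₂ ⊆ M := fun i hi => Or.inl (Or.inr hi)
  have hgM : g ∈ para B.isGCM M := B.red_act_subset_iff.1 fun i hi => Or.inr hi
  ext l
  constructor
  · rintro ⟨hl1, l', hl', hll'⟩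
    rw [mem_R_iff _ hs₁] at hl1
    rw [mem_R_iff _ hs₂] at hl'
    obtain ⟨w, hw, x, hx, hxM, rfl⟩ := B.exists_dominant hl1.1 M
    obtain ⟨⟨a, ha, n, hn, hwn⟩, hx1⟩ := B.exists_eq_mul_of_vanish hs₁ h1 hxM hw hl1.2
    have hl'' : l' = B.act (g⁻¹ * w) x := by
      rw [act_mul_apply, ← hll', act_inv_apply_self]
    obtain ⟨⟨b, hb, n', hn', hwn'⟩, hx2⟩ := B.exists_eq_mul_of_vanish hs₂ h2 hxM
      (mul_mem (inv_mem hgM) hw) (hl'' ▸ hl'.2)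
    -- The left side lies in the parabolic of the zeros of x, the right side in the double coset of
    -- g.
    have he : n * n'⁻¹ = a⁻¹ * g * b := by
      have h3 : w = g * (b * n') := by rw [← hwn', mul_inv_cancel_left]
      have h4 : n = a⁻¹ * w := by rw [hwn, inv_mul_cancel_left]
      rw [h4, h3]
      group
    have hgN := mem_para_of_double_coset B.isGCM hg₁ hg₂ _ _ (mul_mem hn (inv_mem hn')) rfl
      _ (inv_mem (para_mono _ Set.subset_union_right ha)) _
      (para_mono _ Set.subset_union_right hb) he
    have hxz : ∀ i ∈ M, x (B.h i) = 0 := by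
      rintro i ((hi | hi) | hi)
      · exact hx1 i hi
      · exact hx2 i hi
      · exact (B.red_act_subset_iff.2 hgN hi).2
    rw [B.act_eq_self hw hxz, mem_R_iff _ hsM]
    exact ⟨hx, hxz⟩
  · intro hl
    rw [mem_R_iff _ hsM] at hl
    refine ⟨(B.mem_R_iff hs₁).2 ⟨hl.1, fun i hi => hl.2 i (h1 hi)⟩, l,
      (B.mem_R_iff hs₂).2 ⟨hl.1, fun i hi => hl.2 i (h2 hi)⟩, B.act_eq_self hgM hl.2⟩

/-- Rigidity applied to g⁻¹. It follows that g fixes e_i for i in this special part, so the index j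
matched with i is i itself. -/
theorem mem_para_perp_infPart_twist :
    g ∈ para B.isGCM (perp B.A (infPart B.A (twist B.isGCM Θ₁ g Θ₂))) := by
  rw [← inv_mem_iff]
  refine mem_para_perp B.isGCM (hasAntidominant_infPart B.isGCM _) _ _ rfl fun i hi => ?_
  obtain ⟨_, j, _, r, hr, he⟩ := infPart_subset hi
  refine ⟨j, r⁻¹, inv_pos.2 hr, ?_⟩
  rw [eq_inv_smul_iff₀ hr.ne', ← map_smul, ← he, rep_inv_apply_self]

theorem infPart_twist_subset_left : infPart B.A (twist B.isGCM Θ₁ g Θ₂) ⊆ Θ₁ :=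
  fun _ hi => (infPart_subset hi).1

theorem infPart_twist_subset_right : infPart B.A (twist B.isGCM Θ₁ g Θ₂) ⊆ Θ₂ := by
  intro i hi
  obtain ⟨_, j, hj, r, hr, he⟩ := infPart_subset hi
  have h1 := rep_e_of_mem_para_perp B.isGCM (inv_mem B.mem_para_perp_infPart_twist) hi
  have h2 : e i = r⁻¹ • e j := by
    rw [eq_inv_smul_iff₀ hr.ne', ← h1, ← map_smul, ← he, rep_inv_apply_self]
  rwa [eq_of_e_eq_smul_e h2]

/-- The facial closure K of T stays in Θ₁ and Θ₂ and is special. Positivity of g on K improves g ∈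
W_{T^⊥} to g ∈ W_{K^⊥}; so g fixes the roots of K, and K is contained in T. -/
theorem isFacial_infPart_twist [FiniteDimensional ℝ 𝔥] (hf₁ : B.IsFacial Θ₁)
    (hf₂ : B.IsFacial Θ₂) (hg₂ : ∀ i ∈ Θ₂ ∪ perp B.A Θ₂, 0 ≤ rep B.isGCM g (e i)) :
    B.IsFacial (infPart B.A (twist B.isGCM Θ₁ g Θ₂)) := by
  set T := infPart B.A (twist B.isGCM Θ₁ g Θ₂) with hT
  set K := B.facialClosure T with hK
  have hK1 : K ⊆ Θ₁ := B.facialClosure_subset hf₁ B.infPart_twist_subset_left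
  have hK2 : K ⊆ Θ₂ := B.facialClosure_subset hf₂ B.infPart_twist_subset_right
  have hsK : HasAntidominant B.A K :=
    B.hasAntidominant_facialClosure (hasAntidominant_infPart B.isGCM _)
  have hgK : g ∈ para B.isGCM (perp B.A K) := by
    refine mem_para_of_nonneg_of_perp B.isGCM (S := K) subset_rfl
      (para_mono _ (fun i (hi : i ∈ perp B.A T) => ?_) B.mem_para_perp_infPart_twist)
      fun i hi => hg₂ i (Or.inl (hK2 hi))
    by_cases hiK : i ∈ K
    · exact Or.inl hiK
    · exact Or.inr (B.mem_perp_facialClosure hi hiK)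
  have hKT : K ⊆ T := subset_infPart B.isGCM hsK fun k hk =>
    ⟨hK1 hk, k, hK2 hk, 1, one_pos, by
      rw [rep_e_of_mem_para_perp B.isGCM hgK hk, one_smul]⟩
  rw [(B.subset_facialClosure T).antisymm hKT]
  exact B.isFacial_facialClosure T

theorem R_subset_R_infPart_twist (hs₁ : HasAntidominant B.A Θ₁) :
    B.R Θ₁ ⊆ B.R (infPart B.A (twist B.isGCM Θ₁ g Θ₂)) := fun l hl => by
  rw [mem_R_iff _ hs₁] at hl
  exact (B.mem_R_iff (hasAntidominant_infPart B.isGCM _)).2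
    ⟨hl.1, fun i hi => hl.2 i (B.infPart_twist_subset_left hi)⟩

theorem image_R_subset_R_infPart_twist (hs₂ : HasAntidominant B.A Θ₂) :
    B.act g '' B.R Θ₂ ⊆ B.R (infPart B.A (twist B.isGCM Θ₁ g Θ₂)) := by
  rintro _ ⟨l, hl, rfl⟩
  rw [mem_R_iff _ hs₂] at hl
  refine (B.mem_R_iff (hasAntidominant_infPart B.isGCM _)).2
    ⟨B.act_mem_titsCone g hl.1, fun i hi => ?_⟩
  rw [act_apply_h, rep_e_of_mem_para_perp B.isGCM (inv_mem B.mem_para_perp_infPart_twist) hi,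
    comb_e]
  exact hl.2 i (B.infPart_twist_subset_right hi)

theorem R_infPart_twist_subset [FiniteDimensional ℝ 𝔥] (hs₁ : HasAntidominant B.A Θ₁)
    (hs₂ : HasAntidominant B.A Θ₂) (hf₁ : B.IsFacial Θ₁) (hf₂ : B.IsFacial Θ₂)
    (hg₁ : ∀ i ∈ Θ₁ ∪ perp B.A Θ₁, 0 ≤ rep B.isGCM g⁻¹ (e i))
    (hg₂ : ∀ i ∈ Θ₂ ∪ perp B.A Θ₂, 0 ≤ rep B.isGCM g (e i))
    {F : Set (Dual ℝ 𝔥)} (hF : F ∈ faceSet B.titsCone) (hF₁ : B.R Θ₁ ⊆ F)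
    (hF₂ : B.act g '' B.R Θ₂ ⊆ F) : B.R (infPart B.A (twist B.isGCM Θ₁ g Θ₂)) ⊆ F := by
  set P := twist B.isGCM Θ₁ g Θ₂ with hP
  set T := infPart B.A P with hT
  have hsT : HasAntidominant B.A T := hasAntidominant_infPart B.isGCM P
  obtain ⟨x, hxC, hx⟩ := B.exists_mem_chamber_of_isFacial hf₁
  obtain ⟨y, hyC, hy⟩ := B.exists_mem_chamber_of_isFacial hf₂
  have hxX := B.chamber_subset_titsCone hxC
  have hyX := B.act_mem_titsCone g (B.chamber_subset_titsCone hyC)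
  have hxF : x ∈ F := hF₁ ((B.mem_R_iff hs₁).2 ⟨hxX, fun i hi => (hx i).2 hi⟩)
  have hyF : B.act g y ∈ F := hF₂ ⟨y, (B.mem_R_iff hs₂).2
    ⟨B.chamber_subset_titsCone hyC, fun i hi => (hy i).2 hi⟩, rfl⟩
  have hm := hF.2.1 hxF hyF (by norm_num : (0 : ℝ) ≤ 1 / 2) (by norm_num : (0 : ℝ) ≤ 1 / 2)
    (by norm_num)
  obtain ⟨w, μ, hμ, hw⟩ := B.mem_titsCone.1 (hF.1.subset hm)
  have hμe : (1 / 2 : ℝ) • B.act w⁻¹ x + (1 / 2 : ℝ) • B.act w⁻¹ (B.act g y) = μ := by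
    rw [← map_smul, ← map_smul, ← map_add, hw, act_inv_apply_self]
  have hF' := B.image_mem_faceSet w⁻¹ hF
  have hμF' : μ ∈ B.act w⁻¹ '' F := ⟨_, hm, by rw [hw, act_inv_apply_self]⟩
  have hRD := B.R_infPart_subset hF' hμF' hμ
  set D := infPart B.A {i | μ (B.h i) = 0} with hD
  have hsD : HasAntidominant B.A D := hasAntidominant_infPart B.isGCM _
  have hDsub : D ⊆ {i | μ (B.h i) = 0} := infPart_subset
  have hμD : ∀ i ∈ D, μ (B.h i) = 0 := fun i hi => hDsub hi
  have hxD := B.vanish_of_mem_openSegment hsD (B.act_mem_titsCone w⁻¹ hxX)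
    (B.act_mem_titsCone w⁻¹ hyX) hμD ⟨1 / 2, 1 / 2, by norm_num, by norm_num, by norm_num, hμe⟩
  have hyD := B.vanish_of_mem_openSegment hsD (B.act_mem_titsCone w⁻¹ hyX)
    (B.act_mem_titsCone w⁻¹ hxX) hμD
    ⟨1 / 2, 1 / 2, by norm_num, by norm_num, by norm_num, by rw [add_comm, hμe]⟩
  rw [← act_mul_apply] at hyD
  have hall : ∀ u, u ∈ para B.isGCM Set.univ := fun u => by
    rw [para_univ]
    trivial
  obtain ⟨⟨a, ha, n, hn, hwa⟩, hD1⟩ := B.exists_eq_mul_of_vanish hsD (Set.subset_univ _)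
    (fun k _ => hxC k) (hall _) hxD
  obtain ⟨⟨b, hb, n', hn', hwb⟩, hD2⟩ := B.exists_eq_mul_of_vanish hsD (Set.subset_univ _)
    (fun k _ => hyC k) (hall _) hyD
  simp only [Set.mem_univ, true_and, hx, Set.ofPred_mem_eq] at hn hD1
  simp only [Set.mem_univ, true_and, hy, Set.ofPred_mem_eq] at hn' hD2
  have hw1 : w = n⁻¹ * a⁻¹ := by rw [← mul_inv_rev, ← hwa, inv_inv]
  have hw2 : g⁻¹ * w = n'⁻¹ * b⁻¹ := by
    rw [← mul_inv_rev, ← hwb, mul_inv_rev, inv_inv]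
  have hsupp : ∀ {S : Set I} {u : CoxGroup B.isGCM} {j : I}, u ∈ para B.isGCM S → j ∈ S →
      ∀ k, k ∉ S → rep B.isGCM u (e j) k = 0 := by
    intro S u j hu hj k hk
    rw [rep_apply_of_notMem B.isGCM hu hk]
    simp [e, show k ≠ j from fun h => hk (h ▸ hj)]
  -- The two factorizations place w(e_j) in the span of Θ₁ and g⁻¹w(e_j) in that of Θ₂; as the
  -- latter root has constant sign, its image under g is supported on the twist P.
  have hwD : ∀ j ∈ D, ∀ k, k ∉ P → rep B.isGCM w (e j) k = 0 := by
    intro j hj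
    have h1 : ∀ k, k ∉ Θ₁ → rep B.isGCM w (e j) k = 0 := by
      rw [hw1, rep_mul_apply, rep_e_of_mem_para_perp B.isGCM (inv_mem ha) hj]
      exact hsupp (inv_mem hn) (hD1 j hj)
    have h2 : ∀ k, k ∉ Θ₂ → rep B.isGCM (g⁻¹ * w) (e j) k = 0 := by
      rw [hw2, rep_mul_apply, rep_e_of_mem_para_perp B.isGCM (inv_mem hb) hj]
      exact hsupp (inv_mem hn') (hD2 j hj)
    have h3 : rep B.isGCM g (rep B.isGCM (g⁻¹ * w) (e j)) = rep B.isGCM w (e j) := by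
      rw [← rep_mul_apply, mul_inv_cancel_left]
    have hJ : ∀ i ∈ Θ₁, 0 ≤ rep B.isGCM g⁻¹ (e i) := fun i hi => hg₁ i (Or.inl hi)
    have hK : ∀ i ∈ Θ₂, 0 ≤ rep B.isGCM g (e i) := fun i hi => hg₂ i (Or.inl hi)
    rw [← h3] at h1 ⊢
    rcases rep_nonneg_or_nonpos B.isGCM (g⁻¹ * w) j with h | h
    · exact rep_apply_eq_zero_of_notMem_twist B.isGCM hJ hK h h2 h1
    · have := rep_apply_eq_zero_of_notMem_twist B.isGCM hJ hK (neg_nonneg.2 h)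
        (by simpa using h2) (by simpa using h1)
      simpa using this
  -- With w' minimal in W_P w, the roots w'(e_j), j ∈ D, are multiples of simple roots in P.
  -- Rigidity then gives w' ∈ W_{D^⊥}, so these roots are fixed and D ⊆ P.
  obtain ⟨p, w', hp, hpw, hw'⟩ := exists_eq_para_mul B.isGCM P w
  have hw'D : ∀ j ∈ D, ∃ k ∈ P, ∃ r : ℝ, 0 < r ∧ rep B.isGCM w' (e j) = r • e k := by
    intro j hj
    have := rep_inv_e_eq_smul B.isGCM (g := w'⁻¹) hw' (i := j) fun k hk => by
      have h1 : w' = p⁻¹ * w := by rw [hpw, inv_mul_cancel_left]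
      rw [inv_inv, h1, rep_mul_apply, rep_apply_of_notMem B.isGCM (inv_mem hp) hk]
      exact hwD j hj k hk
    rwa [inv_inv] at this
  have hw'perp : w' ∈ para B.isGCM (perp B.A D) :=
    mem_para_perp B.isGCM hsD _ w' rfl fun j hj =>
      let ⟨k, _, r, hr, he⟩ := hw'D j hj
      ⟨k, r, hr, he⟩
  have hDT : D ⊆ T := subset_infPart B.isGCM hsD fun j hj => by
    obtain ⟨k, hk, r, hr, he⟩ := hw'D j hj
    rw [rep_e_of_mem_para_perp B.isGCM hw'perp hj] at he
    rwa [eq_of_e_eq_smul_e he]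
  intro l hl
  rw [mem_R_iff _ hsT] at hl
  -- For j ∈ D the root w(e_j) = p(e_j) is supported on T, since the factor of p in W_{P \ T} fixes
  -- e_j; hence w⁻¹l vanishes on D.
  have hlF : B.act w⁻¹ l ∈ B.act w⁻¹ '' F := by
    refine hRD ((B.mem_R_iff hsD).2 ⟨B.act_mem_titsCone _ hl.1, fun j hj => ?_⟩)
    obtain ⟨t, ht, q, hq, rfl⟩ := exists_eq_mul_of_mem_para_union B.isGCM (S := P \ T) (T := T)
      (fun i hi k hk => eq_zero_of_mem_infPart hi hk.1 hk.2)
      (by rwa [Set.sdiff_union_of_subset infPart_subset] : p ∈ _)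
    have hPT : P \ T ⊆ perp B.A T := fun k hk i hi =>
      (eq_zero_comm B.isGCM).1 (eq_zero_of_mem_infPart hi hk.1 hk.2)
    have hq' : q ∈ para B.isGCM (perp B.A T) := para_mono _ hPT hq
    rw [act_apply_h, inv_inv, hpw, rep_mul_apply, rep_e_of_mem_para_perp B.isGCM hw'perp hj,
      rep_mul_apply, rep_e_of_mem_para_perp B.isGCM hq' (hDT hj), apply_comb]
    refine Finset.sum_eq_zero fun k _ => ?_
    by_cases hk : k ∈ T
    · rw [hl.2 k hk, mul_zero]
    · rw [hsupp ht (hDT hj) k hk, zero_mul]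
  obtain ⟨l', hl', he⟩ := hlF
  rwa [(B.act w⁻¹).injective he] at hl'

end DoubleCoset

end RootBase

theorem mainTheorem11 {I : Type*} [Fintype I] {𝔥 : Type*} [AddCommGroup 𝔥] [Module ℝ 𝔥]
    [FiniteDimensional ℝ 𝔥] (B : RootBase I 𝔥) (Θ₁ Θ₂ : Set I)
    (hs₁ : GCM.IsSpecial B.A Θ₁) (hf₁ : B.IsFacial Θ₁)
    (hs₂ : GCM.IsSpecial B.A Θ₂) (hf₂ : B.IsFacial Θ₂)
    (τ : Module.Dual ℝ 𝔥 ≃ₗ[ℝ] Module.Dual ℝ 𝔥)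
    (hτ : B.IsMinDoubleCosetRep (Θ₁ ∪ GCM.perp B.A Θ₁) (Θ₂ ∪ GCM.perp B.A Θ₂) τ) :
    GCM.IsSpecial B.A (Θ₁ ∪ Θ₂ ∪ B.red τ) ∧
    (GCM.IsSpecial B.A (B.facialClosure (Θ₁ ∪ Θ₂ ∪ B.red τ)) ∧
      B.IsFacial (B.facialClosure (Θ₁ ∪ Θ₂ ∪ B.red τ))) ∧
    (GCM.IsSpecial B.A (GCM.infPart B.A (B.interTwist Θ₁ τ Θ₂)) ∧
      B.IsFacial (GCM.infPart B.A (B.interTwist Θ₁ τ Θ₂))) ∧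
    (B.R Θ₁ ∈ faceSet B.titsCone ∧ τ '' B.R Θ₂ ∈ faceSet B.titsCone) ∧
    B.R Θ₁ ∩ τ '' B.R Θ₂ = B.R (B.facialClosure (Θ₁ ∪ Θ₂ ∪ B.red τ)) ∧
    IsLeast {F | F ∈ faceSet B.titsCone ∧ B.R Θ₁ ⊆ F ∧ τ '' B.R Θ₂ ⊆ F}
      (B.R (GCM.infPart B.A (B.interTwist Θ₁ τ Θ₂))) := by
  have hs := @GCM.isSpecial_iff I _ B.A B.isGCM
  rw [hs] at hs₁ hs₂
  obtain ⟨g, rfl, hg₁, hg₂⟩ := RootBase.IsMinDoubleCosetRep.exists_act B hτ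
  have hM := B.hasAntidominant_union_red hs₁ hs₂ hg₂
  rw [B.interTwist_act]
  refine ⟨hs.2 hM, ⟨hs.2 (B.hasAntidominant_facialClosure hM), B.isFacial_facialClosure _⟩,
    ⟨GCM.isSpecial_infPart B.isGCM _, B.isFacial_infPart_twist hf₁ hf₂ hg₂⟩,
    ⟨B.R_mem_faceSet hs₁, B.image_mem_faceSet g (B.R_mem_faceSet hs₂)⟩, ?_, ⟨?_, ?_⟩, ?_⟩
  · rw [B.R_facialClosure hM]
    exact B.R_inter_image_R hs₁ hs₂ hg₁ hg₂
  · exact B.R_mem_faceSet (GCM.hasAntidominant_infPart B.isGCM _)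
  · exact ⟨B.R_subset_R_infPart_twist hs₁, B.image_R_subset_R_infPart_twist hs₂⟩
  · rintro F ⟨hF, hF₁, hF₂⟩
    exact B.R_infPart_twist_subset hs₁ hs₂ hf₁ hf₂ hg₁ hg₂ hF hF₁ hF₂
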